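/- Let $\Sigma=\mathbb F_2$, let $\Sigma^*$ be the set of finite words over $\Sigma$ (the binary rooted tree), and let $G=\langle a,b,c,d\rangle$ be Grigorchuk's group, where $a,b,c,d$ are the bijections of $\Sigma^*$ fixing the empty word with $$a(s w)=(1-s)w,\quad b(0w)=0a(w),\ b(1w)=1c(w),\quad c(0w)=0a(w),\ c(1w)=1d(w),\quad d(0w)=0w,\ d(1w)=1b(w)$$ for $s\in\Sigma$, $w\in\Sigma^*$. Write $[g,h]=ghg^{-1}h^{-1}$, $\gamma_1(G)=G$, $\gamma_{n+1}(G)=[\gamma_n(G),G]$. Let $x=[a,b]$, let $K=\langle x\rangle^G$ and $T=\langle x^2\rangle^G$ be the subgroups generated by the $G$-conjugates of $x$ and of $x^2$. For a group $Q$ of bijections of $\Sigma^*$ let $Q_m=Q\times\dots\times Q$ ($2^m$ factors) act on the subtrees rooted at the $2^m$ words of length $m$, one factor on each. For $m\ge1$ put $N_m=K_m\cdot T_{m-1}$. For $n\ge0$ let $V_n=\mathbb F_2[X_1,\dots,X_n]/(X_1^2-1,\dots,X_n^2-1)$, where the word $\sigma=\sigma_1\cdots\sigma_n$ corresponds to the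 monomial $X_1^{\sigma_1}\cdots X_n^{\sigma_n}$. For $0\le r<2^n$ with binary digits $r=r_n\dots r_1$ put $v_n^r=(1-X_1)^{r_1}\cdots(1-X_n)^{r_n}$ and $V_n^r=\langle v_n^r,\dots,v_n^{2^n-1}\rangle$; put $V_n^r=0$ for $r\ge2^n$. **Theorem.** For all $m\ge1$: 1. $\gamma_{2^m+1}(G)=N_m$. 2. There is a (necessarily unique) isomorphism $\alpha\oplus\beta:N_m/N_{m+1}\to V_m\oplus V_{m-1}$ that sends the class of $(1,\dots,1,x,1,\dots,1)\in K_m$, with $x$ at the word $\sigma$ of length $m$, to $(\sigma,0)$, and the class of $(1,\dots,1,x^2,1,\dots,1)\in T_{m-1}$, with $x^2$ at the word $\tau$ of length $m-1$, to $(0,\tau)$. For $W\le V_m$ let $\alpha^{-1}(W)\subseteq N_m$ be the preimage of $W\oplus0$, and for $W\le V_{m-1}$ let $\beta^{-1}(W)\subseteq N_m$ be the preimage of $0\oplus W$. Then for $0\le r\le2^m$ $$\gamma_{2^m+1+r}(G)=N_{m+1}\,\alpha^{-1}(V_m^r)\,\beta^{-1}(V_{m-1}^r).$$ 3. The rank (minimal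 number of generators) of $\gamma_n(G)/\gamma_{n+1}(G)$ is $3$ if $n=1$; $2$ if $n=2$; $2$ if $n=2^m+1+r$ with $0\le r<2^{m-1}$; and $1$ if $n=2^m+1+r$ with $2^{m-1}\le r<2^m$. Consequently $G$, which is residually-$2$ (every $g\ne1$ in $G$ lies outside some normal subgroup of $2$-power index), has finite $C$-width: there is a constant $B$ with $[\gamma_n(G):\gamma_{n+1}(G)]\le B$ for all $n\ge1$. -/

import Mathlib

open scoped Pointwise

namespace Grigorchuk

noncomputable section

/-! ### The tree and the four generators -/

/-- The vertices of the binary rooted tree: finite words over `F_2`. The first letter of a word is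
the one next to the root. -/
abbrev Word : Type := List (ZMod 2)

/-- The action of `a`: change the first letter. -/
def aFun : Word → Word
  | [] => []
  | s :: w => (1 - s) :: w

mutual
/-- The action of `b`: `b (0 w) = 0 a(w)`, `b (1 w) = 1 c(w)`. -/
def bFun : Word → Word
  | [] => []
  | s :: w => if s = 0 then s :: aFun w else s :: cFun w
/-- The action of `c`: `c (0 w) = 0 a(w)`, `c (1 w) = 1 d(w)`. -/
def cFun : Word → Word
  | [] => []
  | s :: w => if s = 0 then s :: aFun w else s :: dFun w
/-- The action of `d`: `d (0 w) = 0 w`, `d (1 w) = 1 b(w)`. -/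
def dFun : Word → Word
  | [] => []
  | s :: w => if s = 0 then s :: w else s :: bFun w
end

theorem aFun_invol : Function.Involutive aFun := by
  intro w
  cases w with
  | nil => rfl
  | cons s w => simp [aFun]

theorem bcdFun_invol (w : Word) :
    bFun (bFun w) = w ∧ cFun (cFun w) = w ∧ dFun (dFun w) = w := by
  induction w with
  | nil => simp [bFun, cFun, dFun]
  | cons s w ih =>
    obtain ⟨hb, hc, hd⟩ := ih
    have ha := aFun_invol w
    by_cases h : s = 0 <;> simp [bFun, cFun, dFun, h, ha, hb, hc, hd]

def a : Equiv.Perm Word := Function.Involutive.toPerm aFun aFun_invol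
def b : Equiv.Perm Word := Function.Involutive.toPerm bFun fun w => (bcdFun_invol w).1
def c : Equiv.Perm Word := Function.Involutive.toPerm cFun fun w => (bcdFun_invol w).2.1
def d : Equiv.Perm Word := Function.Involutive.toPerm dFun fun w => (bcdFun_invol w).2.2

/-- Grigorchuk's group `G = ⟨a, b, c, d⟩`, as a group of bijections of the set of words. -/
def G : Subgroup (Equiv.Perm Word) := Subgroup.closure {a, b, c, d}

/-! ### Acting on subtrees -/

/-- `branch f = (f 0, f 1)`: fixes the root and acts as `f s` on the subtree below the letter
`s`. -/
def branch : (ZMod 2 → Equiv.Perm Word) →* Equiv.Perm Word where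
  toFun f :=
    { toFun := fun w => match w with
        | [] => []
        | s :: w => s :: f s w
      invFun := fun w => match w with
        | [] => []
        | s :: w => s :: (f s)⁻¹ w
      left_inv := by rintro (_ | ⟨s, w⟩) <;> simp
      right_inv := by rintro (_ | ⟨s, w⟩) <;> simp }
  map_one' := by ext1 w; cases w <;> rfl
  map_mul' f g := by ext1 w; cases w <;> rfl

/-- `place σ g` is `(1, …, 1, g, 1, …, 1)`, with `g` at the position of the vertex `σ`:
`σ w ↦ σ g(w)`, and every word that does not begin with `σ` is fixed. -/
def place : Word → Equiv.Perm Word → Equiv.Perm Word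
  | [], g => g
  | s :: σ, g => branch (Pi.mulSingle s (place σ g))

/-- `level Q m` is the group `Q_m = Q × ⋯ × Q` (`2 ^ m` copies), acting on the subtrees rooted at
the vertices of length `m`. -/
def level (Q : Subgroup (Equiv.Perm Word)) : ℕ → Subgroup (Equiv.Perm Word)
  | 0 => Q
  | m + 1 => (Subgroup.pi Set.univ fun _ : ZMod 2 => level Q m).map branch

theorem place_mem_level {Q : Subgroup (Equiv.Perm Word)} {g : Equiv.Perm Word} (hg : g ∈ Q)
    (σ : Word) : place σ g ∈ level Q σ.length := by
  induction σ with
  | nil => exact hg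
  | cons s σ ih =>
    refine Subgroup.mem_map_of_mem branch ?_
    rw [Subgroup.mem_pi]
    intro t _
    by_cases h : t = s
    · subst h; simpa using ih
    · simp [Pi.mulSingle_eq_of_ne h, one_mem]

/-! ### The subgroups `K`, `T` and `N_m` -/

/-- `⟨g⟩^G`: the subgroup generated by the `G`-conjugates of `g`. -/
def conjClosure (g : Equiv.Perm Word) : Subgroup (Equiv.Perm Word) :=
  Subgroup.closure {y | ∃ h ∈ G, y = h * g * h⁻¹}

theorem mem_conjClosure (g : Equiv.Perm Word) : g ∈ conjClosure g :=
  Subgroup.subset_closure ⟨1, one_mem _, by simp⟩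

/-- `x = [a, b]`. -/
def x : Equiv.Perm Word := a * b * a⁻¹ * b⁻¹

/-- `K = ⟨x⟩^G`. -/
def K : Subgroup (Equiv.Perm Word) := conjClosure x

/-- `T = ⟨x²⟩^G`. -/
def T : Subgroup (Equiv.Perm Word) := conjClosure (x ^ 2)

/-- `N_m = K_m T_{m-1}` (used for `m ≥ 1`). -/
def N (m : ℕ) : Subgroup (Equiv.Perm Word) := level K m ⊔ level T (m - 1)

theorem placeX_mem_N (m : ℕ) (σ : Fin m → ZMod 2) : place (List.ofFn σ) x ∈ N m := by
  have h := place_mem_level (mem_conjClosure x) (List.ofFn σ)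
  rw [List.length_ofFn] at h
  exact (le_sup_left : level K m ≤ N m) h

theorem placeXsq_mem_N (m : ℕ) (τ : Fin (m - 1) → ZMod 2) :
    place (List.ofFn τ) (x ^ 2) ∈ N m := by
  have h := place_mem_level (mem_conjClosure (x ^ 2)) (List.ofFn τ)
  rw [List.length_ofFn] at h
  exact (le_sup_right : level T (m - 1) ≤ N m) h

/-- `(1, …, 1, x, 1, …, 1) ∈ K_m` as an element of `N_m`, with `x` at the vertex `σ`. -/
def xAt (m : ℕ) (σ : Fin m → ZMod 2) : N m := ⟨place (List.ofFn σ) x, placeX_mem_N m σ⟩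

/-- `(1, …, 1, x², 1, …, 1) ∈ T_{m-1}` as an element of `N_m`, with `x²` at the vertex `τ`. -/
def xsqAt (m : ℕ) (τ : Fin (m - 1) → ZMod 2) : N m :=
  ⟨place (List.ofFn τ) (x ^ 2), placeXsq_mem_N m τ⟩

/-! ### The modules `V_n` and their filtration -/

/-- `V_n = F_2[X_1, …, X_n] / (X_1² - 1, …, X_n² - 1)`: the group algebra over `F_2` of the group
`(ℤ/2)ⁿ` of exponent vectors of monomials. The index `i : Fin n` stands for `X_{i+1}`. -/
abbrev V (n : ℕ) : Type := AddMonoidAlgebra (ZMod 2) (Fin n → ZMod 2)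

/-- The monomial `X_1^{σ_1} ⋯ X_n^{σ_n}` of the vertex `σ = σ_1 … σ_n`. -/
def monomial {n : ℕ} (σ : Fin n → ZMod 2) : V n := AddMonoidAlgebra.single σ 1

/-- The variable `X_{i+1}`. -/
def X {n : ℕ} (i : Fin n) : V n := monomial (Pi.single i 1)

/-- `v_n^r = (1 - X_1)^{r_1} ⋯ (1 - X_n)^{r_n}`, where `r = r_n … r_1` in base `2`. -/
def v (n r : ℕ) : V n := ∏ i : Fin n, (1 - X i) ^ (r / 2 ^ (i : ℕ) % 2)

/-- `V_n^r`, the span of `v_n^r, …, v_n^{2^n - 1}`; it is `0` for `r ≥ 2^n`. -/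
def Vfil (n r : ℕ) : Submodule (ZMod 2) (V n) :=
  Submodule.span (ZMod 2) {u | ∃ s, r ≤ s ∧ s < 2 ^ n ∧ u = v n s}

/-- `α ⊕ β : N_m / N_{m+1} → V_m ⊕ V_{m-1}` is the isomorphism that sends `(1, …, x, …, 1) ∈ K_m`
to its monomial in `V_m` and `(1, …, x², …, 1) ∈ T_{m-1}` to its monomial in `V_{m-1}`. The
isomorphism is given by the homomorphism `(α, β)` on `N_m`, onto and with kernel `N_{m+1}`; the
four values determine it. -/
structure IsAlphaBeta (m : ℕ) (α : N m →* Multiplicative (V m))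
    (β : N m →* Multiplicative (V (m - 1))) : Prop where
  surjective : Function.Surjective (α.prod β)
  ker_eq : (α.prod β).ker = (N (m + 1)).subgroupOf (N m)
  alpha_x : ∀ σ, α (xAt m σ) = Multiplicative.ofAdd (monomial σ)
  beta_x : ∀ σ, β (xAt m σ) = 1
  alpha_xsq : ∀ τ, α (xsqAt m τ) = 1
  beta_xsq : ∀ τ, β (xsqAt m τ) = Multiplicative.ofAdd (monomial τ)

/-- The elements of `N_m` whose class is in `(α ⊕ β)⁻¹(W ⊕ 0)`, that is, in `α⁻¹(W)`. -/
def alphaInv {m : ℕ} (α : N m →* Multiplicative (V m)) (β : N m →* Multiplicative (V (m - 1)))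
    (W : Submodule (ZMod 2) (V m)) : Set (Equiv.Perm Word) :=
  {g | ∃ h : g ∈ N m, (α ⟨g, h⟩).toAdd ∈ W ∧ β ⟨g, h⟩ = 1}

/-- The elements of `N_m` whose class is in `(α ⊕ β)⁻¹(0 ⊕ W)`, that is, in `β⁻¹(W)`. -/
def betaInv {m : ℕ} (α : N m →* Multiplicative (V m)) (β : N m →* Multiplicative (V (m - 1)))
    (W : Submodule (ZMod 2) (V (m - 1))) : Set (Equiv.Perm Word) :=
  {g | ∃ h : g ∈ N m, α ⟨g, h⟩ = 1 ∧ (β ⟨g, h⟩).toAdd ∈ W}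

/-! ### Lower central series, rank, width -/

/-- `γ_n(H)` for `n ≥ 1`: `γ_1(H) = H` and `γ_{n+1}(H) = [γ_n(H), H]`. -/
def gamma (H : Type*) [Group H] (n : ℕ) : Subgroup H :=
  (⊤ : Subgroup H).lowerCentralSeries (n - 1)

instance gamma_normal (H : Type*) [Group H] (n : ℕ) : (gamma H n).Normal := by
  unfold gamma; infer_instance

/-- The lower central factor `γ_n(H) / γ_{n+1}(H)`. -/
abbrev lcFactor (H : Type*) [Group H] (n : ℕ) : Type _ :=
  gamma H n ⧸ (gamma H (n + 1)).subgroupOf (gamma H n)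

/-- The group `Q` is finitely generated and `k` is its minimal number of generators. -/
def HasRank (Q : Type*) [Group Q] (k : ℕ) : Prop :=
  ∃ _ : Group.FG Q, Group.rank Q = k

/-- `H` is residually-`p`: every non-trivial element lies outside some normal subgroup whose index
is a power of `p`. -/
def IsResiduallyP (p : ℕ) (H : Type*) [Group H] : Prop :=
  ∀ g : H, g ≠ 1 → ∃ M : Subgroup H, M.Normal ∧ (∃ k : ℕ, M.index = p ^ k) ∧ g ∉ M

/-- `H` is residually-`p` and of finite `C`-width: the indices `[γ_n(H) : γ_{n+1}(H)]` are finite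
and bounded. -/
def HasFiniteCWidth (p : ℕ) (H : Type*) [Group H] : Prop :=
  IsResiduallyP p H ∧ ∃ B : ℕ, ∀ n : ℕ, 1 ≤ n →
    (gamma H (n + 1)).relIndex (gamma H n) ≠ 0 ∧ (gamma H (n + 1)).relIndex (gamma H n) ≤ B

/-- `γ_n(G)` for Grigorchuk's group `G`, as a set of bijections of the set of words. -/
def gammaG (n : ℕ) : Subgroup (Equiv.Perm Word) := (gamma G n).map G.subtype

end

end Grigorchuk

/-!
Write `(g, h)` for the bijection of words that acts as `g` below the letter `0` and as `h` below the
letter `1`. Then `x = (c a, a c)`, and the identities `[x, a] = [x, b] = x²` and `[x, d] = (1, x)`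
drive the whole argument.

*Coordinates.* Every element of `G` has a label in `𝔽₂` at every vertex, and the sums of labels over
the `2 ^ n` vertices lying `n` levels below a vertex `u` satisfy a cocycle identity
(`parity_mul`). On `N_m`, which fixes the level `m + 1`, suitable sums of this kind give
homomorphisms: one for each vertex of level `m`, detecting `x` (`alphaFun`), and one for each vertex
of level `m - 1`, detecting `x²` (`betaFun`). They are compatible with the action of `G` on the tree
by `alphaFun_conj` and `betaFun_conj`, they separate the elements of `N_m / N_{m+1}` by
`mem_N_succ_of_coord_eq_zero`, and they take all values by `exists_coord_eq`. So `N_m / N_{m+1}` is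
the permutation module `V_m ⊕ V_{m-1}`. Injectivity rests on two facts: `x` is central of order `2`
in `G / N_1`, and `x²` is central of order `2` in `G / N_2`.

*The filtration.* Splitting a function on the words of length `n` according to the first letter turns
`V_n^r` into a recursively defined condition (`InFil`, `toV_mem_Vfil`). From the recursions
`b = (a, c)`, `c = (a, d)`, `d = (1, b)` it follows by induction on `n` that the differences
`f - f ∘ y`, with `f ∈ V_n^r` and `y` a generator, lie in `V_n^{r+1}` (`InFil.delta`) and span it
(`mem_of_containsDeltas`). The delicate point is that for even `r` only `a` acts nontrivially from
`V_n^r / V_n^{r+1}` to `V_n^{r+1} / V_n^{r+2}`, while for odd `r` only `b`, `c`, `d` do.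

*The lower central series.* Let `layer m r` be the group of the elements of `N_{m+1}` with both
coordinates of degree at least `r`. For `r < 2 ^ (m + 1)` it contains `(x, …, x)`, with one `x` at
each vertex of level `m + 1`. The commutators of this element with `b`, `c`, `d` produce single
copies of `x²` at level `m + 1` and of `x` at level `m + 2`; since `G` is transitive on levels and
self-replicating, these generate `N_{m+2}` as a normal subgroup (`N_le_layer_commutator`). Together
with the statement on the filtration this gives `[layer m r, G] = layer m (r + 1)`
(`layer_commutator`). As `γ_3(G) = N_1` (`gammaG_three`), all terms of the lower central series are
known. Their ranks follow because each `V_n^r / V_n^{r+1}` with `r < 2 ^ n` is one-dimensional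
(`exists_functional`), and `G` is residually-`2` because `N_m` fixes the level `m + 1`.
-/

open scoped commutatorElement

namespace Grigorchuk

/-! ### Pairs of tree bijections -/

theorem zmod2_cases (s : ZMod 2) : s = 0 ∨ s = 1 := by
  revert s; decide

/-- `pair g h = (g, h)` acts as `g` below the letter `0` and as `h` below the letter `1`. -/
noncomputable def pair (g h : Equiv.Perm Word) : Equiv.Perm Word :=
  branch fun s => if s = 0 then g else h

theorem branch_eq_pair (f : ZMod 2 → Equiv.Perm Word) : branch f = pair (f 0) (f 1) := by
  unfold pair
  congr 1
  funext s
  rcases zmod2_cases s with rfl | rfl <;> simp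

theorem pair_mul (g h g' h' : Equiv.Perm Word) :
    pair g h * pair g' h' = pair (g * g') (h * h') := by
  unfold pair
  rw [← map_mul]
  congr 1
  funext s
  by_cases hs : s = 0 <;> simp [hs]

theorem pair_one : pair 1 1 = 1 := by
  unfold pair
  rw [← map_one branch]
  congr 1
  funext s
  simp

theorem pair_inv (g h : Equiv.Perm Word) : (pair g h)⁻¹ = pair g⁻¹ h⁻¹ := by
  rw [inv_eq_iff_mul_eq_one, pair_mul, mul_inv_cancel, mul_inv_cancel, pair_one]

theorem pair_zero_cons (g h : Equiv.Perm Word) (w : Word) : pair g h (0 :: w) = 0 :: g w := rfl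

theorem pair_one_cons (g h : Equiv.Perm Word) (w : Word) : pair g h (1 :: w) = 1 :: h w := rfl

theorem place_zero_cons (σ : Word) (g : Equiv.Perm Word) :
    place (0 :: σ) g = pair (place σ g) 1 := by
  rw [place, branch_eq_pair]; simp

theorem place_one_cons (σ : Word) (g : Equiv.Perm Word) :
    place (1 :: σ) g = pair 1 (place σ g) := by
  rw [place, branch_eq_pair]; simp

theorem place_mul (σ : Word) (g h : Equiv.Perm Word) :
    place σ (g * h) = place σ g * place σ h := by
  induction σ with
  | nil => rfl
  | cons s σ ih => rw [place, place, place, ih, Pi.mulSingle_mul, map_mul]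

theorem place_one (σ : Word) : place σ 1 = 1 := by
  induction σ with
  | nil => rfl
  | cons s σ ih => rw [place, ih, Pi.mulSingle_one, map_one]

/-- `place σ` as a group homomorphism. -/
noncomputable def placeHom (σ : Word) : Equiv.Perm Word →* Equiv.Perm Word where
  toFun := place σ
  map_one' := place_one σ
  map_mul' := place_mul σ

@[simp] theorem placeHom_apply (σ : Word) (g : Equiv.Perm Word) : placeHom σ g = place σ g := rfl

theorem place_append (σ τ : Word) (g : Equiv.Perm Word) :
    place (σ ++ τ) g = place σ (place τ g) := by
  induction σ with
  | nil => rfl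
  | cons s σ ih => rw [List.cons_append, place, place, ih]

/-! ### Relations between the generators -/

theorem a_mul_a : a * a = 1 := Equiv.ext aFun_invol
theorem b_mul_b : b * b = 1 := Equiv.ext fun w => (bcdFun_invol w).1
theorem c_mul_c : c * c = 1 := Equiv.ext fun w => (bcdFun_invol w).2.1
theorem d_mul_d : d * d = 1 := Equiv.ext fun w => (bcdFun_invol w).2.2

theorem a_inv : a⁻¹ = a := inv_eq_of_mul_eq_one_right a_mul_a
theorem b_inv : b⁻¹ = b := inv_eq_of_mul_eq_one_right b_mul_b
theorem c_inv : c⁻¹ = c := inv_eq_of_mul_eq_one_right c_mul_c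
theorem d_inv : d⁻¹ = d := inv_eq_of_mul_eq_one_right d_mul_d

theorem b_eq : b = pair a c := by
  ext1 w
  rcases w with _ | ⟨s, w⟩
  · exact bFun.eq_1
  · have h : b (s :: w) = _ := bFun.eq_2 s w
    rw [h]
    rcases zmod2_cases s with rfl | rfl <;> rfl

theorem c_eq : c = pair a d := by
  ext1 w
  rcases w with _ | ⟨s, w⟩
  · exact cFun.eq_1
  · have h : c (s :: w) = _ := cFun.eq_2 s w
    rw [h]
    rcases zmod2_cases s with rfl | rfl <;> rfl

theorem d_eq : d = pair 1 b := by
  ext1 w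
  rcases w with _ | ⟨s, w⟩
  · exact dFun.eq_1
  · have h : d (s :: w) = _ := dFun.eq_2 s w
    rw [h]
    rcases zmod2_cases s with rfl | rfl <;> rfl

theorem a_mul_pair (g h : Equiv.Perm Word) : a * pair g h = pair h g * a := by
  ext1 w
  rcases w with _ | ⟨s, w⟩
  · rfl
  · rcases zmod2_cases s with rfl | rfl <;> rfl

theorem b_zero_cons (w : Word) : b (0 :: w) = 0 :: a w := by rw [b_eq, pair_zero_cons]
theorem b_one_cons (w : Word) : b (1 :: w) = 1 :: c w := by rw [b_eq, pair_one_cons]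
theorem c_zero_cons (w : Word) : c (0 :: w) = 0 :: a w := by rw [c_eq, pair_zero_cons]
theorem c_one_cons (w : Word) : c (1 :: w) = 1 :: d w := by rw [c_eq, pair_one_cons]
theorem d_zero_cons (w : Word) : d (0 :: w) = 0 :: w := by rw [d_eq, pair_zero_cons]; rfl
theorem d_one_cons (w : Word) : d (1 :: w) = 1 :: b w := by rw [d_eq, pair_one_cons]

theorem bcd_apply (w : Word) : b (c w) = d w ∧ c (d w) = b w ∧ d (b w) = c w := by
  induction w with
  | nil => exact ⟨rfl, rfl, rfl⟩
  | cons s w ih =>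
    have ha : a (a w) = w := aFun_invol w
    rcases zmod2_cases s with rfl | rfl
    · simp only [b_zero_cons, c_zero_cons, d_zero_cons, ha, and_self]
    · simp only [b_one_cons, c_one_cons, d_one_cons, ih, and_self]

theorem b_mul_c : b * c = d := Equiv.ext fun w => (bcd_apply w).1
theorem c_mul_d : c * d = b := Equiv.ext fun w => (bcd_apply w).2.1
theorem d_mul_b : d * b = c := Equiv.ext fun w => (bcd_apply w).2.2

theorem c_mul_b : c * b = d := by rw [← d_inv, ← b_mul_c, mul_inv_rev, b_inv, c_inv]
theorem d_mul_c : d * c = b := by rw [← b_inv, ← c_mul_d, mul_inv_rev, c_inv, d_inv]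
theorem b_mul_d : b * d = c := by rw [← c_inv, ← d_mul_b, mul_inv_rev, b_inv, d_inv]

theorem a_mul_a_mul (g : Equiv.Perm Word) : a * (a * g) = g := by rw [← mul_assoc, a_mul_a, one_mul]
theorem c_mul_b_mul (g : Equiv.Perm Word) : c * (b * g) = d * g := by rw [← mul_assoc, c_mul_b]
theorem d_mul_c_mul (g : Equiv.Perm Word) : d * (c * g) = b * g := by rw [← mul_assoc, d_mul_c]
theorem b_mul_d_mul (g : Equiv.Perm Word) : b * (d * g) = c * g := by rw [← mul_assoc, b_mul_d]

theorem x_eq : x = a * b * a * b := by rw [x, a_inv, b_inv]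

theorem x_eq_pair : x = pair (c * a) (a * c) := by
  rw [x_eq, b_eq, a_mul_pair, mul_assoc (pair c a), a_mul_a, mul_one, pair_mul]

theorem x_sq_eq_pair : x ^ 2 = pair (c * a * (c * a)) (a * c * (a * c)) := by
  rw [sq, x_eq_pair, pair_mul]

theorem ca_sq : c * a * (c * a) = pair (a * d) (d * a) := by
  rw [c_eq, mul_assoc, ← mul_assoc a, a_mul_pair, mul_assoc (pair d a), a_mul_a, mul_one, pair_mul]

theorem ac_sq : a * c * (a * c) = pair (d * a) (a * d) := by
  rw [c_eq, a_mul_pair, mul_assoc, ← a_mul_pair, a_mul_a_mul, pair_mul]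

theorem a_conj_x : a * x * a⁻¹ = x⁻¹ := by
  simp only [x_eq, a_inv, b_inv, mul_inv_rev, mul_assoc, a_mul_a_mul]

theorem b_conj_x : b * x * b⁻¹ = x⁻¹ := by
  simp only [x_eq, a_inv, b_inv, mul_inv_rev, mul_assoc, b_mul_b, mul_one]

/-- Commuting with `d` moves `x` one level down; this makes `K` contain `K × K`. -/
theorem commutator_x_d : x * d * x⁻¹ * d⁻¹ = pair 1 x := by
  have h : a * c * b * (a * c)⁻¹ * b = x := by
    simp only [x_eq, mul_inv_rev, a_inv, c_inv, mul_assoc, c_mul_b_mul, d_mul_c_mul]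
  nth_rw 1 2 [x_eq_pair]
  rw [d_inv, d_eq, pair_inv, pair_mul, pair_mul, pair_mul, h, mul_one, mul_one, mul_inv_cancel]

theorem ad_sq : a * d * a * d = pair b b := by
  rw [d_eq, a_mul_pair, mul_assoc (pair b 1), a_mul_a, mul_one, pair_mul, mul_one, one_mul]

/-! ### Membership in the group -/

theorem a_mem : a ∈ G := Subgroup.subset_closure (by simp)
theorem b_mem : b ∈ G := Subgroup.subset_closure (by simp)
theorem c_mem : c ∈ G := Subgroup.subset_closure (by simp)
theorem d_mem : d ∈ G := Subgroup.subset_closure (by simp)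

theorem x_mem : x ∈ G := by
  rw [x_eq]
  exact mul_mem (mul_mem (mul_mem a_mem b_mem) a_mem) b_mem

/-- `G` is generated by `a`, `b` and `d`, since `c = b d`. -/
theorem G_le_of_mem {H : Subgroup (Equiv.Perm Word)} (ha : a ∈ H) (hb : b ∈ H) (hd : d ∈ H) :
    G ≤ H := by
  rw [G, Subgroup.closure_le]
  rintro y (rfl | rfl | rfl | rfl)
  · exact ha
  · exact hb
  · rw [← b_mul_d]; exact mul_mem hb hd
  · exact hd

/-- Every element of `G` is the section at `1` of an element of `G` that fixes the first level. -/
theorem exists_pair_mem {h : Equiv.Perm Word} (hh : h ∈ G) : ∃ g, pair g h ∈ G := by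
  let H : Subgroup (Equiv.Perm Word) :=
    { carrier := {h | ∃ g, pair g h ∈ G}
      one_mem' := ⟨1, by rw [pair_one]; exact one_mem _⟩
      mul_mem' := by
        rintro h h' ⟨g, hg⟩ ⟨g', hg'⟩
        exact ⟨g * g', by rw [← pair_mul]; exact mul_mem hg hg'⟩
      inv_mem' := by
        rintro h ⟨g, hg⟩
        exact ⟨g⁻¹, by rw [← pair_inv]; exact inv_mem hg⟩ }
  refine (G_le_of_mem (H := H) ⟨c, ?_⟩ ⟨1, ?_⟩ ⟨a, ?_⟩) hh
  · have h : pair c a = a * b * a := by rw [b_eq, a_mul_pair, mul_assoc, a_mul_a, mul_one]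
    rw [h]
    exact mul_mem (mul_mem a_mem b_mem) a_mem
  · rw [← d_eq]; exact d_mem
  · rw [← c_eq]; exact c_mem

/-- For vertices `1ⁿ` and `σ` of the same level and `h ∈ G`, some element of `G` carries the
subtree at `1ⁿ` to the subtree at `σ` by `h`. -/
theorem exists_conj_place {h : Equiv.Perm Word} (hh : h ∈ G) (σ : Word) :
    ∃ g ∈ G, ∀ y, g * place (List.replicate σ.length 1) y * g⁻¹ = place σ (h * y * h⁻¹) := by
  induction σ with
  | nil => exact ⟨h, hh, fun y => rfl⟩
  | cons s σ ih =>
    obtain ⟨g, hg, hgy⟩ := ih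
    obtain ⟨g', hg'⟩ := exists_pair_mem hg
    have key : ∀ y, pair g' g * place (List.replicate (s :: σ).length 1) y * (pair g' g)⁻¹ =
        place (1 :: σ) (h * y * h⁻¹) := by
      intro y
      rw [List.length_cons, List.replicate_succ, place_one_cons, place_one_cons, pair_inv, pair_mul,
        pair_mul, hgy, mul_one, mul_inv_cancel]
    rcases zmod2_cases s with rfl | rfl
    · refine ⟨a * pair g' g, mul_mem a_mem hg', fun y => ?_⟩
      rw [mul_inv_rev, show a * pair g' g * place (List.replicate (0 :: σ).length 1) y *
        ((pair g' g)⁻¹ * a⁻¹) = a * (pair g' g * place (List.replicate (0 :: σ).length 1) y *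
        (pair g' g)⁻¹) * a⁻¹ by group]
      erw [key]
      rw [place_one_cons, a_mul_pair, mul_inv_cancel_right, place_zero_cons]
    · exact ⟨pair g' g, hg', key⟩

/-! ### Tree automorphisms and the parities of their labels -/

/-- The label of `g` at the vertex `w`: the letter by which `g` shifts the edges below `w`. -/
def label (g : Equiv.Perm Word) (w : Word) : ZMod 2 := (g (w ++ [0])).getD w.length 0

/-- The automorphisms of the rooted tree, as a group of bijections of the set of words. -/
def treeAut : Subgroup (Equiv.Perm Word) where
  carrier := {g | ∀ w, (g w).length = w.length ∧ ∀ s, g (w ++ [s]) = g w ++ [s + label g w]}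
  one_mem' := by
    intro w
    simp [label]
  mul_mem' := by
    intro g h hg hh w
    obtain ⟨hl, hs⟩ := hh w
    obtain ⟨gl, gs⟩ := hg (h w)
    refine ⟨by rw [Equiv.Perm.mul_apply, gl, hl], fun s => ?_⟩
    have key : label (g * h) w = label h w + label g (h w) := by
      rw [label, Equiv.Perm.mul_apply, hs, gs, List.getD_append_right _ _ _ _ (by rw [gl, hl]), gl,
        hl]
      simp
    rw [Equiv.Perm.mul_apply, hs, gs, key, add_assoc, Equiv.Perm.mul_apply]
  inv_mem' := by
    intro g hg w
    have hself : ∀ u, g (g⁻¹ u) = u := fun u => by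
      rw [← Equiv.Perm.mul_apply, mul_inv_cancel, Equiv.Perm.one_apply]
    have hl : ∀ u, (g⁻¹ u).length = u.length := fun u => by
      rw [← (hg (g⁻¹ u)).1, hself]
    refine ⟨hl w, fun s => ?_⟩
    have key : ∀ s, g⁻¹ (w ++ [s]) = g⁻¹ w ++ [s + label g (g⁻¹ w)] := by
      intro s
      rw [Equiv.Perm.inv_eq_iff_eq, (hg _).2, hself, add_assoc,
        CharTwo.add_self_eq_zero, add_zero]
    have hlab : label g⁻¹ w = label g (g⁻¹ w) := by
      rw [label, key, List.getD_append_right _ _ _ _ (by rw [hl]), hl]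
      simp
    rw [key, hlab]

theorem length_apply {g : Equiv.Perm Word} (hg : g ∈ treeAut) (w : Word) :
    (g w).length = w.length := (hg w).1

theorem apply_append_singleton {g : Equiv.Perm Word} (hg : g ∈ treeAut) (w : Word) (s : ZMod 2) :
    g (w ++ [s]) = g w ++ [s + label g w] := (hg w).2 s

theorem label_mul {g h : Equiv.Perm Word} (hg : g ∈ treeAut) (hh : h ∈ treeAut) (w : Word) :
    label (g * h) w = label g (h w) + label h w := by
  rw [label, Equiv.Perm.mul_apply, apply_append_singleton hh, apply_append_singleton hg,
    List.getD_append_right _ _ _ _ (by rw [length_apply hg, length_apply hh]), length_apply hg,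
    length_apply hh]
  simp [add_comm]

theorem pair_mem_treeAut {g h : Equiv.Perm Word} (hg : g ∈ treeAut) (hh : h ∈ treeAut) :
    pair g h ∈ treeAut := by
  rintro (_ | ⟨t, w⟩)
  · exact ⟨rfl, fun s => by rcases zmod2_cases s with rfl | rfl <;> rw [List.nil_append] <;>
      [rw [pair_zero_cons, List.length_eq_zero_iff.1 (length_apply hg [])];
       rw [pair_one_cons, List.length_eq_zero_iff.1 (length_apply hh [])]] <;> rfl⟩
  · rcases zmod2_cases t with rfl | rfl
    · refine ⟨congrArg (· + 1) (length_apply hg w), fun s => ?_⟩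
      exact congrArg (List.cons 0) (apply_append_singleton hg w s)
    · refine ⟨congrArg (· + 1) (length_apply hh w), fun s => ?_⟩
      exact congrArg (List.cons 1) (apply_append_singleton hh w s)

theorem place_mem_treeAut {g : Equiv.Perm Word} (hg : g ∈ treeAut) (σ : Word) :
    place σ g ∈ treeAut := by
  induction σ with
  | nil => exact hg
  | cons s σ ih =>
    rcases zmod2_cases s with rfl | rfl
    · rw [place_zero_cons]; exact pair_mem_treeAut ih (one_mem _)
    · rw [place_one_cons]; exact pair_mem_treeAut (one_mem _) ih

theorem a_mem_treeAut : a ∈ treeAut := by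
  rintro (_ | ⟨t, w⟩)
  · refine ⟨rfl, fun s => ?_⟩
    change [1 - s] = [s + (1 - 0)]
    revert s; decide
  · refine ⟨rfl, fun s => ?_⟩
    change (1 - t) :: (w ++ [s]) = (1 - t) :: (w ++ [s + (w ++ [0]).getD w.length 0])
    simp

theorem bcd_mem_treeAut : b ∈ treeAut ∧ c ∈ treeAut ∧ d ∈ treeAut := by
  have key : ∀ w : Word, ∀ g ∈ ({b, c, d} : Set (Equiv.Perm Word)),
      (g w).length = w.length ∧ ∀ s, g (w ++ [s]) = g w ++ [s + label g w] := by
    intro w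
    induction w with
    | nil =>
      rintro g (rfl | rfl | rfl) <;> refine ⟨rfl, fun s => ?_⟩ <;>
        rcases zmod2_cases s with rfl | rfl <;> decide
    | cons t w ih =>
      have lift : ∀ g h : Equiv.Perm Word, (∀ u : Word, g (t :: u) = t :: h u) →
          ((h w).length = w.length ∧ ∀ s, h (w ++ [s]) = h w ++ [s + label h w]) →
          ((g (t :: w)).length = (t :: w).length ∧
            ∀ s, g (t :: w ++ [s]) = g (t :: w) ++ [s + label g (t :: w)]) := by
        intro g h hgh hw
        have hlab : label g (t :: w) = label h w := by
          simp only [label, List.cons_append, hgh]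
          rfl
        refine ⟨by rw [hgh, List.length_cons, List.length_cons, hw.1], fun s => ?_⟩
        rw [List.cons_append, hgh, hgh, hw.2, hlab, List.cons_append]
      rcases zmod2_cases t with rfl | rfl
      · rintro g (rfl | rfl | rfl)
        · exact lift b a b_zero_cons (a_mem_treeAut w)
        · exact lift c a c_zero_cons (a_mem_treeAut w)
        · exact lift d 1 d_zero_cons (one_mem treeAut w)
      · rintro g (rfl | rfl | rfl)
        · exact lift b c b_one_cons (ih c (by simp))
        · exact lift c d c_one_cons (ih d (by simp))
        · exact lift d b d_one_cons (ih b (by simp))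
  exact ⟨fun w => key w b (by simp), fun w => key w c (by simp), fun w => key w d (by simp)⟩

theorem G_le_treeAut : G ≤ treeAut :=
  G_le_of_mem a_mem_treeAut bcd_mem_treeAut.1 bcd_mem_treeAut.2.2

/-- `parity n u g` is the sum of the labels of `g` at the `2 ^ n` vertices that lie `n` levels
below `u`. -/
def parity : ℕ → Word → Equiv.Perm Word → ZMod 2
  | 0, u, g => label g u
  | n + 1, u, g => parity n (u ++ [0]) g + parity n (u ++ [1]) g

/-- The cocycle identity for the label parities. -/
theorem parity_mul {g h : Equiv.Perm Word} (hg : g ∈ treeAut) (hh : h ∈ treeAut) (n : ℕ)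
    (u : Word) : parity n u (g * h) = parity n (h u) g + parity n u h := by
  induction n generalizing u with
  | zero => exact label_mul hg hh u
  | succ n ih =>
    rw [parity, parity, parity, ih, ih, apply_append_singleton hh, apply_append_singleton hh]
    rcases zmod2_cases (label h u) with h' | h' <;> rw [h']
    · rw [zero_add, add_zero]; ring
    · rw [zero_add, show (1 + 1 : ZMod 2) = 0 from rfl]; ring

theorem parity_one (n : ℕ) (u : Word) : parity n u 1 = 0 := by
  have h := parity_mul (one_mem treeAut) (one_mem treeAut) n u
  rw [mul_one, Equiv.Perm.one_apply] at h
  simpa using h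

theorem parity_inv {g : Equiv.Perm Word} (hg : g ∈ treeAut) (n : ℕ) (u : Word) :
    parity n u g⁻¹ = parity n (g⁻¹ u) g := by
  have h := parity_mul hg (inv_mem hg) n u
  rw [mul_inv_cancel, parity_one] at h
  exact (CharTwo.add_eq_zero.1 h.symm).symm

theorem parity_mul_of_fix {g h : Equiv.Perm Word} (hg : g ∈ treeAut) (hh : h ∈ treeAut) (n : ℕ)
    {u : Word} (hu : h u = u) : parity n u (g * h) = parity n u g + parity n u h := by
  rw [parity_mul hg hh, hu]

theorem parity_inv_of_fix {g : Equiv.Perm Word} (hg : g ∈ treeAut) (n : ℕ)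
    {u : Word} (hu : g u = u) : parity n u g⁻¹ = parity n u g := by
  rw [parity_inv hg, Equiv.Perm.inv_eq_iff_eq.2 hu.symm]

theorem parity_conj {g h : Equiv.Perm Word} (hg : g ∈ treeAut) (hh : h ∈ treeAut) (n : ℕ) {u : Word}
    (hu : g (h⁻¹ u) = h⁻¹ u) : parity n u (h * g * h⁻¹) = parity n (h⁻¹ u) g := by
  rw [parity_mul (mul_mem hh hg) (inv_mem hh), parity_mul hh hg, hu, parity_inv hh,
    add_comm _ (parity n (h⁻¹ u) g), add_assoc, CharTwo.add_self_eq_zero, add_zero]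

theorem parity_pair_zero (g h : Equiv.Perm Word) (n : ℕ) (u : Word) :
    parity n (0 :: u) (pair g h) = parity n u g := by
  induction n generalizing u with
  | zero => rfl
  | succ n ih => rw [parity, parity, List.cons_append, List.cons_append, ih, ih]

theorem parity_pair_one (g h : Equiv.Perm Word) (n : ℕ) (u : Word) :
    parity n (1 :: u) (pair g h) = parity n u h := by
  induction n generalizing u with
  | zero => rfl
  | succ n ih => rw [parity, parity, List.cons_append, List.cons_append, ih, ih]

theorem parity_succ_nil_pair (g h : Equiv.Perm Word) (n : ℕ) :
    parity (n + 1) [] (pair g h) = parity n [] g + parity n [] h := by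
  rw [parity, List.nil_append, List.nil_append, parity_pair_zero, parity_pair_one]

/-- The sum of the labels of one level is a homomorphism. -/
theorem parity_nil_mul {g h : Equiv.Perm Word} (hg : g ∈ treeAut) (hh : h ∈ treeAut) (n : ℕ) :
    parity n [] (g * h) = parity n [] g + parity n [] h :=
  parity_mul_of_fix hg hh n (List.length_eq_zero_iff.1 (length_apply hh []))

theorem parity_zero_a : parity 0 [] a = 1 := by decide

theorem parity_succ_a (n : ℕ) : parity (n + 1) [] a = 0 := by
  have h : ∀ n (s : ZMod 2) (w : Word), parity n (s :: w) a = 0 := by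
    intro n
    induction n with
    | zero =>
      intro s w
      change (w ++ [0]).getD w.length 0 = 0
      simp
    | succ n ih => intro s w; rw [parity, List.cons_append, List.cons_append, ih, ih, add_zero]
  rw [parity, List.nil_append, List.nil_append, h, h, add_zero]

theorem parity_zero_b : parity 0 [] b = 0 := by decide
theorem parity_zero_c : parity 0 [] c = 0 := by decide
theorem parity_zero_d : parity 0 [] d = 0 := by decide

theorem parity_succ_b (n : ℕ) : parity (n + 1) [] b = parity n [] a + parity n [] c := by
  rw [b_eq, parity_succ_nil_pair]
theorem parity_succ_c (n : ℕ) : parity (n + 1) [] c = parity n [] a + parity n [] d := by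
  rw [c_eq, parity_succ_nil_pair]
theorem parity_succ_d (n : ℕ) : parity (n + 1) [] d = parity n [] b := by
  rw [d_eq, parity_succ_nil_pair, parity_one, zero_add]

theorem parity_one_b : parity 1 [] b = 1 := by
  rw [parity_succ_b, parity_zero_a, parity_zero_c, add_zero]
theorem parity_one_c : parity 1 [] c = 1 := by
  rw [parity_succ_c, parity_zero_a, parity_zero_d, add_zero]
theorem parity_one_d : parity 1 [] d = 0 := by rw [parity_succ_d, parity_zero_b]
theorem parity_two_b : parity 2 [] b = 1 := by
  rw [parity_succ_b, parity_succ_a, parity_one_c, zero_add]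
theorem parity_two_c : parity 2 [] c = 0 := by
  rw [parity_succ_c, parity_succ_a, parity_one_d, zero_add]
theorem parity_two_d : parity 2 [] d = 1 := by rw [parity_succ_d, parity_one_b]

/-! ### Subgroups normalised by the Grigorchuk group -/

/-- `H` is stable under conjugation by the elements of `G`. -/
def GStable (H : Subgroup (Equiv.Perm Word)) : Prop := ∀ g ∈ G, ∀ y ∈ H, g * y * g⁻¹ ∈ H

theorem GStable.of_generators {H : Subgroup (Equiv.Perm Word)} (ha : ∀ y ∈ H, a * y * a⁻¹ ∈ H)
    (hb : ∀ y ∈ H, b * y * b⁻¹ ∈ H) (hd : ∀ y ∈ H, d * y * d⁻¹ ∈ H) : GStable H := by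
  let M : Subgroup (Equiv.Perm Word) :=
    { carrier := {g | ∀ y ∈ H, g * y * g⁻¹ ∈ H ∧ g⁻¹ * y * g ∈ H}
      one_mem' := by intro y hy; simpa using hy
      mul_mem' := by
        intro g h hg hh y hy
        constructor
        · rw [show g * h * y * (g * h)⁻¹ = g * (h * y * h⁻¹) * g⁻¹ by group]
          exact (hg _ (hh _ hy).1).1
        · rw [show (g * h)⁻¹ * y * (g * h) = h⁻¹ * (g⁻¹ * y * g) * h by group]
          exact (hh _ (hg _ hy).2).2
      inv_mem' := by
        intro g hg y hy
        rw [inv_inv]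
        exact (hg y hy).symm }
  have hM : G ≤ M := by
    refine G_le_of_mem (fun y hy => ⟨ha y hy, ?_⟩) (fun y hy => ⟨hb y hy, ?_⟩)
      (fun y hy => ⟨hd y hy, ?_⟩)
    · have := ha y hy; rwa [a_inv] at this ⊢
    · have := hb y hy; rwa [b_inv] at this ⊢
    · have := hd y hy; rwa [d_inv] at this ⊢
  exact fun g hg y hy => (hM hg y hy).1

theorem GStable.inv_conj {H : Subgroup (Equiv.Perm Word)} (hH : GStable H) {g y : Equiv.Perm Word}
    (hg : g ∈ G) (hy : y ∈ H) : g⁻¹ * y * g ∈ H := by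
  have := hH g⁻¹ (inv_mem hg) y hy
  rwa [inv_inv] at this

theorem GStable.sup {H M : Subgroup (Equiv.Perm Word)} (hH : GStable H) (hM : GStable M) :
    GStable (H ⊔ M) := by
  intro g hg y hy
  have h : H ⊔ M ≤ (H ⊔ M).comap (MulAut.conj g).toMonoidHom :=
    sup_le (fun y hy => (le_sup_left : H ≤ H ⊔ M) (hH g hg y hy))
      (fun y hy => (le_sup_right : M ≤ H ⊔ M) (hM g hg y hy))
  exact h hy

theorem GStable.commutator {H : Subgroup (Equiv.Perm Word)} (hH : GStable H) : GStable ⁅H, G⁆ := by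
  intro g hg y hy
  have h : ⁅H, G⁆ ≤ (⁅H, G⁆ : Subgroup (Equiv.Perm Word)).comap (MulAut.conj g).toMonoidHom := by
    rw [Subgroup.commutator_le]
    intro p hp q hq
    change g * ⁅p, q⁆ * g⁻¹ ∈ ⁅H, G⁆
    rw [show g * ⁅p, q⁆ * g⁻¹ = ⁅g * p * g⁻¹, g * q * g⁻¹⁆ by
      simp only [commutatorElement_def]; group]
    exact Subgroup.commutator_mem_commutator (hH g hg p hp)
      (mul_mem (mul_mem hg hq) (inv_mem hg))
  exact h hy

/-- If the generators commute with `y` modulo the `G`-stable subgroup `H`, so does all of `G`. -/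
theorem conj_mul_inv_mem {H : Subgroup (Equiv.Perm Word)} (hH : GStable H) {y : Equiv.Perm Word}
    (ha : a * y * a⁻¹ * y⁻¹ ∈ H) (hb : b * y * b⁻¹ * y⁻¹ ∈ H) (hd : d * y * d⁻¹ * y⁻¹ ∈ H)
    {g : Equiv.Perm Word} (hg : g ∈ G) : g * y * g⁻¹ * y⁻¹ ∈ H := by
  let M : Subgroup (Equiv.Perm Word) :=
    { carrier := {g | g ∈ G ∧ g * y * g⁻¹ * y⁻¹ ∈ H}
      one_mem' := ⟨one_mem _, by simp⟩
      mul_mem' := by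
        rintro g h ⟨hg, hgy⟩ ⟨hh, hhy⟩
        refine ⟨mul_mem hg hh, ?_⟩
        rw [show g * h * y * (g * h)⁻¹ * y⁻¹ =
          g * (h * y * h⁻¹ * y⁻¹) * g⁻¹ * (g * y * g⁻¹ * y⁻¹) by group]
        exact mul_mem (hH g hg _ hhy) hgy
      inv_mem' := by
        rintro g ⟨hg, hgy⟩
        refine ⟨inv_mem hg, ?_⟩
        rw [show g⁻¹ * y * g⁻¹⁻¹ * y⁻¹ = g⁻¹ * (g * y * g⁻¹ * y⁻¹)⁻¹ * g by group]
        exact hH.inv_conj hg (inv_mem hgy) }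
  exact (G_le_of_mem (H := M) ⟨a_mem, ha⟩ ⟨b_mem, hb⟩ ⟨d_mem, hd⟩ hg).2

theorem conjClosure_gStable (y : Equiv.Perm Word) : GStable (conjClosure y) := by
  intro g hg k hk
  have h : conjClosure y ≤ (conjClosure y).comap (MulAut.conj g).toMonoidHom := by
    rw [conjClosure, Subgroup.closure_le]
    rintro _ ⟨h, hh, rfl⟩
    exact Subgroup.subset_closure ⟨g * h, mul_mem hg hh, by simp [mul_assoc]⟩
  exact h hk

theorem conjClosure_le {H : Subgroup (Equiv.Perm Word)} (hH : GStable H) {y : Equiv.Perm Word}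
    (hy : y ∈ H) : conjClosure y ≤ H := by
  rw [conjClosure, Subgroup.closure_le]
  rintro _ ⟨h, hh, rfl⟩
  exact hH h hh y hy

theorem G_gStable : GStable G := fun _ hg _ hy => mul_mem (mul_mem hg hy) (inv_mem hg)

/-- The union `H ∪ y H`, for a `G`-stable subgroup `H` and an element `y` of `G` with `y² ∈ H`. -/
def twoCosets {H : Subgroup (Equiv.Perm Word)} (hH : GStable H) {y : Equiv.Perm Word}
    (hyG : y ∈ G) (hy : y * y ∈ H) : Subgroup (Equiv.Perm Word) where
  carrier := {k | k ∈ H ∨ y⁻¹ * k ∈ H}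
  one_mem' := Or.inl (one_mem _)
  mul_mem' := by
    rintro p q (hp | hp) (hq | hq)
    · exact Or.inl (mul_mem hp hq)
    · right
      rw [show y⁻¹ * (p * q) = y⁻¹ * p * y * (y⁻¹ * q) by group]
      exact mul_mem (hH.inv_conj hyG hp) hq
    · right
      rw [← mul_assoc]
      exact mul_mem hp hq
    · left
      rw [show p * q = y * (y⁻¹ * p) * y⁻¹ * (y * y) * (y⁻¹ * q) by group]
      exact mul_mem (mul_mem (hH y hyG _ hp) hy) hq
  inv_mem' := by
    rintro p (hp | hp)
    · exact Or.inl (inv_mem hp)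
    · right
      rw [show y⁻¹ * p⁻¹ = y⁻¹ * (y⁻¹ * p)⁻¹ * y * (y * y)⁻¹ by group]
      exact mul_mem (hH.inv_conj hyG (inv_mem hp)) (inv_mem hy)

theorem conjClosure_le_twoCosets {H : Subgroup (Equiv.Perm Word)} (hH : GStable H)
    {y : Equiv.Perm Word} (hyG : y ∈ G) (hy : y * y ∈ H)
    (hc : ∀ g ∈ G, g * y * g⁻¹ * y⁻¹ ∈ H) : conjClosure y ≤ twoCosets hH hyG hy := by
  rw [conjClosure, Subgroup.closure_le]
  rintro _ ⟨h, hh, rfl⟩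
  right
  rw [show y⁻¹ * (h * y * h⁻¹) = y⁻¹ * (h * y * h⁻¹ * y⁻¹) * y by group]
  exact hH.inv_conj hyG (hc h hh)

/-! ### Direct powers acting on a level -/

theorem mem_level_succ {Q : Subgroup (Equiv.Perm Word)} {m : ℕ} {g : Equiv.Perm Word} :
    g ∈ level Q (m + 1) ↔ ∃ p ∈ level Q m, ∃ q ∈ level Q m, g = pair p q := by
  rw [level, Subgroup.mem_map]
  constructor
  · rintro ⟨f, hf, rfl⟩
    rw [Subgroup.mem_pi] at hf
    exact ⟨f 0, hf 0 trivial, f 1, hf 1 trivial, branch_eq_pair f⟩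
  · rintro ⟨p, hp, q, hq, rfl⟩
    refine ⟨_, ?_, rfl⟩
    rw [Subgroup.mem_pi]
    intro s _
    by_cases hs : s = 0 <;> simp [hs, hp, hq]

theorem pair_mem_level {Q : Subgroup (Equiv.Perm Word)} {m : ℕ} {p q : Equiv.Perm Word}
    (hp : p ∈ level Q m) (hq : q ∈ level Q m) : pair p q ∈ level Q (m + 1) :=
  mem_level_succ.2 ⟨p, hp, q, hq, rfl⟩

theorem level_le {Q : Subgroup (Equiv.Perm Word)} {m : ℕ} {H : Subgroup (Equiv.Perm Word)}
    (h : ∀ σ : Word, σ.length = m → Q ≤ H.comap (placeHom σ)) : level Q m ≤ H := by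
  induction m generalizing H with
  | zero => exact h [] rfl
  | succ m ih =>
    have key : ∀ s : ZMod 2, level Q m ≤ H.comap (placeHom [s]) := by
      intro s
      refine ih fun σ hσ q hq => ?_
      have := h (s :: σ) (by rw [List.length_cons, hσ]) hq
      rw [Subgroup.mem_comap, placeHom_apply] at this ⊢
      rwa [Subgroup.mem_comap, placeHom_apply, ← place_append]
    intro g hg
    obtain ⟨p, hp, q, hq, rfl⟩ := mem_level_succ.1 hg
    have hp' := key 0 hp
    have hq' := key 1 hq
    rw [Subgroup.mem_comap, placeHom_apply] at hp' hq'
    rw [place_zero_cons] at hp'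
    rw [place_one_cons] at hq'
    have := mul_mem hp' hq'
    rwa [pair_mul, mul_one, one_mul] at this

theorem place_mem_level' {Q : Subgroup (Equiv.Perm Word)} {g : Equiv.Perm Word} (hg : g ∈ Q)
    {σ : Word} {m : ℕ} (hσ : σ.length = m) : place σ g ∈ level Q m := hσ ▸ place_mem_level hg σ

theorem level_mono {P Q : Subgroup (Equiv.Perm Word)} (h : P ≤ Q) (m : ℕ) :
    level P m ≤ level Q m :=
  level_le fun _ hσ _ hg => place_mem_level' (h hg) hσ

theorem level_sup (P Q : Subgroup (Equiv.Perm Word)) (m : ℕ) :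
    level (P ⊔ Q) m = level P m ⊔ level Q m := by
  refine le_antisymm (level_le fun σ hσ => sup_le (fun g hg => ?_) (fun g hg => ?_))
    (sup_le (level_mono le_sup_left m) (level_mono le_sup_right m))
  · exact (le_sup_left : level P m ≤ _) (place_mem_level' hg hσ)
  · exact (le_sup_right : level Q m ≤ _) (place_mem_level' hg hσ)

theorem level_succ_eq (Q : Subgroup (Equiv.Perm Word)) (m : ℕ) :
    level Q (m + 1) = level (level Q 1) m := by
  induction m with
  | zero => rfl
  | succ m ih => rw [level, ih, ← level]

theorem GStable.level {Q : Subgroup (Equiv.Perm Word)} (hQ : GStable Q) (m : ℕ) :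
    GStable (level Q m) := by
  induction m with
  | zero => exact hQ
  | succ m ih =>
    refine GStable.of_generators (fun y hy => ?_) (fun y hy => ?_) (fun y hy => ?_) <;>
      obtain ⟨p, hp, q, hq, rfl⟩ := mem_level_succ.1 hy
    · rw [a_mul_pair, mul_inv_cancel_right]
      exact pair_mem_level hq hp
    · rw [b_eq, pair_inv, pair_mul, pair_mul]
      exact pair_mem_level (ih a a_mem p hp) (ih c c_mem q hq)
    · rw [d_eq, pair_inv, pair_mul, pair_mul]
      exact pair_mem_level (ih 1 (one_mem _) p hp) (ih b b_mem q hq)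

/-- A `G`-stable subgroup contains `⟨y⟩^G × ⋯ × ⟨y⟩^G` as soon as it contains one copy of `y`. -/
theorem level_conjClosure_le {H : Subgroup (Equiv.Perm Word)} (hH : GStable H) {m : ℕ}
    {y : Equiv.Perm Word} (hy : place (List.replicate m 1) y ∈ H) :
    level (conjClosure y) m ≤ H := by
  refine level_le fun σ hσ => ?_
  rw [conjClosure, Subgroup.closure_le]
  rintro _ ⟨h, hh, rfl⟩
  obtain ⟨g, hg, hgy⟩ := exists_conj_place hh σ
  change place σ (h * y * h⁻¹) ∈ H
  rw [← hgy, hσ]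
  exact hH g hg _ hy

/-- The variant of `level_conjClosure_le` for subgroups stable under all tree automorphisms. -/
theorem level_conjClosure_le_of_treeAut {H : Subgroup (Equiv.Perm Word)}
    (hH : ∀ g ∈ treeAut, ∀ y ∈ H, g * y * g⁻¹ ∈ H) {m : ℕ} {y : Equiv.Perm Word}
    (hy : ∀ σ : Word, σ.length = m → place σ y ∈ H) : level (conjClosure y) m ≤ H := by
  refine level_le fun σ hσ => ?_
  rw [conjClosure, Subgroup.closure_le]
  rintro _ ⟨h, hh, rfl⟩
  change placeHom σ (h * y * h⁻¹) ∈ H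
  rw [map_mul, map_mul, map_inv]
  exact hH _ (place_mem_treeAut (G_le_treeAut hh) σ) _ (hy σ hσ)

/-! ### The subgroups `K`, `T` and `N_m` -/

theorem K_gStable : GStable K := conjClosure_gStable x
theorem T_gStable : GStable T := conjClosure_gStable (x ^ 2)
theorem N_gStable (m : ℕ) : GStable (N m) := (K_gStable.level m).sup (T_gStable.level (m - 1))

theorem x_mem_K : x ∈ K := mem_conjClosure x
theorem x_sq_mem_T : x ^ 2 ∈ T := mem_conjClosure (x ^ 2)

theorem T_le_K : T ≤ K := conjClosure_le K_gStable (pow_mem x_mem_K 2)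

theorem level_K_one_le : level K 1 ≤ K := by
  refine level_conjClosure_le K_gStable ?_
  rw [List.replicate_one, place_one_cons, place, ← commutator_x_d,
    show x * d * x⁻¹ * d⁻¹ = x * (d * x⁻¹ * d⁻¹) by group]
  exact mul_mem x_mem_K (K_gStable d d_mem _ (inv_mem x_mem_K))

theorem level_K_succ_le (m : ℕ) : level K (m + 1) ≤ level K m := by
  rw [level_succ_eq]
  exact level_mono level_K_one_le m

theorem N_succ_le_level_K (m : ℕ) : N (m + 1) ≤ level K m :=
  sup_le (level_K_succ_le m) (level_mono T_le_K m)

theorem N_succ_eq (m : ℕ) : N (m + 1) = level (N 1) m := by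
  rw [N, N, level_sup, ← level_succ_eq]
  rfl

theorem N_succ_succ_le (m : ℕ) : N (m + 2) ≤ N (m + 1) :=
  (N_succ_le_level_K (m + 1)).trans le_sup_left

/-- A `G`-stable subgroup contains `N_m` as soon as it contains one copy of `x` and one of
`x²`. -/
theorem N_succ_le {H : Subgroup (Equiv.Perm Word)} (hH : GStable H) {m : ℕ}
    (hx : place (List.replicate (m + 1) 1) x ∈ H) (hx2 : place (List.replicate m 1) (x ^ 2) ∈ H) :
    N (m + 1) ≤ H :=
  sup_le (level_conjClosure_le hH hx) (level_conjClosure_le hH hx2)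

theorem pair_mem_N_one {p q : Equiv.Perm Word} (hp : p ∈ K) (hq : q ∈ K) : pair p q ∈ N 1 :=
  (le_sup_left : level K 1 ≤ N 1) (pair_mem_level (m := 0) hp hq)

theorem x_sq_mem_N_one : x ^ 2 ∈ N 1 := (le_sup_right : level T 0 ≤ N 1) x_sq_mem_T

theorem pair_mem_N_two {p q : Equiv.Perm Word} (hp : p ∈ N 1) (hq : q ∈ N 1) : pair p q ∈ N 2 := by
  rw [N_succ_eq]
  exact pair_mem_level (m := 0) hp hq

theorem d_conj_x : d * x * d⁻¹ = pair 1 x⁻¹ * x := by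
  rw [← inv_one, ← pair_inv, ← commutator_x_d]
  group

/-- `x` is central modulo `N_1`. -/
theorem conj_x_mul_inv_mem_N_one {g : Equiv.Perm Word} (hg : g ∈ G) :
    g * x * g⁻¹ * x⁻¹ ∈ N 1 := by
  have h : x⁻¹ * x⁻¹ ∈ N 1 := by
    rw [← mul_inv_rev, ← sq]
    exact inv_mem x_sq_mem_N_one
  refine conj_mul_inv_mem (N_gStable 1) ?_ ?_ ?_ hg
  · rwa [a_conj_x]
  · rwa [b_conj_x]
  · rw [d_conj_x, mul_inv_cancel_right]
    exact pair_mem_N_one (one_mem _) (inv_mem x_mem_K)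

/-- `K` is the union of the cosets `N_1` and `x N_1`. -/
theorem mem_N_one_or_of_mem_K {k : Equiv.Perm Word} (hk : k ∈ K) :
    k ∈ N 1 ∨ x⁻¹ * k ∈ N 1 :=
  conjClosure_le_twoCosets (N_gStable 1) x_mem (sq x ▸ x_sq_mem_N_one)
    (fun _ hg => conj_x_mul_inv_mem_N_one hg) hk

/-- `x² · x² = (z, z)` with `z = ((b, b), (b, b))` in the coset `x² K_1`, which lies in `N_1`. -/
theorem x_pow_four_mem_N_two : x ^ 2 * x ^ 2 ∈ N 2 := by
  have had : a * d * (a * d) = pair b b := by rw [← mul_assoc, ad_sq]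
  have hda : d * a * (d * a) = pair b b := by
    rw [← inv_inj, pair_inv, b_inv, ← had]
    simp only [mul_inv_rev, a_inv, d_inv, mul_assoc]
  -- Modulo `K`, the squares of `a c` and `a d` agree because `c = b d` and `b` commutes with `a`.
  have hk : pair b b * (a * c * (a * c))⁻¹ ∈ K := by
    have h : pair b b * (a * c * (a * c))⁻¹ = a * d * x * (a * d)⁻¹ := by
      rw [← had]
      simp only [x_eq, mul_inv_rev, a_inv, c_inv, d_inv, mul_assoc, d_mul_c_mul, b_mul_d_mul]
    rw [h]
    exact K_gStable _ (mul_mem a_mem d_mem) _ x_mem_K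
  have hca : (c * a * (c * a))⁻¹ = a * c * (a * c) := by
    simp only [mul_inv_rev, a_inv, c_inv, mul_assoc]
  have hk' : pair b b * (c * a * (c * a))⁻¹ ∈ K := by
    have h := K_gStable.inv_conj (mul_mem (mul_mem a_mem c_mem) (mul_mem a_mem c_mem)) (inv_mem hk)
    rw [hca, ← inv_inv (pair b b), pair_inv, b_inv]
    convert h using 1
    group
  have hz : pair (pair b b) (pair b b) ∈ N 1 := by
    have h := mul_mem (pair_mem_N_one hk' hk) x_sq_mem_N_one
    rwa [x_sq_eq_pair, pair_mul, inv_mul_cancel_right, inv_mul_cancel_right] at h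
  rw [x_sq_eq_pair, pair_mul, ca_sq, ac_sq, pair_mul, pair_mul, had, hda]
  exact pair_mem_N_two hz hz

/-- `x²` is central modulo `N_2`. -/
theorem conj_x_sq_mul_inv_mem_N_two {g : Equiv.Perm Word} (hg : g ∈ G) :
    g * x ^ 2 * g⁻¹ * (x ^ 2)⁻¹ ∈ N 2 := by
  have h : x⁻¹ ^ 2 * (x ^ 2)⁻¹ ∈ N 2 := by
    rw [inv_pow, ← mul_inv_rev]
    exact inv_mem x_pow_four_mem_N_two
  refine conj_mul_inv_mem (N_gStable 2) ?_ ?_ ?_ hg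
  · rwa [← conj_pow, a_conj_x]
  · rwa [← conj_pow, b_conj_x]
  · have h1 : d * x ^ 2 * d⁻¹ * (x ^ 2)⁻¹ =
        pair 1 x⁻¹ * (x * pair 1 x⁻¹ * x⁻¹) := by
      rw [← conj_pow, d_conj_x, sq, sq]
      group
    have h2 : x * pair 1 x⁻¹ * x⁻¹ = pair 1 (a * c * x⁻¹ * (a * c)⁻¹) := by
      nth_rw 1 3 [x_eq_pair]
      rw [pair_inv, pair_mul, pair_mul, mul_one, mul_inv_cancel]
    have hac := mul_mem a_mem c_mem
    rw [h1, h2, pair_mul, one_mul, show x⁻¹ * (a * c * x⁻¹ * (a * c)⁻¹) =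
      (x ^ 2)⁻¹ * (a * c * x * (a * c)⁻¹ * x⁻¹)⁻¹ by group]
    exact pair_mem_N_two (one_mem _)
      (mul_mem (inv_mem x_sq_mem_N_one) (inv_mem (conj_x_mul_inv_mem_N_one hac)))

/-- `N_1` is the union of the cosets `K_1` and `x² K_1`. -/
theorem mem_level_K_one_or_of_mem_N_one {g : Equiv.Perm Word} (hg : g ∈ N 1) :
    g ∈ level K 1 ∨ (x ^ 2)⁻¹ * g ∈ level K 1 := by
  have hN : N 2 ≤ level K 1 := N_succ_le_level_K 1
  have h : N 1 ≤ twoCosets (K_gStable.level 1) (pow_mem x_mem 2) (hN x_pow_four_mem_N_two) :=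
    sup_le (fun k hk => Or.inl hk)
      (conjClosure_le_twoCosets _ _ _ fun _ hg => hN (conj_x_sq_mul_inv_mem_N_two hg))
  exact h hg

/-! ### Coordinates on `N_m / N_{m+1}` -/

/-- The coordinate of `N_m / N_{m+1}` at the vertex `w` of level `m` that detects `x`. It is the
character `a, b, d ↦ 1`, `c ↦ 0` of the section at `w 0`. -/
def alphaFun (g : Equiv.Perm Word) (w : Word) : ZMod 2 :=
  parity 0 (w ++ [0]) g + parity 2 (w ++ [0]) g

/-- The coordinate of `N_m / N_{m+1}` at the vertex `w` of level `m - 1` that detects `x²`. It is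
the character `b, d ↦ 1`, `a, c ↦ 0` of the section at `w 0 0`. -/
def betaFun (g : Equiv.Perm Word) (w : Word) : ZMod 2 := parity 2 (w ++ [0, 0]) g

theorem append_pair_eq (τ : Word) (s t : ZMod 2) : τ ++ [s, t] = τ ++ [s] ++ [t] := by simp

theorem exists_length_succ {n : ℕ} {u : Word} (hu : u.length = n + 1) :
    ∃ (τ : Word) (s : ZMod 2), τ.length = n ∧ u = τ ++ [s] := by
  rcases List.eq_nil_or_concat u with rfl | ⟨τ, s, rfl⟩
  · simp at hu
  · exact ⟨τ, s, by simpa using hu, List.concat_eq_append⟩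

theorem apply_of_apply_append {g : Equiv.Perm Word} (hg : g ∈ treeAut) {w : Word} {s : ZMod 2}
    (h : g (w ++ [s]) = w ++ [s]) : g w = w := by
  rw [apply_append_singleton hg] at h
  exact (List.append_inj' h rfl).1

/-- The tree automorphisms on whose label parities `alphaFun` and `betaFun` are homomorphisms
compatible with the action on the tree. The group is normal in the automorphism group of the tree
and contains `N_{m+1}`. -/
def coordGroup (m : ℕ) : Subgroup (Equiv.Perm Word) where
  carrier := {g | g ∈ treeAut ∧ (∀ u : Word, u.length = m + 2 → g u = u) ∧
    (∀ (n : ℕ) (u : Word), u.length = m + 1 → parity n u g = 0) ∧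
    ∀ (τ : Word) (s t : ZMod 2), τ.length = m →
      parity 2 (τ ++ [s, t]) g = parity 2 (τ ++ [0, 0]) g}
  one_mem' := ⟨one_mem _, fun _ _ => rfl, fun _ _ _ => parity_one _ _, fun τ s t _ => by
    rw [parity_one, parity_one]⟩
  mul_mem' := by
    rintro g h ⟨hg, g1, g2, g3⟩ ⟨hh, h1, h2, h3⟩
    refine ⟨mul_mem hg hh, fun u hu => ?_, fun n u hu => ?_, fun τ s t hτ => ?_⟩
    · rw [Equiv.Perm.mul_apply, h1 u hu, g1 u hu]
    · have hu' : h u = u :=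
        apply_of_apply_append hh (s := 0) (h1 (u ++ [0]) (by simp [hu]))
      rw [parity_mul_of_fix hg hh n hu', g2 n u hu, h2 n u hu, add_zero]
    · rw [parity_mul_of_fix hg hh 2 (h1 _ (by simp [hτ])),
        parity_mul_of_fix hg hh 2 (h1 _ (by simp [hτ])), g3 τ s t hτ, h3 τ s t hτ]
  inv_mem' := by
    rintro g ⟨hg, g1, g2, g3⟩
    refine ⟨inv_mem hg, fun u hu => ?_, fun n u hu => ?_, fun τ s t hτ => ?_⟩
    · rw [Equiv.Perm.inv_eq_iff_eq, g1 u hu]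
    · have hu' : g u = u :=
        apply_of_apply_append hg (s := 0) (g1 (u ++ [0]) (by simp [hu]))
      rw [parity_inv_of_fix hg n hu', g2 n u hu]
    · rw [parity_inv_of_fix hg 2 (g1 _ (by simp [hτ])),
        parity_inv_of_fix hg 2 (g1 _ (by simp [hτ])), g3 τ s t hτ]

section coordGroup

variable {m : ℕ} {g h : Equiv.Perm Word}

theorem coordGroup_apply (hg : g ∈ coordGroup m) {u : Word} (hu : u.length = m + 2) : g u = u :=
  hg.2.1 u hu

theorem coordGroup_apply' (hg : g ∈ coordGroup m) {u : Word} (hu : u.length = m + 1) : g u = u :=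
  apply_of_apply_append hg.1 (s := 0) (coordGroup_apply hg (by simp [hu]))

theorem parity_append_eq (hg : g ∈ coordGroup m) (n : ℕ) {u : Word} (hu : u.length = m + 1)
    (s : ZMod 2) : parity n (u ++ [s]) g = parity n (u ++ [0]) g := by
  rcases zmod2_cases s with rfl | rfl
  · rfl
  · have := hg.2.2.1 (n + 1) u hu
    rw [parity] at this
    exact (CharTwo.add_eq_zero.1 this).symm

theorem parity_conj_append (hg : g ∈ coordGroup m) (hh : h ∈ treeAut) (n : ℕ) {w : Word}
    (hw : w.length = m + 1) :
    parity n (w ++ [0]) (h * g * h⁻¹) = parity n (h⁻¹ w ++ [0]) g := by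
  have hl := length_apply (inv_mem hh) w
  rw [parity_conj hg.1 hh, apply_append_singleton (inv_mem hh),
    parity_append_eq hg n (by rw [hl, hw])]
  refine coordGroup_apply hg ?_
  rw [length_apply (inv_mem hh)]
  simp [hw]

theorem parity_conj_append_append (hg : g ∈ coordGroup m) (hh : h ∈ treeAut) {τ : Word}
    (hτ : τ.length = m) (s t : ZMod 2) :
    parity 2 (τ ++ [s, t]) (h * g * h⁻¹) = parity 2 (h⁻¹ τ ++ [0, 0]) g := by
  have hl := length_apply (inv_mem hh) τ
  rw [parity_conj hg.1 hh, append_pair_eq, apply_append_singleton (inv_mem hh),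
    apply_append_singleton (inv_mem hh), ← append_pair_eq, hg.2.2.2 _ _ _ (by rw [hl, hτ])]
  refine coordGroup_apply hg ?_
  rw [length_apply (inv_mem hh)]
  simp [hτ]

theorem coordGroup_conj (m : ℕ) :
    ∀ h ∈ treeAut, ∀ g ∈ coordGroup m, h * g * h⁻¹ ∈ coordGroup m := by
  intro h hh g hg
  refine ⟨mul_mem (mul_mem hh hg.1) (inv_mem hh), fun u hu => ?_, fun n u hu => ?_,
    fun τ s t hτ => ?_⟩
  · rw [Equiv.Perm.mul_apply, Equiv.Perm.mul_apply,
      coordGroup_apply hg (by rw [length_apply (inv_mem hh), hu]), ← Equiv.Perm.mul_apply,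
      mul_inv_cancel, Equiv.Perm.one_apply]
  · have hl : (h⁻¹ u).length = m + 1 := by rw [length_apply (inv_mem hh), hu]
    rw [parity_conj hg.1 hh n (coordGroup_apply' hg hl), hg.2.2.1 n _ hl]
  · rw [parity_conj_append_append hg hh hτ, parity_conj_append_append hg hh hτ]

theorem alphaFun_mul (hg : g ∈ coordGroup m) (hh : h ∈ coordGroup m) {w : Word}
    (hw : w.length = m + 1) : alphaFun (g * h) w = alphaFun g w + alphaFun h w := by
  have hu : h (w ++ [0]) = w ++ [0] := coordGroup_apply hh (by simp [hw])
  rw [alphaFun, alphaFun, alphaFun, parity_mul_of_fix hg.1 hh.1 _ hu,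
    parity_mul_of_fix hg.1 hh.1 _ hu]
  ring

theorem betaFun_mul (hg : g ∈ coordGroup m) (hh : h ∈ coordGroup m) {w : Word}
    (hw : w.length = m) : betaFun (g * h) w = betaFun g w + betaFun h w :=
  parity_mul_of_fix hg.1 hh.1 _ (coordGroup_apply hh (by simp [hw]))

theorem alphaFun_inv (hg : g ∈ coordGroup m) {w : Word} (hw : w.length = m + 1) :
    alphaFun g⁻¹ w = alphaFun g w := by
  have hu : g (w ++ [0]) = w ++ [0] := coordGroup_apply hg (by simp [hw])
  rw [alphaFun, alphaFun, parity_inv_of_fix hg.1 _ hu, parity_inv_of_fix hg.1 _ hu]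

theorem betaFun_inv (hg : g ∈ coordGroup m) {w : Word} (hw : w.length = m) :
    betaFun g⁻¹ w = betaFun g w :=
  parity_inv_of_fix hg.1 _ (coordGroup_apply hg (by simp [hw]))

theorem alphaFun_conj (hg : g ∈ coordGroup m) (hh : h ∈ treeAut) {w : Word}
    (hw : w.length = m + 1) : alphaFun (h * g * h⁻¹) w = alphaFun g (h⁻¹ w) := by
  rw [alphaFun, alphaFun, parity_conj_append hg hh _ hw, parity_conj_append hg hh _ hw]

theorem betaFun_conj (hg : g ∈ coordGroup m) (hh : h ∈ treeAut) {w : Word}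
    (hw : w.length = m) : betaFun (h * g * h⁻¹) w = betaFun g (h⁻¹ w) :=
  parity_conj_append_append hg hh hw 0 0

theorem alphaFun_eq_zero (hg : g ∈ coordGroup (m + 1)) {w : Word} (hw : w.length = m + 1) :
    alphaFun g w = 0 := by
  rw [alphaFun, hg.2.2.1 _ _ (by simp [hw]), hg.2.2.1 _ _ (by simp [hw]), add_zero]

theorem betaFun_eq_zero (hg : g ∈ coordGroup (m + 1)) {w : Word} (hw : w.length = m) :
    betaFun g w = 0 := hg.2.2.1 _ _ (by simp [hw])

end coordGroup

theorem pair_mem_coordGroup {m : ℕ} {p q : Equiv.Perm Word} (hp : p ∈ coordGroup m)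
    (hq : q ∈ coordGroup m) : pair p q ∈ coordGroup (m + 1) := by
  refine ⟨pair_mem_treeAut hp.1 hq.1, ?_, ?_, ?_⟩
  · rintro (_ | ⟨t, u⟩) hu
    · simp at hu
    · rw [List.length_cons, Nat.add_right_cancel_iff] at hu
      rcases zmod2_cases t with rfl | rfl
      · rw [pair_zero_cons, coordGroup_apply hp hu]
      · rw [pair_one_cons, coordGroup_apply hq hu]
  · rintro n (_ | ⟨t, u⟩) hu
    · simp at hu
    · rw [List.length_cons, Nat.add_right_cancel_iff] at hu
      rcases zmod2_cases t with rfl | rfl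
      · rw [parity_pair_zero, hp.2.2.1 n u hu]
      · rw [parity_pair_one, hq.2.2.1 n u hu]
  · rintro (_ | ⟨r, τ⟩) s t hτ
    · simp at hτ
    · rw [List.length_cons, Nat.add_right_cancel_iff] at hτ
      rcases zmod2_cases r with rfl | rfl
      · simpa only [List.cons_append, parity_pair_zero] using hp.2.2.2 τ s t hτ
      · simpa only [List.cons_append, parity_pair_one] using hq.2.2.2 τ s t hτ

theorem place_mem_coordGroup {m : ℕ} {g : Equiv.Perm Word} (hg : g ∈ coordGroup m) (σ : Word) :
    place σ g ∈ coordGroup (σ.length + m) := by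
  induction σ with
  | nil => rwa [List.length_nil, zero_add]
  | cons s σ ih =>
    rw [List.length_cons, add_right_comm]
    rcases zmod2_cases s with rfl | rfl
    · rw [place_zero_cons]; exact pair_mem_coordGroup ih (one_mem _)
    · rw [place_one_cons]; exact pair_mem_coordGroup (one_mem _) ih

theorem c_mem_treeAut : c ∈ treeAut := bcd_mem_treeAut.2.1
theorem d_mem_treeAut : d ∈ treeAut := bcd_mem_treeAut.2.2

theorem parity_nil_ca (n : ℕ) :
    parity n [] (c * a) = parity n [] c + parity n [] a ∧
    parity n [] (a * c) = parity n [] c + parity n [] a := by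
  rw [parity_nil_mul c_mem_treeAut a_mem_treeAut, parity_nil_mul a_mem_treeAut c_mem_treeAut]
  exact ⟨rfl, add_comm _ _⟩

theorem parity_x (n : ℕ) (s : ZMod 2) : parity n [s] x = parity n [] c + parity n [] a := by
  rcases zmod2_cases s with rfl | rfl
  · rw [x_eq_pair, parity_pair_zero, (parity_nil_ca n).1]
  · rw [x_eq_pair, parity_pair_one, (parity_nil_ca n).2]

theorem parity_nil_x (n : ℕ) : parity n [] x = 0 := by
  cases n with
  | zero => rw [x_eq_pair]; rfl
  | succ n =>
    rw [parity, List.nil_append, List.nil_append, parity_x, parity_x, CharTwo.add_self_eq_zero]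

theorem parity_two_x (s : ZMod 2) : parity 2 [s] x = 0 := by
  rw [parity_x, parity_two_c, parity_succ_a, add_zero]

theorem pair_apply_singleton {p q : Equiv.Perm Word} (hp : p ∈ treeAut) (hq : q ∈ treeAut)
    {u : Word} (hu : u.length = 1) : pair p q u = u := by
  obtain ⟨t, rfl⟩ := List.length_eq_one_iff.1 hu
  rcases zmod2_cases t with rfl | rfl
  · rw [pair_zero_cons, List.length_eq_zero_iff.1 (length_apply hp [])]
  · rw [pair_one_cons, List.length_eq_zero_iff.1 (length_apply hq [])]

theorem pair_apply_of_length_two {p q : Equiv.Perm Word} (hp : ∀ u : Word, u.length = 1 → p u = u)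
    (hq : ∀ u : Word, u.length = 1 → q u = u) {u : Word} (hu : u.length = 2) : pair p q u = u := by
  rcases u with _ | ⟨t, u⟩
  · simp at hu
  · rw [List.length_cons, Nat.add_right_cancel_iff] at hu
    rcases zmod2_cases t with rfl | rfl
    · rw [pair_zero_cons, hp u hu]
    · rw [pair_one_cons, hq u hu]

theorem x_mem_treeAut : x ∈ treeAut := G_le_treeAut x_mem

theorem x_apply_singleton {u : Word} (hu : u.length = 1) : x u = u := by
  rw [x_eq_pair]
  exact pair_apply_singleton (mul_mem c_mem_treeAut a_mem_treeAut)
    (mul_mem a_mem_treeAut c_mem_treeAut) hu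

theorem pair_x_mem_coordGroup {p q : Equiv.Perm Word} (hp : p = 1 ∨ p = x) (hq : q = 1 ∨ q = x) :
    pair p q ∈ coordGroup 0 := by
  have h1 : ∀ p : Equiv.Perm Word, p = 1 ∨ p = x →
      p ∈ treeAut ∧ (∀ u : Word, u.length = 1 → p u = u) ∧ (∀ n, parity n [] p = 0) ∧ ∀ s, parity 2 [s] p = 0 := by
    rintro p (rfl | rfl)
    · exact ⟨one_mem _, fun _ _ => rfl, fun _ => parity_one _ _, fun _ => parity_one _ _⟩
    · exact ⟨x_mem_treeAut, fun _ hu => x_apply_singleton hu, parity_nil_x, parity_two_x⟩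
  obtain ⟨p1, p2, p3, p4⟩ := h1 p hp
  obtain ⟨q1, q2, q3, q4⟩ := h1 q hq
  have h2 : ∀ s t, parity 2 [s, t] (pair p q) = 0 := by
    intro s t
    rcases zmod2_cases s with rfl | rfl
    · rw [parity_pair_zero, p4]
    · rw [parity_pair_one, q4]
  refine ⟨pair_mem_treeAut p1 q1, fun u hu => pair_apply_of_length_two p2 q2 hu,
    fun n u hu => ?_, fun τ s t hτ => ?_⟩
  · obtain ⟨t, rfl⟩ := List.length_eq_one_iff.1 hu
    rcases zmod2_cases t with rfl | rfl
    · rw [parity_pair_zero, p3]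
    · rw [parity_pair_one, q3]
  · rw [List.length_eq_zero_iff.1 hτ, List.nil_append, List.nil_append, h2, h2]

theorem parity_nil_ad (n : ℕ) :
    parity n [] (a * d) = parity n [] d + parity n [] a ∧
    parity n [] (d * a) = parity n [] d + parity n [] a := by
  rw [parity_nil_mul d_mem_treeAut a_mem_treeAut, parity_nil_mul a_mem_treeAut d_mem_treeAut]
  exact ⟨add_comm _ _, rfl⟩

theorem parity_x_sq (n : ℕ) (s t : ZMod 2) :
    parity n [s, t] (x ^ 2) = parity n [] d + parity n [] a := by
  rw [x_sq_eq_pair, ca_sq, ac_sq]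
  rcases zmod2_cases s with rfl | rfl <;> rcases zmod2_cases t with rfl | rfl <;>
    simp only [parity_pair_zero, parity_pair_one, (parity_nil_ad n).1, (parity_nil_ad n).2]

theorem x_sq_mem_coordGroup : x ^ 2 ∈ coordGroup 0 := by
  have had := mul_mem a_mem_treeAut d_mem_treeAut
  have hda := mul_mem d_mem_treeAut a_mem_treeAut
  refine ⟨pow_mem x_mem_treeAut 2, fun u hu => ?_, fun n u hu => ?_, fun τ s t hτ => ?_⟩
  · rw [x_sq_eq_pair, ca_sq, ac_sq]
    exact pair_apply_of_length_two (fun _ => pair_apply_singleton had hda)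
      (fun _ => pair_apply_singleton hda had) hu
  · rw [sq, parity_mul_of_fix x_mem_treeAut x_mem_treeAut n (x_apply_singleton hu),
      CharTwo.add_self_eq_zero]
  · rw [List.length_eq_zero_iff.1 hτ, List.nil_append, List.nil_append, parity_x_sq, parity_x_sq]

theorem N_succ_le_coordGroup (m : ℕ) : N (m + 1) ≤ coordGroup m := by
  refine sup_le (level_conjClosure_le_of_treeAut (coordGroup_conj m) fun σ hσ => ?_)
    (level_conjClosure_le_of_treeAut (coordGroup_conj m) fun σ hσ => ?_)
  · obtain ⟨τ, s, hτ, rfl⟩ := exists_length_succ hσ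
    have h : place [s] x ∈ coordGroup 0 := by
      rcases zmod2_cases s with rfl | rfl
      · rw [place_zero_cons]
        exact pair_x_mem_coordGroup (Or.inr rfl) (Or.inl rfl)
      · rw [place_one_cons]
        exact pair_x_mem_coordGroup (Or.inl rfl) (Or.inr rfl)
    rw [place_append]
    simpa [hτ] using place_mem_coordGroup h τ
  · have := place_mem_coordGroup x_sq_mem_coordGroup σ
    rw [hσ] at this
    exact this

theorem alphaFun_pair_zero (p q : Equiv.Perm Word) (w : Word) :
    alphaFun (pair p q) (0 :: w) = alphaFun p w := by
  rw [alphaFun, List.cons_append, parity_pair_zero, parity_pair_zero, alphaFun]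

theorem alphaFun_pair_one (p q : Equiv.Perm Word) (w : Word) :
    alphaFun (pair p q) (1 :: w) = alphaFun q w := by
  rw [alphaFun, List.cons_append, parity_pair_one, parity_pair_one, alphaFun]

theorem betaFun_pair_zero (p q : Equiv.Perm Word) (w : Word) :
    betaFun (pair p q) (0 :: w) = betaFun p w := by
  rw [betaFun, List.cons_append, parity_pair_zero, betaFun]

theorem betaFun_pair_one (p q : Equiv.Perm Word) (w : Word) :
    betaFun (pair p q) (1 :: w) = betaFun q w := by
  rw [betaFun, List.cons_append, parity_pair_one, betaFun]

theorem alphaFun_one (w : Word) : alphaFun 1 w = 0 := by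
  rw [alphaFun, parity_one, parity_one, add_zero]

theorem betaFun_one (w : Word) : betaFun 1 w = 0 := parity_one _ _

theorem alphaFun_x : alphaFun x [] = 1 := by
  rw [alphaFun, List.nil_append, parity_two_x, parity_x, parity_zero_c, parity_zero_a]
  rfl

theorem alphaFun_x_sq (s : ZMod 2) : alphaFun (x ^ 2) [s] = 0 := by
  rw [alphaFun, List.cons_append, List.nil_append, parity_x_sq, parity_x_sq, parity_zero_d,
    parity_zero_a, parity_two_d, parity_succ_a]
  rfl

theorem betaFun_x_sq : betaFun (x ^ 2) [] = 1 := by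
  rw [betaFun, List.nil_append, parity_x_sq, parity_two_d, parity_succ_a, add_zero]

theorem parity_x_mul {n : N 1} (k : ℕ) : parity k [0] (x * n) = parity k [0] x := by
  have hn := N_succ_le_coordGroup 0 n.2
  rw [parity_mul_of_fix x_mem_treeAut hn.1 k (coordGroup_apply' hn rfl), hn.2.2.1 k [0] rfl,
    add_zero]

theorem mem_N_one_of_mem_K {k : Equiv.Perm Word} (hk : k ∈ K) (h : alphaFun k [] = 0) :
    k ∈ N 1 := by
  rcases mem_N_one_or_of_mem_K hk with hk | hk
  · exact hk
  · rw [← mul_inv_cancel_left x k, alphaFun, List.nil_append, parity_x_mul (n := ⟨_, hk⟩),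
      parity_x_mul (n := ⟨_, hk⟩)] at h
    have h' := alphaFun_x
    rw [alphaFun, List.nil_append, h] at h'
    exact absurd h' zero_ne_one

theorem parity_two_of_mem_K {k : Equiv.Perm Word} (hk : k ∈ K) : parity 2 [0] k = 0 := by
  rcases mem_N_one_or_of_mem_K hk with hk | hk
  · exact (N_succ_le_coordGroup 0 hk).2.2.1 2 [0] rfl
  · rw [← mul_inv_cancel_left x k, parity_x_mul (n := ⟨_, hk⟩), parity_two_x]

theorem betaFun_of_mem_level_K {m : ℕ} {g : Equiv.Perm Word} (hg : g ∈ level K (m + 1)) {w : Word}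
    (hw : w.length = m) : betaFun g w = 0 := by
  induction w generalizing m g with
  | nil =>
    obtain ⟨p, hp, q, hq, rfl⟩ := mem_level_succ.1 hg
    subst hw
    rw [betaFun, List.nil_append, parity_pair_zero, parity_two_of_mem_K hp]
  | cons s w ih =>
    subst hw
    obtain ⟨p, hp, q, hq, rfl⟩ := mem_level_succ.1 hg
    rcases zmod2_cases s with rfl | rfl
    · rw [betaFun_pair_zero, ih hp rfl]
    · rw [betaFun_pair_one, ih hq rfl]

theorem exists_mem_level_K_alphaFun_eq (m : ℕ) (f : Word → ZMod 2) :
    ∃ g ∈ level K m, ∀ w : Word, w.length = m → alphaFun g w = f w := by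
  induction m generalizing f with
  | zero =>
    rcases zmod2_cases (f []) with hf | hf
    · refine ⟨1, one_mem _, fun w hw => ?_⟩
      rw [List.length_eq_zero_iff.1 hw, hf, alphaFun_one]
    · refine ⟨x, x_mem_K, fun w hw => ?_⟩
      rw [List.length_eq_zero_iff.1 hw, hf, alphaFun_x]
  | succ m ih =>
    obtain ⟨p, hp, hpf⟩ := ih fun w => f (0 :: w)
    obtain ⟨q, hq, hqf⟩ := ih fun w => f (1 :: w)
    refine ⟨pair p q, pair_mem_level hp hq, ?_⟩
    rintro (_ | ⟨s, w⟩) hw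
    · simp at hw
    · rw [List.length_cons, Nat.add_right_cancel_iff] at hw
      rcases zmod2_cases s with rfl | rfl
      · rw [alphaFun_pair_zero, hpf w hw]
      · rw [alphaFun_pair_one, hqf w hw]

theorem exists_mem_level_T_betaFun_eq (m : ℕ) (f : Word → ZMod 2) :
    ∃ g ∈ level T m, (∀ w : Word, w.length = m + 1 → alphaFun g w = 0) ∧
      ∀ w : Word, w.length = m → betaFun g w = f w := by
  induction m generalizing f with
  | zero =>
    rcases zmod2_cases (f []) with hf | hf
    · refine ⟨1, one_mem _, fun w _ => alphaFun_one w, fun w hw => ?_⟩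
      rw [List.length_eq_zero_iff.1 hw, hf, betaFun_one]
    · refine ⟨x ^ 2, x_sq_mem_T, fun w hw => ?_, fun w hw => ?_⟩
      · obtain ⟨s, rfl⟩ := List.length_eq_one_iff.1 hw
        exact alphaFun_x_sq s
      · rw [List.length_eq_zero_iff.1 hw, hf, betaFun_x_sq]
  | succ m ih =>
    obtain ⟨p, hp, hpa, hpf⟩ := ih fun w => f (0 :: w)
    obtain ⟨q, hq, hqa, hqf⟩ := ih fun w => f (1 :: w)
    refine ⟨pair p q, pair_mem_level hp hq, ?_, ?_⟩
    all_goals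
      rintro (_ | ⟨s, w⟩) hw
      · simp at hw
      rw [List.length_cons, Nat.add_right_cancel_iff] at hw
      rcases zmod2_cases s with rfl | rfl
    · rw [alphaFun_pair_zero, hpa w hw]
    · rw [alphaFun_pair_one, hqa w hw]
    · rw [betaFun_pair_zero, hpf w hw]
    · rw [betaFun_pair_one, hqf w hw]

/-- The coordinates `alphaFun` and `betaFun` are faithful on `N_m / N_{m+1}`. -/
theorem mem_N_succ_of_coord_eq_zero {m : ℕ} {g : Equiv.Perm Word} (hg : g ∈ N (m + 1))
    (hα : ∀ w : Word, w.length = m + 1 → alphaFun g w = 0)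
    (hβ : ∀ w : Word, w.length = m → betaFun g w = 0) : g ∈ N (m + 2) := by
  induction m generalizing g with
  | zero =>
    rcases mem_level_K_one_or_of_mem_N_one hg with hk | hk
    · obtain ⟨p, hp, q, hq, rfl⟩ := mem_level_succ.1 hk
      refine pair_mem_N_two (mem_N_one_of_mem_K hp ?_) (mem_N_one_of_mem_K hq ?_)
      · rw [← hα [0] rfl, alphaFun_pair_zero]
      · rw [← hα [1] rfl, alphaFun_pair_one]
    · have h := betaFun_mul (w := []) x_sq_mem_coordGroup
        (N_succ_le_coordGroup 0 ((le_sup_left : level K 1 ≤ N 1) hk)) rfl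
      rw [mul_inv_cancel_left, hβ [] rfl, betaFun_of_mem_level_K hk rfl, betaFun_x_sq] at h
      exact absurd h (by decide)
  | succ m ih =>
    rw [N_succ_eq] at hg ⊢
    obtain ⟨p, hp, q, hq, rfl⟩ := mem_level_succ.1 hg
    refine pair_mem_level ?_ ?_
    · rw [← N_succ_eq] at hp ⊢
      refine ih hp (fun w hw => ?_) (fun w hw => ?_)
      · rw [← hα (0 :: w) (by simp [hw]), alphaFun_pair_zero]
      · rw [← hβ (0 :: w) (by simp [hw]), betaFun_pair_zero]
    · rw [← N_succ_eq] at hq ⊢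
      refine ih hq (fun w hw => ?_) (fun w hw => ?_)
      · rw [← hα (1 :: w) (by simp [hw]), alphaFun_pair_one]
      · rw [← hβ (1 :: w) (by simp [hw]), betaFun_pair_one]

/-! ### The filtration on functions on a level -/

/-- The function on the subtree below the letter `s` given by a function on the tree. -/
def below (s : ZMod 2) (f : Word → ZMod 2) : Word → ZMod 2 := fun w => f (s :: w)

theorem below_add (s : ZMod 2) (f g : Word → ZMod 2) : below s (f + g) = below s f + below s g :=
  rfl

/-- The filtration `V_n^r` in terms of the values of a function on the words of length `n`. With
`f = f_0 + X_1 f_1`, the recursion is `V_n^{2s} = V_{n-1}^s + X_1 V_{n-1}^s` and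
`V_n^{2s+1} = (1 - X_1) V_{n-1}^s + V_{n-1}^{s+1}`. Values at words of other lengths are
unconstrained. -/
def InFil : ℕ → ℕ → (Word → ZMod 2) → Prop
  | 0, r, f => r = 0 ∨ f [] = 0
  | n + 1, r, f => InFil n (r / 2) (below 0 f) ∧ InFil n (r / 2) (below 1 f) ∧
      InFil n ((r + 1) / 2) (below 0 f + below 1 f)

theorem inFil_of_eq_zero {n r : ℕ} {f : Word → ZMod 2} (h : ∀ w : Word, w.length = n → f w = 0) :
    InFil n r f := by
  induction n generalizing r f with
  | zero => exact Or.inr (h [] rfl)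
  | succ n ih =>
    have h' : ∀ s (w : Word), w.length = n → below s f w = 0 := fun s w hw =>
      h (s :: w) (by rw [List.length_cons, hw])
    exact ⟨ih (h' 0), ih (h' 1), ih fun w hw => by
      rw [Pi.add_apply, h' 0 w hw, h' 1 w hw, add_zero]⟩

theorem InFil.add {n r : ℕ} {f g : Word → ZMod 2} (hf : InFil n r f) (hg : InFil n r g) :
    InFil n r (f + g) := by
  induction n generalizing r f g with
  | zero =>
    rcases hf with hf | hf
    · exact Or.inl hf
    · rcases hg with hg | hg
      · exact Or.inl hg
      · exact Or.inr (by rw [Pi.add_apply, hf, hg, add_zero])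
  | succ n ih =>
    refine ⟨ih hf.1 hg.1, ih hf.2.1 hg.2.1, ?_⟩
    rw [below_add, below_add, add_add_add_comm]
    exact ih hf.2.2 hg.2.2

theorem add_self_fun (f : Word → ZMod 2) : f + f = 0 := CharTwo.add_self_eq_zero f

theorem add_add_self_fun (f g : Word → ZMod 2) : f + g + g = f := by
  rw [add_assoc, add_self_fun, add_zero]

theorem inFil_zero (n r : ℕ) : InFil n r 0 := inFil_of_eq_zero fun _ _ => rfl

theorem InFil.congr {n r : ℕ} {f g : Word → ZMod 2} (hf : InFil n r f)
    (h : ∀ w : Word, w.length = n → f w = g w) : InFil n r g := by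
  have h' : InFil n r (g + f) := inFil_of_eq_zero fun w hw => by
    rw [Pi.add_apply, h w hw, CharTwo.add_self_eq_zero]
  rw [← add_add_self_fun g f]
  exact h'.add hf

theorem InFil.mono {n r s : ℕ} {f : Word → ZMod 2} (hf : InFil n r f) (h : s ≤ r) :
    InFil n s f := by
  induction n generalizing r s f with
  | zero =>
    rcases hf with hf | hf
    · exact Or.inl (by omega)
    · exact Or.inr hf
  | succ n ih =>
    exact ⟨ih hf.1 (by omega), ih hf.2.1 (by omega), ih hf.2.2 (by omega)⟩

theorem inFil_zero_right (n : ℕ) (f : Word → ZMod 2) : InFil n 0 f := by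
  induction n generalizing f with
  | zero => exact Or.inl rfl
  | succ n ih => exact ⟨ih _, ih _, ih _⟩

theorem inFil_succ_even {n s : ℕ} {f : Word → ZMod 2} :
    InFil (n + 1) (2 * s) f ↔ InFil n s (below 0 f) ∧ InFil n s (below 1 f) := by
  rw [InFil, show 2 * s / 2 = s by omega, show (2 * s + 1) / 2 = s by omega]
  exact ⟨fun h => ⟨h.1, h.2.1⟩, fun h => ⟨h.1, h.2, h.1.add h.2⟩⟩

theorem inFil_succ_odd {n s : ℕ} {f : Word → ZMod 2} :
    InFil (n + 1) (2 * s + 1) f ↔ InFil n s (below 0 f) ∧ InFil n s (below 1 f) ∧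
      InFil n (s + 1) (below 0 f + below 1 f) := by
  rw [InFil, show (2 * s + 1) / 2 = s by omega, show (2 * s + 1 + 1) / 2 = s + 1 by omega]

theorem InFil.eq_zero {n r : ℕ} {f : Word → ZMod 2} (hf : InFil n r f) (hr : 2 ^ n ≤ r) {w : Word}
    (hw : w.length = n) : f w = 0 := by
  induction n generalizing r f w with
  | zero =>
    rw [List.length_eq_zero_iff.1 hw]
    rcases hf with hf | hf
    · rw [hf] at hr; simp at hr
    · exact hf
  | succ n ih =>
    have hr' : 2 ^ n ≤ r / 2 := by rw [pow_succ] at hr; omega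
    rcases w with _ | ⟨s, w⟩
    · simp at hw
    · rw [List.length_cons, Nat.add_right_cancel_iff] at hw
      rcases zmod2_cases s with rfl | rfl
      · exact ih hf.1 hr' hw
      · exact ih hf.2.1 hr' hw

theorem inFil_one (n : ℕ) {r : ℕ} (hr : r < 2 ^ n) : InFil n r 1 := by
  induction n generalizing r with
  | zero => exact Or.inl (by simpa using hr)
  | succ n ih =>
    have hr' : r / 2 < 2 ^ n := by rw [pow_succ] at hr; omega
    exact ⟨ih hr', ih hr', inFil_zero _ _⟩

/-! ### The generators act on the filtration -/

/-- The difference `f - f ∘ y`, written as a sum since the values are in characteristic `2`. -/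
def delta (y : Equiv.Perm Word) (f : Word → ZMod 2) : Word → ZMod 2 := f + f ∘ y

theorem below_delta_a_zero (f : Word → ZMod 2) : below 0 (delta a f) = below 0 f + below 1 f := rfl
theorem below_delta_a_one (f : Word → ZMod 2) : below 1 (delta a f) = below 0 f + below 1 f :=
  add_comm (below 1 f) (below 0 f)

theorem below_delta_pair_zero (p q : Equiv.Perm Word) (f : Word → ZMod 2) :
    below 0 (delta (pair p q) f) = delta p (below 0 f) := rfl

theorem delta_one (f : Word → ZMod 2) : delta 1 f = 0 := add_self_fun f

/-- The function `f - f ∘ a` agrees on the two subtrees below the root, so its degree is odd. -/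
theorem inFil_delta_a {n r : ℕ} {f : Word → ZMod 2} (hf : InFil n r f) :
    InFil n ((r + 1) / 2 * 2 + 1) (delta a f) := by
  cases n with
  | zero => exact Or.inr (CharTwo.add_self_eq_zero (f []))
  | succ n =>
    rw [mul_comm, inFil_succ_odd, below_delta_a_zero, below_delta_a_one, add_self_fun]
    exact ⟨hf.2.2, hf.2.2, inFil_zero _ _⟩

/-- The rooted automorphism `a` raises an odd degree by at least two. -/
theorem InFil.delta_a_odd {n s : ℕ} {f : Word → ZMod 2} (hf : InFil n (2 * s + 1) f) :
    InFil n (2 * s + 1 + 2) (delta a f) :=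
  (inFil_delta_a hf).mono (by omega)

theorem InFil.delta_a {n r : ℕ} {f : Word → ZMod 2} (hf : InFil n r f) :
    InFil n (r + 1) (delta a f) :=
  (inFil_delta_a hf).mono (by omega)

/-- The generators `b`, `c`, `d` raise an even degree by at least two. -/
theorem InFil.delta_bcd_even {n s : ℕ} {f : Word → ZMod 2} (hf : InFil n (2 * s) f) :
    InFil n (2 * s + 2) (delta b f) ∧ InFil n (2 * s + 2) (delta c f) ∧
      InFil n (2 * s + 2) (delta d f) := by
  induction n generalizing s f with
  | zero =>
    have h := CharTwo.add_self_eq_zero (f [])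
    exact ⟨Or.inr h, Or.inr h, Or.inr h⟩
  | succ n ih =>
    have key : ∀ {g : Word → ZMod 2}, InFil n s g → InFil n (s + 1) (delta b g) ∧
        InFil n (s + 1) (delta c g) ∧ InFil n (s + 1) (delta d g) := by
      intro g hg
      have h := ih (s := s / 2) (hg.mono (by omega))
      exact ⟨h.1.mono (by omega), h.2.1.mono (by omega), h.2.2.mono (by omega)⟩
    rw [inFil_succ_even] at hf
    rw [show 2 * s + 2 = 2 * (s + 1) by ring, inFil_succ_even, inFil_succ_even, inFil_succ_even]
    obtain ⟨hb, hc, hd⟩ := key hf.2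
    have ha := hf.1.delta_a
    refine ⟨⟨?_, ?_⟩, ⟨?_, ?_⟩, ⟨?_, ?_⟩⟩
    · rw [b_eq]; exact ha
    · rw [b_eq]; exact hc
    · rw [c_eq]; exact ha
    · rw [c_eq]; exact hd
    · rw [d_eq, below_delta_pair_zero, delta_one]; exact inFil_zero _ _
    · rw [d_eq]; exact hb

theorem InFil.delta_bcd {n r : ℕ} {f : Word → ZMod 2} (hf : InFil n r f) :
    InFil n (r + 1) (delta b f) ∧ InFil n (r + 1) (delta c f) ∧ InFil n (r + 1) (delta d f) := by
  have h := InFil.delta_bcd_even (s := r / 2) (hf.mono (by omega))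
  exact ⟨h.1.mono (by omega), h.2.1.mono (by omega), h.2.2.mono (by omega)⟩

/-- The group `G` acts trivially on the layers of the filtration. -/
theorem InFil.delta {n r : ℕ} {f : Word → ZMod 2} (hf : InFil n r f) {g : Equiv.Perm Word}
    (hg : g ∈ G) : InFil n (r + 1) (delta g f) := by
  have hcomp : ∀ {r : ℕ} {f : Word → ZMod 2} {g : Equiv.Perm Word}, InFil n r f →
      (∀ f : Word → ZMod 2, InFil n r f → InFil n (r + 1) (Grigorchuk.delta g f)) →
      InFil n r (f ∘ g) := by
    intro r f g hf h
    rw [← add_add_self_fun (f ∘ g) f, add_comm (f ∘ g) f]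
    exact ((h f hf).mono (Nat.le_succ r)).add hf
  let M : Subgroup (Equiv.Perm Word) :=
    { carrier := {g | ∀ (r : ℕ) (f : Word → ZMod 2), InFil n r f →
        InFil n (r + 1) (Grigorchuk.delta g f) ∧ InFil n (r + 1) (Grigorchuk.delta g⁻¹ f)}
      one_mem' := by
        intro r f _
        rw [inv_one, delta_one]
        exact ⟨inFil_zero _ _, inFil_zero _ _⟩
      mul_mem' := by
        have key : ∀ g h : Equiv.Perm Word,
            (∀ (r : ℕ) (f : Word → ZMod 2), InFil n r f → InFil n (r + 1) (Grigorchuk.delta g f)) →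
            (∀ (r : ℕ) (f : Word → ZMod 2), InFil n r f → InFil n (r + 1) (Grigorchuk.delta h f)) →
            ∀ (r : ℕ) (f : Word → ZMod 2), InFil n r f →
              InFil n (r + 1) (Grigorchuk.delta (g * h) f) := by
          intro g h hg hh r f hf
          have e : Grigorchuk.delta (g * h) f =
              Grigorchuk.delta h f + Grigorchuk.delta g f ∘ h := by
            funext w
            change f w + f (g (h w)) = f w + f (h w) + (f (h w) + f (g (h w)))
            rw [← add_assoc, add_assoc (f w) (f (h w)), CharTwo.add_self_eq_zero, add_zero]
          rw [e]
          exact (hh r f hf).add (hcomp (hg r f hf) (hh (r + 1)))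
        intro g h hg hh r f hf
        refine ⟨key g h (fun r f hf => (hg r f hf).1) (fun r f hf => (hh r f hf).1) r f hf, ?_⟩
        rw [mul_inv_rev]
        exact key h⁻¹ g⁻¹ (fun r f hf => (hh r f hf).2) (fun r f hf => (hg r f hf).2) r f hf
      inv_mem' := by
        intro g hg r f hf
        rw [inv_inv]
        exact (hg r f hf).symm }
  refine (G_le_of_mem (H := M) (fun r f hf => ?_) (fun r f hf => ?_) (fun r f hf => ?_) hg r f hf).1
  · rw [a_inv]; exact ⟨hf.delta_a, hf.delta_a⟩
  · rw [b_inv]; exact ⟨hf.delta_bcd.1, hf.delta_bcd.1⟩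
  · rw [d_inv]; exact ⟨hf.delta_bcd.2.2, hf.delta_bcd.2.2⟩

/-- The function that is `f` below the letter `0` and `g` below the letter `1`. -/
def join (f g : Word → ZMod 2) : Word → ZMod 2
  | [] => 0
  | s :: w => if s = 0 then f w else g w

theorem below_zero_join (f g : Word → ZMod 2) : below 0 (join f g) = f := rfl
theorem below_one_join (f g : Word → ZMod 2) : below 1 (join f g) = g := rfl

theorem join_add (f g f' g' : Word → ZMod 2) : join f g + join f' g' = join (f + f') (g + g') := by
  funext w
  rcases w with _ | ⟨s, w⟩
  · exact add_zero 0
  · rcases zmod2_cases s with rfl | rfl <;> rfl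

theorem delta_a_join (f g : Word → ZMod 2) : delta a (join f g) = join (f + g) (f + g) := by
  funext w
  rcases w with _ | ⟨s, w⟩
  · exact add_zero 0
  · rcases zmod2_cases s with rfl | rfl
    · rfl
    · exact add_comm (g w) (f w)

theorem delta_pair_join (p q : Equiv.Perm Word) (f g : Word → ZMod 2) :
    delta (pair p q) (join f g) = join (delta p f) (delta q g) := by
  funext w
  rcases w with _ | ⟨s, w⟩
  · exact add_zero 0
  · rcases zmod2_cases s with rfl | rfl <;> rfl

/-- An additive group `S` of functions contains all the differences `f - f ∘ y` with `f` of
degree `r` at level `n` and `y` a generator, and all functions that vanish on level `n`. -/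
structure ContainsDeltas (n r : ℕ) (S : AddSubgroup (Word → ZMod 2)) : Prop where
  of_zero : ∀ f : Word → ZMod 2, (∀ w : Word, w.length = n → f w = 0) → f ∈ S
  of_a : ∀ f, InFil n r f → delta a f ∈ S
  of_b : ∀ f, InFil n r f → delta b f ∈ S
  of_c : ∀ f, InFil n r f → delta c f ∈ S
  of_d : ∀ f, InFil n r f → delta d f ∈ S

/-- The functions `k` for which `(0, k)` lies in `S`. -/
def rightPart (S : AddSubgroup (Word → ZMod 2)) : AddSubgroup (Word → ZMod 2) where
  carrier := {k | join 0 k ∈ S}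
  zero_mem' := by
    have h := add_self_fun (join 0 0)
    rw [join_add, add_zero] at h
    change join 0 0 ∈ S
    rw [h]
    exact zero_mem S
  add_mem' := by
    intro f g hf hg
    have h : join 0 f + join 0 g ∈ S := add_mem hf hg
    rwa [join_add, add_zero] at h
  neg_mem' := by
    intro f hf
    rwa [CharTwo.neg_eq]

/-- The differences `f - f ∘ y` with `y` a generator span the next step of the filtration. -/
theorem mem_of_containsDeltas {n r : ℕ} {S : AddSubgroup (Word → ZMod 2)}
    (hS : ContainsDeltas n r S) {f : Word → ZMod 2} (hf : InFil n (r + 1) f) : f ∈ S := by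
  induction n generalizing r S f with
  | zero =>
    refine hS.of_zero f fun w hw => ?_
    rw [List.length_eq_zero_iff.1 hw]
    exact hf.resolve_left (Nat.succ_ne_zero r)
  | succ n ih =>
    -- It suffices to treat functions of the forms `(k, k)` and `(0, k)`.
    have split : join (below 0 f) (below 0 f) + join 0 (below 0 f + below 1 f) ∈ S → f ∈ S := by
      intro h
      have e : f = (join (below 0 f) (below 0 f) + join 0 (below 0 f + below 1 f)) +
          (f + (join (below 0 f) (below 0 f) + join 0 (below 0 f + below 1 f))) := by
        rw [add_comm f, ← add_assoc, add_self_fun, zero_add]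
      rw [e]
      refine add_mem h (hS.of_zero _ ?_)
      rintro (_ | ⟨s, w⟩) hw
      · simp at hw
      · rcases zmod2_cases s with rfl | rfl
        · change f (0 :: w) + (f (0 :: w) + 0) = 0
          rw [add_zero, CharTwo.add_self_eq_zero]
        · change f (1 :: w) + (f (0 :: w) + (f (0 :: w) + f (1 :: w))) = 0
          rw [CharTwo.add_cancel_left, CharTwo.add_self_eq_zero]
    -- Modulo the functions `(k, k)`, every function has the form `(0, k)`.
    have shift : ∀ k k', join k k ∈ S → join k k' ∈ S → join 0 (k + k') ∈ S := by
      intro k k' h h'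
      have := add_mem h h'
      rwa [join_add, add_self_fun] at this
    rcases Nat.even_or_odd' r with ⟨s, rfl | rfl⟩
    · obtain ⟨hf0, hf1, hf2⟩ := inFil_succ_odd.1 hf
      have diag : ∀ k, InFil n s k → join k k ∈ S := by
        intro k hk
        have := hS.of_a (join k 0) (inFil_succ_even.2 ⟨hk, inFil_zero _ _⟩)
        rwa [delta_a_join, add_zero] at this
      have right : ∀ k, InFil n s k → InFil (n + 1) (2 * s) (join 0 k) := fun k hk =>
        inFil_succ_even.2 ⟨inFil_zero _ _, hk⟩
      have hS' : ContainsDeltas n s (rightPart S) := by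
        refine ⟨fun k hk => hS.of_zero _ ?_, fun k hk => ?_, fun k hk => ?_, fun k hk => ?_,
          fun k hk => ?_⟩
        · rintro (_ | ⟨t, w⟩) hw
          · rfl
          · rcases zmod2_cases t with rfl | rfl
            · rfl
            · exact hk w (by simpa using hw)
        · have h := hS.of_b (join k 0) (inFil_succ_even.2 ⟨hk, inFil_zero _ _⟩)
          rw [b_eq, delta_pair_join] at h
          have h' := shift _ _ (diag _ (hk.delta_a.mono (Nat.le_succ s))) h
          rwa [show delta c (0 : Word → ZMod 2) = 0 from add_zero 0, add_zero] at h'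
        · have h := hS.of_d _ (right k hk)
          rwa [d_eq, delta_pair_join, delta_one] at h
        · have h := hS.of_b _ (right k hk)
          rwa [b_eq, delta_pair_join, show delta a (0 : Word → ZMod 2) = 0 from add_zero 0] at h
        · have h := hS.of_c _ (right k hk)
          rwa [c_eq, delta_pair_join, show delta a (0 : Word → ZMod 2) = 0 from add_zero 0] at h
      exact split (add_mem (diag _ hf0) (ih hS' hf2))
    · rw [show 2 * s + 1 + 1 = 2 * (s + 1) by ring] at hf
      obtain ⟨hf0, hf1⟩ := inFil_succ_even.1 hf
      have diag : ∀ k, InFil n (s + 1) k → join k k ∈ S := by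
        intro k hk
        have := hS.of_a (join k 0) (inFil_succ_odd.2 ⟨hk.mono (Nat.le_succ s), inFil_zero _ _, by
          rwa [below_zero_join, below_one_join, add_zero]⟩)
        rwa [delta_a_join, add_zero] at this
      have dd : ∀ k, InFil n s k → InFil (n + 1) (2 * s + 1) (join k k) := fun k hk =>
        inFil_succ_odd.2 ⟨hk, hk, by
          rw [below_zero_join, below_one_join, add_self_fun]; exact inFil_zero _ _⟩
      have right : ∀ k, InFil n (s + 1) k → InFil (n + 1) (2 * s + 1) (join 0 k) := fun k hk =>
        inFil_succ_odd.2 ⟨inFil_zero _ _, hk.mono (Nat.le_succ s), by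
          rwa [below_zero_join, below_one_join, zero_add]⟩
      have left : ∀ k, InFil n (s + 1) k → InFil (n + 1) (2 * s + 1) (join k 0) := fun k hk =>
        inFil_succ_odd.2 ⟨hk.mono (Nat.le_succ s), inFil_zero _ _, by
          rwa [below_zero_join, below_one_join, add_zero]⟩
      have zero : ∀ k : Word → ZMod 2, (∀ w : Word, w.length = n → k w = 0) →
          k ∈ rightPart S := by
        intro k hk
        refine hS.of_zero _ ?_
        rintro (_ | ⟨t, w⟩) hw
        · rfl
        · rcases zmod2_cases t with rfl | rfl
          · rfl
          · exact hk w (by simpa using hw)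
      -- The part of degree `s + 2` comes from functions `(0, k)` and `(k, 0)`.
      have hS' : ContainsDeltas n (s + 1) (rightPart S) := by
        refine ⟨zero, fun k hk => ?_, fun k hk => ?_, fun k hk => ?_, fun k hk => ?_⟩
        · have h := hS.of_b _ (left k hk)
          rw [b_eq, delta_pair_join] at h
          have h' := shift _ _ (diag _ (hk.delta_a.mono (Nat.le_succ _))) h
          rwa [show delta c (0 : Word → ZMod 2) = 0 from add_zero 0, add_zero] at h'
        · have h := hS.of_d _ (right k hk)
          rwa [d_eq, delta_pair_join, delta_one] at h
        · have h := hS.of_b _ (right k hk)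
          rwa [b_eq, delta_pair_join, show delta a (0 : Word → ZMod 2) = 0 from add_zero 0] at h
        · have h := hS.of_c _ (right k hk)
          rwa [c_eq, delta_pair_join, show delta a (0 : Word → ZMod 2) = 0 from add_zero 0] at h
      have step : ∀ k, InFil n (s + 2) k → k ∈ rightPart S := fun k hk => ih hS' hk
      -- The part of degree `s + 1` modulo degree `s + 2` comes from functions `(k, k)`.
      have eb : ∀ k, InFil n s k → delta b k ∈ rightPart S := by
        intro k hk
        have h := hS.of_d _ (dd k hk)
        rwa [d_eq, delta_pair_join, delta_one] at h
      have eac : ∀ k, InFil n s k → delta a k + delta c k ∈ rightPart S := by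
        intro k hk
        have h := hS.of_b _ (dd k hk)
        rw [b_eq, delta_pair_join] at h
        exact shift _ _ (diag _ hk.delta_a) h
      have ead : ∀ k, InFil n s k → delta a k + delta d k ∈ rightPart S := by
        intro k hk
        have h := hS.of_c _ (dd k hk)
        rw [c_eq, delta_pair_join] at h
        exact shift _ _ (diag _ hk.delta_a) h
      have ea : ∀ k, InFil n s k → delta a k ∈ rightPart S := by
        intro k hk
        rcases Nat.even_or_odd' s with ⟨t, rfl | rfl⟩
        · have h := add_mem (eac k hk) (step _ hk.delta_bcd_even.2.1)
          rwa [add_add_self_fun] at h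
        · exact step _ hk.delta_a_odd
      have hS'' : ContainsDeltas n s (rightPart S) := by
        refine ⟨zero, ea, eb, fun k hk => ?_, fun k hk => ?_⟩
        · have h := add_mem (eac k hk) (ea k hk)
          rwa [add_comm (delta a k), add_add_self_fun] at h
        · have h := add_mem (ead k hk) (ea k hk)
          rwa [add_comm (delta a k), add_add_self_fun] at h
      exact split (add_mem (diag _ hf0) (ih hS'' (hf0.add hf1)))

/-! ### The layers between `N_m` and `N_{m+1}` -/

/-- `layer m r` consists of the elements of `N_{m+1}` whose coordinates have degree at least `r`.
It lies between `N_{m+1}` (for `r = 0`) and `N_{m+2}` (for `r = 2^{m+1}`). -/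
def layer (m r : ℕ) : Subgroup (Equiv.Perm Word) where
  carrier := {g | g ∈ N (m + 1) ∧ InFil (m + 1) r (alphaFun g) ∧ InFil m r (betaFun g)}
  one_mem' := ⟨one_mem _, inFil_of_eq_zero fun w _ => alphaFun_one w,
    inFil_of_eq_zero fun w _ => betaFun_one w⟩
  mul_mem' := by
    rintro g h ⟨hg, g1, g2⟩ ⟨hh, h1, h2⟩
    have hg' := N_succ_le_coordGroup m hg
    have hh' := N_succ_le_coordGroup m hh
    exact ⟨mul_mem hg hh, (g1.add h1).congr fun w hw => (alphaFun_mul hg' hh' hw).symm,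
      (g2.add h2).congr fun w hw => (betaFun_mul hg' hh' hw).symm⟩
  inv_mem' := by
    rintro g ⟨hg, g1, g2⟩
    have hg' := N_succ_le_coordGroup m hg
    exact ⟨inv_mem hg, g1.congr fun w hw => (alphaFun_inv hg' hw).symm,
      g2.congr fun w hw => (betaFun_inv hg' hw).symm⟩

theorem layer_le_N (m r : ℕ) : layer m r ≤ N (m + 1) := fun _ hg => hg.1

theorem layer_zero (m : ℕ) : layer m 0 = N (m + 1) :=
  le_antisymm (layer_le_N m 0) fun _ hg => ⟨hg, inFil_zero_right _ _, inFil_zero_right _ _⟩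

theorem N_le_layer (m r : ℕ) : N (m + 2) ≤ layer m r := fun _ hg =>
  have hg' := N_succ_le_coordGroup (m + 1) hg
  ⟨N_succ_succ_le m hg, inFil_of_eq_zero fun _ hw => alphaFun_eq_zero hg' hw,
    inFil_of_eq_zero fun _ hw => betaFun_eq_zero hg' hw⟩

theorem layer_two_pow (m : ℕ) : layer m (2 ^ (m + 1)) = N (m + 2) := by
  refine le_antisymm (fun g hg => ?_) (N_le_layer m _)
  refine mem_N_succ_of_coord_eq_zero hg.1 (fun w hw => hg.2.1.eq_zero le_rfl hw)
    fun w hw => hg.2.2.eq_zero ?_ hw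
  exact Nat.pow_le_pow_right two_pos (Nat.le_succ m)

theorem alphaFun_commutator {m : ℕ} {g h : Equiv.Perm Word} (hg : g ∈ N (m + 1)) (hh : h ∈ G)
    {w : Word} (hw : w.length = m + 1) : alphaFun ⁅g, h⁆ w = delta h⁻¹ (alphaFun g) w := by
  have hg' := N_succ_le_coordGroup m hg
  have hh' := G_le_treeAut hh
  rw [show ⁅g, h⁆ = g * (h * g⁻¹ * h⁻¹) by rw [commutatorElement_def]; group,
    alphaFun_mul hg' (coordGroup_conj m h hh' _ (inv_mem hg')) hw,
    alphaFun_conj (inv_mem hg') hh' hw, alphaFun_inv hg' (by rw [length_apply (inv_mem hh'), hw])]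
  rfl

theorem betaFun_commutator {m : ℕ} {g h : Equiv.Perm Word} (hg : g ∈ N (m + 1)) (hh : h ∈ G)
    {w : Word} (hw : w.length = m) : betaFun ⁅g, h⁆ w = delta h⁻¹ (betaFun g) w := by
  have hg' := N_succ_le_coordGroup m hg
  have hh' := G_le_treeAut hh
  rw [show ⁅g, h⁆ = g * (h * g⁻¹ * h⁻¹) by rw [commutatorElement_def]; group,
    betaFun_mul hg' (coordGroup_conj m h hh' _ (inv_mem hg')) hw,
    betaFun_conj (inv_mem hg') hh' hw, betaFun_inv hg' (by rw [length_apply (inv_mem hh'), hw])]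
  rfl

theorem layer_commutator_le (m r : ℕ) : ⁅layer m r, G⁆ ≤ layer m (r + 1) := by
  rw [Subgroup.commutator_le]
  intro g hg h hh
  refine ⟨?_, ?_, ?_⟩
  · rw [show ⁅g, h⁆ = g * (h * g⁻¹ * h⁻¹) by rw [commutatorElement_def]; group]
    exact mul_mem hg.1 (N_gStable _ h hh _ (inv_mem hg.1))
  · exact (hg.2.1.delta (inv_mem hh)).congr fun w hw => (alphaFun_commutator hg.1 hh hw).symm
  · exact (hg.2.2.delta (inv_mem hh)).congr fun w hw => (betaFun_commutator hg.1 hh hw).symm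

theorem layer_gStable (m r : ℕ) : GStable (layer m r) := by
  intro g hg y hy
  have h : layer m (r + 1) ≤ layer m r := fun z hz =>
    ⟨hz.1, hz.2.1.mono (Nat.le_succ r), hz.2.2.mono (Nat.le_succ r)⟩
  have hc := h (layer_commutator_le m r (Subgroup.commutator_mem_commutator hy hg))
  rw [show g * y * g⁻¹ = ⁅y, g⁆⁻¹ * y by rw [commutatorElement_def]; group]
  exact mul_mem (inv_mem hc) hy

/-- `(x, …, x)`, with one factor `x` at every vertex of level `m`. -/
noncomputable def diagX : ℕ → Equiv.Perm Word
  | 0 => x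
  | m + 1 => pair (diagX m) (diagX m)

theorem diagX_mem (m : ℕ) : diagX m ∈ level K m := by
  induction m with
  | zero => exact x_mem_K
  | succ m ih => exact pair_mem_level ih ih

theorem alphaFun_diagX {m : ℕ} {w : Word} (hw : w.length = m) : alphaFun (diagX m) w = 1 := by
  induction m generalizing w with
  | zero => rw [List.length_eq_zero_iff.1 hw]; exact alphaFun_x
  | succ m ih =>
    rcases w with _ | ⟨s, w⟩
    · simp at hw
    · rw [List.length_cons, Nat.add_right_cancel_iff] at hw
      rcases zmod2_cases s with rfl | rfl
      · rw [diagX, alphaFun_pair_zero, ih hw]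
      · rw [diagX, alphaFun_pair_one, ih hw]

theorem commutator_pair (p q p' q' : Equiv.Perm Word) :
    ⁅pair p q, pair p' q'⁆ = pair ⁅p, p'⁆ ⁅q, q'⁆ := by
  simp only [commutatorElement_def, pair_inv, pair_mul]

theorem commutator_x_a : ⁅x, a⁆ = x ^ 2 := by
  rw [commutatorElement_def, show x * a * x⁻¹ * a⁻¹ = x * (a * x * a⁻¹)⁻¹ by group, a_conj_x,
    inv_inv, sq]

theorem commutator_x_b : ⁅x, b⁆ = x ^ 2 := by
  rw [commutatorElement_def, show x * b * x⁻¹ * b⁻¹ = x * (b * x * b⁻¹)⁻¹ by group, b_conj_x,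
    inv_inv, sq]

theorem commutator_diagX_a (m : ℕ) : ⁅diagX (m + 1), a⁆ = 1 := by
  rw [commutatorElement_eq_one_iff_mul_comm, diagX, a_mul_pair]

theorem bcd_subset_G {y : Equiv.Perm Word} (hy : y ∈ ({b, c, d} : Set (Equiv.Perm Word))) :
    y ∈ G := Subgroup.subset_closure (Set.mem_insert_of_mem a hy)

/-- A commutator of `(x, …, x)` with one of `b`, `c`, `d` reappears at the vertex `1`. -/
theorem exists_commutator_diagX_succ {y : Equiv.Perm Word}
    (hy : y ∈ ({b, c, d} : Set (Equiv.Perm Word))) :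
    ∃ y' ∈ ({b, c, d} : Set (Equiv.Perm Word)), ∀ m,
      ⁅diagX (m + 2), y'⁆ = pair 1 ⁅diagX (m + 1), y⁆ := by
  rcases hy with rfl | rfl | rfl
  · refine ⟨d, by simp, fun m => ?_⟩
    rw [diagX, d_eq, commutator_pair, commutatorElement_one_right]
  · refine ⟨b, by simp, fun m => ?_⟩
    rw [diagX, b_eq, commutator_pair, commutator_diagX_a]
  · refine ⟨c, by simp, fun m => ?_⟩
    rw [diagX, c_eq, commutator_pair, commutator_diagX_a]

theorem exists_commutator_diagX_eq_x_sq (m : ℕ) : ∃ y ∈ ({b, c, d} : Set (Equiv.Perm Word)),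
    ⁅diagX (m + 1), y⁆ = place (List.replicate (m + 1) 1) (x ^ 2) := by
  induction m with
  | zero =>
    refine ⟨d, by simp, ?_⟩
    rw [diagX, d_eq, commutator_pair, commutatorElement_one_right, List.replicate_one,
      place_one_cons, diagX, commutator_x_b]
    rfl
  | succ m ih =>
    obtain ⟨y, hy, h⟩ := ih
    obtain ⟨y', hy', h'⟩ := exists_commutator_diagX_succ hy
    refine ⟨y', hy', ?_⟩
    rw [h', h, List.replicate_succ (n := m + 1), place_one_cons]

theorem exists_commutator_diagX_eq_x (m : ℕ) : ∃ y ∈ ({b, c, d} : Set (Equiv.Perm Word)),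
    ⁅diagX (m + 1), y⁆ =
      place (List.replicate m 1 ++ [0]) (x ^ 2) * place (List.replicate (m + 2) 1) x := by
  induction m with
  | zero =>
    refine ⟨c, by simp, ?_⟩
    have h : ⁅x, d⁆ = pair 1 x := commutator_x_d
    rw [diagX, c_eq, commutator_pair, diagX, commutator_x_a, h, List.replicate_zero,
      List.nil_append, place_zero_cons, List.replicate_succ, List.replicate_one, place_one_cons,
      place_one_cons, pair_mul, mul_one, one_mul]
    rfl
  | succ m ih =>
    obtain ⟨y, hy, h⟩ := ih
    obtain ⟨y', hy', h'⟩ := exists_commutator_diagX_succ hy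
    refine ⟨y', hy', ?_⟩
    rw [h', h, List.replicate_succ (n := m), List.cons_append, place_one_cons,
      List.replicate_succ (n := m + 2), place_one_cons, pair_mul, mul_one]

/-- Commutators with `(x, …, x)` already generate all of `N_{m+2}`. -/
theorem N_le_layer_commutator {m r : ℕ} (hr : r < 2 ^ (m + 1)) : N (m + 2) ≤ ⁅layer m r, G⁆ := by
  have hst : GStable ⁅layer m r, G⁆ := (layer_gStable m r).commutator
  have hd : diagX (m + 1) ∈ layer m r := by
    refine ⟨(le_sup_left : level K (m + 1) ≤ N (m + 1)) (diagX_mem (m + 1)),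
      (inFil_one (m + 1) hr).congr fun w hw => (alphaFun_diagX hw).symm,
      inFil_of_eq_zero fun w hw => betaFun_of_mem_level_K (diagX_mem (m + 1)) hw⟩
  obtain ⟨y, hy, h1⟩ := exists_commutator_diagX_eq_x_sq m
  obtain ⟨z, hz, h2⟩ := exists_commutator_diagX_eq_x m
  have hx2 : place (List.replicate (m + 1) 1) (x ^ 2) ∈ ⁅layer m r, G⁆ :=
    h1 ▸ Subgroup.commutator_mem_commutator hd (bcd_subset_G hy)
  have hx := Subgroup.commutator_mem_commutator hd (bcd_subset_G hz)
  rw [h2] at hx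
  obtain ⟨g, hg, hgy⟩ := exists_conj_place (one_mem G) (List.replicate m 1 ++ [0])
  have h3 := hgy (x ^ 2)
  rw [one_mul, inv_one, mul_one, List.length_append, List.length_replicate, List.length_singleton]
    at h3
  have h4 := hst g hg _ hx2
  rw [h3] at h4
  exact N_succ_le hst ((Subgroup.mul_mem_cancel_left _ h4).1 hx) hx2

theorem containsDeltas_of_generators {n r : ℕ} {S : AddSubgroup (Word → ZMod 2)}
    (h0 : ∀ f : Word → ZMod 2, (∀ w : Word, w.length = n → f w = 0) → f ∈ S)
    (h : ∀ y ∈ G, ∀ f, InFil n r f → delta y⁻¹ f ∈ S) : ContainsDeltas n r S := by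
  refine ⟨h0, fun f hf => ?_, fun f hf => ?_, fun f hf => ?_, fun f hf => ?_⟩
  · rw [← a_inv]; exact h a a_mem f hf
  · rw [← b_inv]; exact h b b_mem f hf
  · rw [← c_inv]; exact h c c_mem f hf
  · rw [← d_inv]; exact h d d_mem f hf

/-- The functions that are, on level `m + 1`, the `α`-coordinate of an element of `H` with trivial
`β`-coordinate. -/
def alphaRange {m : ℕ} {H : Subgroup (Equiv.Perm Word)} (hH : H ≤ N (m + 1)) :
    AddSubgroup (Word → ZMod 2) where
  carrier := {f | ∃ h ∈ H, (∀ w : Word, w.length = m + 1 → alphaFun h w = f w) ∧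
    ∀ w : Word, w.length = m → betaFun h w = 0}
  zero_mem' := ⟨1, one_mem _, fun w _ => alphaFun_one w, fun w _ => betaFun_one w⟩
  add_mem' := by
    rintro f f' ⟨h, hh, h1, h2⟩ ⟨h', hh', h1', h2'⟩
    have k := N_succ_le_coordGroup m (hH hh)
    have k' := N_succ_le_coordGroup m (hH hh')
    refine ⟨h * h', mul_mem hh hh', fun w hw => ?_, fun w hw => ?_⟩
    · rw [alphaFun_mul k k' hw, h1 w hw, h1' w hw, Pi.add_apply]
    · rw [betaFun_mul k k' hw, h2 w hw, h2' w hw, add_zero]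
  neg_mem' := by
    intro f hf
    rwa [CharTwo.neg_eq]

/-- The functions that are, on level `m`, the `β`-coordinate of an element of `H` with trivial
`α`-coordinate. -/
def betaRange {m : ℕ} {H : Subgroup (Equiv.Perm Word)} (hH : H ≤ N (m + 1)) :
    AddSubgroup (Word → ZMod 2) where
  carrier := {f | ∃ h ∈ H, (∀ w : Word, w.length = m + 1 → alphaFun h w = 0) ∧
    ∀ w : Word, w.length = m → betaFun h w = f w}
  zero_mem' := ⟨1, one_mem _, fun w _ => alphaFun_one w, fun w _ => betaFun_one w⟩
  add_mem' := by
    rintro f f' ⟨h, hh, h1, h2⟩ ⟨h', hh', h1', h2'⟩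
    have k := N_succ_le_coordGroup m (hH hh)
    have k' := N_succ_le_coordGroup m (hH hh')
    refine ⟨h * h', mul_mem hh hh', fun w hw => ?_, fun w hw => ?_⟩
    · rw [alphaFun_mul k k' hw, h1 w hw, h1' w hw, add_zero]
    · rw [betaFun_mul k k' hw, h2 w hw, h2' w hw, Pi.add_apply]
  neg_mem' := by
    intro f hf
    rwa [CharTwo.neg_eq]

/-- Commutators with `G` raise the degree by exactly one. -/
theorem layer_commutator {m r : ℕ} (hr : r < 2 ^ (m + 1)) : ⁅layer m r, G⁆ = layer m (r + 1) := by
  refine le_antisymm (layer_commutator_le m r) fun g hg => ?_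
  have hN : ⁅layer m r, G⁆ ≤ N (m + 1) := (layer_commutator_le m r).trans (layer_le_N m _)
  have hα : ContainsDeltas (m + 1) r (alphaRange hN) := by
    refine containsDeltas_of_generators (fun f hf => ⟨1, one_mem _, fun w hw => ?_, fun w _ =>
      betaFun_one w⟩) fun y hy f hf => ?_
    · rw [alphaFun_one, hf w hw]
    · obtain ⟨k, hk, hkf⟩ := exists_mem_level_K_alphaFun_eq (m + 1) f
      have hk0 : ∀ w : Word, w.length = m → betaFun k w = 0 := fun w hw =>
        betaFun_of_mem_level_K hk hw
      have hkN : k ∈ N (m + 1) := (le_sup_left : level K (m + 1) ≤ N (m + 1)) hk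
      have hkl : k ∈ layer m r := ⟨hkN, hf.congr fun w hw => (hkf w hw).symm, inFil_of_eq_zero hk0⟩
      refine ⟨⁅k, y⁆, Subgroup.commutator_mem_commutator hkl hy, fun w hw => ?_, fun w hw => ?_⟩
      · have hl := length_apply (inv_mem (G_le_treeAut hy)) w
        rw [alphaFun_commutator hkN hy hw]
        change alphaFun k w + alphaFun k (y⁻¹ w) = f w + f (y⁻¹ w)
        rw [hkf w hw, hkf _ (by rw [hl, hw])]
      · have hl := length_apply (inv_mem (G_le_treeAut hy)) w
        rw [betaFun_commutator hkN hy hw]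
        change betaFun k w + betaFun k (y⁻¹ w) = 0
        rw [hk0 w hw, hk0 _ (by rw [hl, hw]), add_zero]
  have hβ : ContainsDeltas m r (betaRange hN) := by
    refine containsDeltas_of_generators (fun f hf => ⟨1, one_mem _, fun w _ => alphaFun_one w,
      fun w hw => ?_⟩) fun y hy f hf => ?_
    · rw [betaFun_one, hf w hw]
    · obtain ⟨k, hk, hk0, hkf⟩ := exists_mem_level_T_betaFun_eq m f
      have hkN : k ∈ N (m + 1) := (le_sup_right : level T m ≤ N (m + 1)) hk
      have hkl : k ∈ layer m r := ⟨hkN, inFil_of_eq_zero hk0, hf.congr fun w hw => (hkf w hw).symm⟩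
      refine ⟨⁅k, y⁆, Subgroup.commutator_mem_commutator hkl hy, fun w hw => ?_, fun w hw => ?_⟩
      · have hl := length_apply (inv_mem (G_le_treeAut hy)) w
        rw [alphaFun_commutator hkN hy hw]
        change alphaFun k w + alphaFun k (y⁻¹ w) = 0
        rw [hk0 w hw, hk0 _ (by rw [hl, hw]), add_zero]
      · have hl := length_apply (inv_mem (G_le_treeAut hy)) w
        rw [betaFun_commutator hkN hy hw]
        change betaFun k w + betaFun k (y⁻¹ w) = f w + f (y⁻¹ w)
        rw [hkf w hw, hkf _ (by rw [hl, hw])]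
  obtain ⟨h, hh, h1, h2⟩ := mem_of_containsDeltas hα hg.2.1
  obtain ⟨k, hk, k1, k2⟩ := mem_of_containsDeltas hβ hg.2.2
  have hg' := N_succ_le_coordGroup m hg.1
  have hh' := N_succ_le_coordGroup m (hN hh)
  have hk' := N_succ_le_coordGroup m (hN hk)
  have hmem : g * (h * k)⁻¹ ∈ N (m + 2) := by
    refine mem_N_succ_of_coord_eq_zero (mul_mem hg.1 (inv_mem (mul_mem (hN hh) (hN hk))))
      (fun w hw => ?_) fun w hw => ?_
    · rw [alphaFun_mul hg' (inv_mem (mul_mem hh' hk')) hw, alphaFun_inv (mul_mem hh' hk') hw,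
        alphaFun_mul hh' hk' hw, h1 w hw, k1 w hw, add_zero, CharTwo.add_self_eq_zero]
    · rw [betaFun_mul hg' (inv_mem (mul_mem hh' hk')) hw, betaFun_inv (mul_mem hh' hk') hw,
        betaFun_mul hh' hk' hw, h2 w hw, k2 w hw, zero_add, CharTwo.add_self_eq_zero]
  have := mul_mem (N_le_layer_commutator hr hmem) (mul_mem hh hk)
  rwa [inv_mul_cancel_right] at this

/-! ### The lower central series -/

theorem gammaG_one : gammaG 1 = G := by
  rw [gammaG, gamma, Nat.sub_self, Subgroup.lowerCentralSeries_zero, ← MonoidHom.range_eq_map,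
    Subgroup.range_subtype]

theorem gammaG_succ {n : ℕ} (hn : 1 ≤ n) : gammaG (n + 1) = ⁅gammaG n, G⁆ := by
  have h : gamma G (n + 1) = ⁅gamma G n, ⊤⁆ := by
    obtain ⟨k, rfl⟩ := Nat.exists_eq_add_of_le' hn
    rfl
  rw [gammaG, h, Subgroup.map_commutator, ← MonoidHom.range_eq_map, Subgroup.range_subtype]
  rfl

/-- The elements of `G` that are central modulo the `G`-stable subgroup `H`. -/
def centralMod {H : Subgroup (Equiv.Perm Word)} (hH : GStable H) : Subgroup (Equiv.Perm Word) where
  carrier := {y | y ∈ G ∧ ∀ g ∈ G, g * y * g⁻¹ * y⁻¹ ∈ H}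
  one_mem' := ⟨one_mem _, fun g _ => by simp⟩
  mul_mem' := by
    rintro y z ⟨hy, hyH⟩ ⟨hz, hzH⟩
    refine ⟨mul_mem hy hz, fun g hg => ?_⟩
    rw [show g * (y * z) * g⁻¹ * (y * z)⁻¹ =
      g * y * g⁻¹ * y⁻¹ * (y * (g * z * g⁻¹ * z⁻¹) * y⁻¹) by group]
    exact mul_mem (hyH g hg) (hH y hy _ (hzH g hg))
  inv_mem' := by
    rintro y ⟨hy, hyH⟩
    refine ⟨inv_mem hy, fun g hg => ?_⟩
    rw [show g * y⁻¹ * g⁻¹ * y⁻¹⁻¹ = y⁻¹ * (y * g * y⁻¹ * g⁻¹) * y by group,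
      show y * g * y⁻¹ * g⁻¹ = (g * y * g⁻¹ * y⁻¹)⁻¹ by group]
    exact hH.inv_conj hy (inv_mem (hyH g hg))

theorem centralMod_gStable {H : Subgroup (Equiv.Perm Word)} (hH : GStable H) :
    GStable (centralMod hH) := by
  rintro h hh y ⟨hy, hyH⟩
  refine ⟨mul_mem (mul_mem hh hy) (inv_mem hh), fun g hg => ?_⟩
  rw [show g * (h * y * h⁻¹) * g⁻¹ * (h * y * h⁻¹)⁻¹ =
    (g * h * y * (g * h)⁻¹ * y⁻¹) * (h * y * h⁻¹ * y⁻¹)⁻¹ by group]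
  exact mul_mem (hyH _ (mul_mem hg hh)) (inv_mem (hyH h hh))

/-- If the commutators of the generators lie in a `G`-stable subgroup, so do all commutators. -/
theorem commutator_G_le {H : Subgroup (Equiv.Perm Word)} (hH : GStable H) (hx : x ∈ H)
    (had : a * d * a⁻¹ * d⁻¹ ∈ H) : ⁅G, G⁆ ≤ H := by
  have hself : ∀ y : Equiv.Perm Word, y * y * y⁻¹ * y⁻¹ ∈ H := by
    intro y
    simp
  have hswap : ∀ {y z : Equiv.Perm Word}, y * z * y⁻¹ * z⁻¹ ∈ H → z * y * z⁻¹ * y⁻¹ ∈ H := by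
    intro y z h
    have := inv_mem h
    rwa [show (y * z * y⁻¹ * z⁻¹)⁻¹ = z * y * z⁻¹ * y⁻¹ by group] at this
  have hbd : b * d * b⁻¹ * d⁻¹ ∈ H := by
    rw [b_inv, d_inv, b_mul_d, c_mul_b, d_mul_d]
    exact one_mem H
  rw [Subgroup.commutator_le]
  intro g hg y hy
  refine conj_mul_inv_mem hH ?_ ?_ ?_ hg
  all_goals refine hswap (conj_mul_inv_mem hH ?_ ?_ ?_ hy)
  · exact hself a
  · exact hswap hx
  · exact hswap had
  · exact hx
  · exact hself b
  · exact hswap hbd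
  · exact had
  · exact hbd
  · exact hself d

theorem commutator_a_d : a * d * a⁻¹ * d⁻¹ = pair b b := by rw [a_inv, d_inv, ad_sq]

theorem gammaG_three : gammaG 3 = N 1 := by
  have h2 : gammaG 2 = ⁅G, G⁆ := by rw [gammaG_succ le_rfl, gammaG_one]
  rw [gammaG_succ one_le_two, h2]
  have hst : GStable ⁅G, G⁆ := G_gStable.commutator
  have hx : x ∈ ⁅G, G⁆ := Subgroup.commutator_mem_commutator a_mem b_mem
  refine le_antisymm ?_ (N_succ_le hst.commutator ?_ ?_)
  · have key : ⁅G, G⁆ ≤ centralMod (N_gStable 1) := by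
      refine commutator_G_le (centralMod_gStable _) ⟨x_mem, fun g hg =>
        conj_x_mul_inv_mem_N_one hg⟩ ?_
      rw [commutator_a_d]
      have hG : pair b b ∈ G := by
        rw [← ad_sq]
        exact mul_mem (mul_mem (mul_mem a_mem d_mem) a_mem) d_mem
      refine ⟨hG, fun g hg => conj_mul_inv_mem (N_gStable 1) ?_ ?_ ?_ hg⟩
      · rw [a_mul_pair, mul_inv_cancel_right, mul_inv_cancel]
        exact one_mem _
      · have hcb : c * b * c⁻¹ * b⁻¹ = 1 := by rw [c_inv, b_inv, c_mul_b, d_mul_c, b_mul_b]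
        have hconj : ∀ p q, b * pair p q * b⁻¹ = pair (a * p * a⁻¹) (c * q * c⁻¹) := fun p q => by
          rw [b_eq, pair_inv, pair_mul, pair_mul]
        rw [hconj, pair_inv, pair_mul, hcb]
        exact pair_mem_N_one x_mem_K (one_mem _)
      · rw [d_eq, pair_inv, pair_inv, pair_mul, pair_mul, pair_mul, inv_one, one_mul, mul_one,
          mul_inv_cancel, mul_inv_cancel_right, mul_inv_cancel, pair_one]
        exact one_mem _
    rw [Subgroup.commutator_le]
    intro y hy g hg
    rw [commutatorElement_def, show y * g * y⁻¹ * g⁻¹ = (g * y * g⁻¹ * y⁻¹)⁻¹ by group]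
    exact inv_mem ((key hy).2 g hg)
  · have h : place (List.replicate (0 + 1) 1) x = ⁅x, d⁆ := by
      rw [zero_add, List.replicate_one, place_one_cons, commutatorElement_def, commutator_x_d]
      rfl
    rw [h]
    exact Subgroup.commutator_mem_commutator hx d_mem
  · have h : place (List.replicate 0 1) (x ^ 2) = ⁅x, a⁆ := commutator_x_a.symm
    rw [h]
    exact Subgroup.commutator_mem_commutator hx a_mem

theorem gammaG_eq_layer (m : ℕ) {r : ℕ} (hr : r ≤ 2 ^ (m + 1)) :
    gammaG (2 ^ (m + 1) + 1 + r) = layer m r := by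
  induction m generalizing r with
  | zero =>
    induction r with
    | zero => rw [layer_zero]; exact gammaG_three
    | succ r ih =>
      rw [← layer_commutator hr, ← ih (by omega), ← add_assoc, gammaG_succ (by omega)]
  | succ m ihm =>
    induction r with
    | zero =>
      have h := ihm (r := 2 ^ (m + 1)) le_rfl
      rw [layer_two_pow] at h
      rw [layer_zero, ← h]
      congr 1
      ring
    | succ r ih =>
      rw [← layer_commutator hr, ← ih (by omega), ← add_assoc, gammaG_succ (by omega)]

/-! ### The modules `V_n` -/

/-- The element of `V_n` whose coefficients are the values of `f` on the words of length `n`. -/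
noncomputable def toV (n : ℕ) (f : Word → ZMod 2) : V n :=
  AddMonoidAlgebra.ofCoeff (Finsupp.equivFunOnFinite.symm fun σ : Fin n → ZMod 2 => f (List.ofFn σ))

/-- The coefficients of an element of `V_n`, as a function of the words of length `n`. -/
def coeffFun {n : ℕ} (u : V n) : Word → ZMod 2 := fun w => u.coeff fun i => w.getD i 0

theorem coeff_toV (n : ℕ) (f : Word → ZMod 2) (σ : Fin n → ZMod 2) :
    (toV n f).coeff σ = f (List.ofFn σ) := rfl

theorem V_ext {n : ℕ} {u u' : V n} (h : ∀ σ, u.coeff σ = u'.coeff σ) : u = u' :=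
  AddMonoidAlgebra.coeff_injective (Finsupp.ext h)

theorem toV_coeffFun {n : ℕ} (u : V n) : toV n (coeffFun u) = u := by
  refine V_ext fun σ => ?_
  rw [coeff_toV, coeffFun]
  congr 1
  funext i
  simp

theorem ofFn_getD {n : ℕ} {w : Word} (hw : w.length = n) :
    List.ofFn (fun i : Fin n => w.getD i 0) = w := by
  subst hw
  refine List.ext_getElem (by simp) fun i h1 h2 => ?_
  simp

theorem coeffFun_toV {n : ℕ} (f : Word → ZMod 2) {w : Word} (hw : w.length = n) :
    coeffFun (toV n f) w = f w := by
  rw [coeffFun, coeff_toV, ofFn_getD hw]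

theorem toV_congr {n : ℕ} {f g : Word → ZMod 2} (h : ∀ w : Word, w.length = n → f w = g w) :
    toV n f = toV n g := V_ext fun _ => h _ List.length_ofFn

theorem toV_add (n : ℕ) (f g : Word → ZMod 2) : toV n (f + g) = toV n f + toV n g :=
  V_ext fun _ => by rw [AddMonoidAlgebra.coeff_add, Finsupp.add_apply]; rfl

theorem toV_eq_zero {n : ℕ} {f : Word → ZMod 2} :
    toV n f = 0 ↔ ∀ w : Word, w.length = n → f w = 0 := by
  constructor
  · intro h w hw
    rw [← coeffFun_toV f hw, h]
    rfl
  · intro h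
    exact V_ext fun _ => h _ List.length_ofFn

theorem monomial_eq_toV {n : ℕ} (σ : Fin n → ZMod 2) :
    monomial σ = toV n fun w => if w = List.ofFn σ then 1 else 0 := by
  refine V_ext fun τ => ?_
  rw [coeff_toV, monomial, AddMonoidAlgebra.coeff_single, Finsupp.single_apply]
  simp only [List.ofFn_inj, eq_comm]

/-- The coefficients of `v_n^r`, for all `n` simultaneously. -/
def vFun : ℕ → Word → ZMod 2
  | _, [] => 1
  | r, s :: w => (if s = 0 then 1 else ((r % 2 : ℕ) : ZMod 2)) * vFun (r / 2) w

theorem one_sub_X_pow {n : ℕ} (i : Fin n) (k : ℕ) :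
    (1 - X i : V n) ^ (k % 2) = ∑ t : ZMod 2, AddMonoidAlgebra.single (Pi.single i t)
      (if t = 0 then (1 : ZMod 2) else ((k % 2 : ℕ) : ZMod 2)) := by
  rw [show (Finset.univ : Finset (ZMod 2)) = {0, 1} from rfl,
    Finset.sum_pair (by decide : (0 : ZMod 2) ≠ 1), if_pos rfl, if_neg one_ne_zero,
    Pi.single_zero]
  rcases Nat.mod_two_eq_zero_or_one k with h | h <;> rw [h]
  · rw [pow_zero, Nat.cast_zero, AddMonoidAlgebra.single_zero, add_zero]
    rfl
  · have hX : -X i = (AddMonoidAlgebra.single (Pi.single i 1) 1 : V n) := by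
      rw [X, monomial, ← AddMonoidAlgebra.single_neg]
      rfl
    rw [pow_one, Nat.cast_one, sub_eq_add_neg, hX]
    rfl

theorem vFun_ofFn {n : ℕ} (r : ℕ) (σ : Fin n → ZMod 2) :
    vFun r (List.ofFn σ) =
      ∏ i : Fin n, if σ i = 0 then 1 else ((r / 2 ^ (i : ℕ) % 2 : ℕ) : ZMod 2) := by
  induction n generalizing r with
  | zero => rfl
  | succ n ih =>
    rw [List.ofFn_succ, vFun, ih, Fin.prod_univ_succ]
    simp [Nat.div_div_eq_div_mul, pow_succ']

theorem v_eq_toV (n r : ℕ) : v n r = toV n (vFun r) := by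
  have h : v n r = ∑ σ : Fin n → ZMod 2, AddMonoidAlgebra.single σ (vFun r (List.ofFn σ)) := by
    simp only [v, one_sub_X_pow, Finset.prod_univ_sum, AddMonoidAlgebra.prod_single, vFun_ofFn]
    rw [Fintype.piFinset_univ]
    refine Finset.sum_congr rfl fun σ _ => ?_
    rw [Finset.univ_sum_single]
  rw [h]
  refine V_ext fun τ => ?_
  rw [AddMonoidAlgebra.coeff_sum, Finsupp.finsetSum_apply, coeff_toV]
  simp [AddMonoidAlgebra.coeff_single, Finsupp.single_apply]

theorem below_zero_vFun (r : ℕ) : below 0 (vFun r) = vFun (r / 2) := by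
  funext w
  rw [below, vFun, if_pos rfl, one_mul]

theorem below_one_vFun_even (s : ℕ) : below 1 (vFun (2 * s)) = 0 := by
  funext w
  rw [below, vFun, if_neg one_ne_zero, show 2 * s % 2 = 0 by omega, Nat.cast_zero, zero_mul,
    Pi.zero_apply]

theorem below_one_vFun_odd (s : ℕ) : below 1 (vFun (2 * s + 1)) = vFun s := by
  funext w
  rw [below, vFun, if_neg one_ne_zero, show (2 * s + 1) % 2 = 1 by omega, Nat.cast_one, one_mul,
    show (2 * s + 1) / 2 = s by omega]

theorem below_zero_vFun_odd (s : ℕ) : below 0 (vFun (2 * s + 1)) = vFun s := by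
  rw [below_zero_vFun, show (2 * s + 1) / 2 = s by omega]

theorem below_zero_vFun_even (s : ℕ) : below 0 (vFun (2 * s)) = vFun s := by
  rw [below_zero_vFun, show 2 * s / 2 = s by omega]

theorem inFil_vFun {n r : ℕ} (hr : r < 2 ^ n) : InFil n r (vFun r) := by
  induction n generalizing r with
  | zero => exact Or.inl (by simpa using hr)
  | succ n ih =>
    rw [pow_succ] at hr
    rcases Nat.even_or_odd' r with ⟨s, rfl | rfl⟩
    · rw [inFil_succ_even, below_zero_vFun_even, below_one_vFun_even]
      exact ⟨ih (by omega), inFil_zero _ _⟩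
    · rw [inFil_succ_odd, below_zero_vFun_odd, below_one_vFun_odd, add_self_fun]
      exact ⟨ih (by omega), ih (by omega), inFil_zero _ _⟩

/-- Below the degree `2 ^ n`, each layer of the filtration is one-dimensional, spanned by
`v_n^r`. -/
theorem exists_functional {n r : ℕ} (hr : r < 2 ^ n) : ∃ φ : (Word → ZMod 2) →+ ZMod 2,
    φ (vFun r) = 1 ∧ (∀ f, InFil n r f → (InFil n (r + 1) f ↔ φ f = 0)) ∧
      ∀ f g : Word → ZMod 2, (∀ w : Word, w.length = n → f w = g w) → φ f = φ g := by
  induction n generalizing r with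
  | zero =>
    have hr0 : r = 0 := by simpa using hr
    subst hr0
    exact ⟨Pi.evalAddMonoidHom _ [], rfl, fun f _ => ⟨fun h => h.resolve_left one_ne_zero, Or.inr⟩,
      fun f g h => h [] rfl⟩
  | succ n ih =>
    rw [pow_succ] at hr
    have hbelow : ∀ {f g : Word → ZMod 2}, (∀ w : Word, w.length = n + 1 → f w = g w) →
        ∀ (s : ZMod 2) (w : Word), w.length = n → below s f w = below s g w :=
      fun h s w hw => h (s :: w) (by rw [List.length_cons, hw])
    rcases Nat.even_or_odd' r with ⟨s, rfl | rfl⟩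
    · obtain ⟨φ, h1, h2, h3⟩ := ih (r := s) (by omega)
      let ψ : (Word → ZMod 2) →+ ZMod 2 := φ.comp
        { toFun := fun f => below 0 f + below 1 f
          map_zero' := add_zero 0
          map_add' := fun f g => add_add_add_comm (below 0 f) (below 0 g) (below 1 f) (below 1 g) }
      refine ⟨ψ, ?_, fun f hf => ?_, fun f g h => h3 _ _ fun w hw => ?_⟩
      · change φ (below 0 (vFun (2 * s)) + below 1 (vFun (2 * s))) = 1
        rw [below_zero_vFun_even, below_one_vFun_even, add_zero, h1]
      · rw [inFil_succ_even] at hf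
        rw [inFil_succ_odd]
        exact ⟨fun h => (h2 _ (hf.1.add hf.2)).1 h.2.2,
          fun h => ⟨hf.1, hf.2, (h2 _ (hf.1.add hf.2)).2 h⟩⟩
      · change below 0 f w + below 1 f w = below 0 g w + below 1 g w
        rw [hbelow h 0 w hw, hbelow h 1 w hw]
    · obtain ⟨φ, h1, h2, h3⟩ := ih (r := s) (by omega)
      let ψ : (Word → ZMod 2) →+ ZMod 2 := φ.comp
        { toFun := fun f => below 0 f
          map_zero' := rfl
          map_add' := fun f g => rfl }
      refine ⟨ψ, ?_, fun f hf => ?_, fun f g h => h3 _ _ (hbelow h 0)⟩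
      · change φ (below 0 (vFun (2 * s + 1))) = 1
        rw [below_zero_vFun_odd, h1]
      · rw [inFil_succ_odd] at hf
        rw [show 2 * s + 1 + 1 = 2 * (s + 1) by ring, inFil_succ_even]
        refine ⟨fun h => (h2 _ hf.1).1 h.1, fun h => ?_⟩
        have h0 := (h2 _ hf.1).2 h
        refine ⟨h0, ?_⟩
        have := h0.add hf.2.2
        rwa [← add_assoc, add_self_fun, zero_add] at this

theorem toV_mem_Vfil {n r : ℕ} {f : Word → ZMod 2} : toV n f ∈ Vfil n r ↔ InFil n r f := by
  constructor
  · have key : ∀ u ∈ Vfil n r, InFil n r (coeffFun u) := by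
      intro u hu
      induction hu using Submodule.span_induction with
      | mem u hu =>
        obtain ⟨s, hrs, hs, rfl⟩ := hu
        rw [v_eq_toV]
        exact ((inFil_vFun hs).mono hrs).congr fun w hw => (coeffFun_toV _ hw).symm
      | zero => exact inFil_zero _ _
      | add u u' _ _ h h' => exact h.add h'
      | smul t u _ h =>
        rcases zmod2_cases t with rfl | rfl
        · rw [zero_smul]; exact inFil_zero _ _
        · rwa [one_smul]
    exact fun h => (key _ h).congr fun w hw => coeffFun_toV f hw
  · intro hf
    induction hk : 2 ^ n - r generalizing r f with
    | zero =>
      rw [toV_eq_zero.2 fun w hw => hf.eq_zero (by omega) hw]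
      exact zero_mem _
    | succ k ih =>
      have hr : r < 2 ^ n := by omega
      have hmono : Vfil n (r + 1) ≤ Vfil n r :=
        Submodule.span_mono fun u ⟨s, hrs, hs, hu⟩ => ⟨s, by omega, hs, hu⟩
      obtain ⟨φ, h1, h2, -⟩ := exists_functional hr
      rcases zmod2_cases (φ f) with h | h
      · exact hmono (ih ((h2 f hf).2 h) (by omega))
      · have hv := inFil_vFun hr
        have h3 : InFil n (r + 1) (f + vFun r) :=
          (h2 _ (hf.add hv)).2 (by rw [map_add, h, h1]; rfl)
        have h4 := add_mem (hmono (ih h3 (by omega)))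
          (Submodule.subset_span ⟨r, le_rfl, hr, (v_eq_toV n r).symm⟩ : toV n (vFun r) ∈ Vfil n r)
        rwa [← toV_add, add_add_self_fun] at h4

/-! ### The isomorphism `α ⊕ β` -/

/-- The homomorphism `α` on `N_{m+1}`. -/
noncomputable def alphaHom (m : ℕ) : N (m + 1) →* Multiplicative (V (m + 1)) where
  toFun g := Multiplicative.ofAdd (toV (m + 1) (alphaFun g))
  map_one' := congrArg Multiplicative.ofAdd (toV_eq_zero.2 fun w _ => alphaFun_one w)
  map_mul' g h := by
    rw [← ofAdd_add, ← toV_add]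
    exact congrArg Multiplicative.ofAdd (toV_congr fun w hw =>
      alphaFun_mul (N_succ_le_coordGroup m g.2) (N_succ_le_coordGroup m h.2) hw)

/-- The homomorphism `β` on `N_{m+1}`. -/
noncomputable def betaHom (m : ℕ) : N (m + 1) →* Multiplicative (V m) where
  toFun g := Multiplicative.ofAdd (toV m (betaFun g))
  map_one' := congrArg Multiplicative.ofAdd (toV_eq_zero.2 fun w _ => betaFun_one w)
  map_mul' g h := by
    rw [← ofAdd_add, ← toV_add]
    exact congrArg Multiplicative.ofAdd (toV_congr fun w hw =>
      betaFun_mul (N_succ_le_coordGroup m g.2) (N_succ_le_coordGroup m h.2) hw)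

theorem alphaHom_apply {m : ℕ} (g : N (m + 1)) :
    alphaHom m g = Multiplicative.ofAdd (toV (m + 1) (alphaFun g)) := rfl

theorem betaHom_apply {m : ℕ} (g : N (m + 1)) :
    betaHom m g = Multiplicative.ofAdd (toV m (betaFun g)) := rfl

theorem alphaHom_eq_one {m : ℕ} {g : N (m + 1)} :
    alphaHom m g = 1 ↔ ∀ w : Word, w.length = m + 1 → alphaFun g w = 0 := by
  rw [alphaHom_apply, ofAdd_eq_one, toV_eq_zero]

theorem betaHom_eq_one {m : ℕ} {g : N (m + 1)} :
    betaHom m g = 1 ↔ ∀ w : Word, w.length = m → betaFun g w = 0 := by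
  rw [betaHom_apply, ofAdd_eq_one, toV_eq_zero]

theorem alphaFun_place_x {σ w : Word} (h : w.length = σ.length) :
    alphaFun (place σ x) w = if w = σ then 1 else 0 := by
  induction σ generalizing w with
  | nil => rw [List.length_eq_zero_iff.1 h, if_pos rfl]; exact alphaFun_x
  | cons s σ ih =>
    rcases w with _ | ⟨t, w⟩
    · simp at h
    · rw [List.length_cons, List.length_cons, Nat.add_right_cancel_iff] at h
      rcases zmod2_cases s with rfl | rfl <;> rcases zmod2_cases t with rfl | rfl
      · rw [place_zero_cons, alphaFun_pair_zero, ih h]; simp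
      · rw [place_zero_cons, alphaFun_pair_one, alphaFun_one]; simp
      · rw [place_one_cons, alphaFun_pair_zero, alphaFun_one]; simp
      · rw [place_one_cons, alphaFun_pair_one, ih h]; simp

theorem betaFun_place_x_sq {σ w : Word} (h : w.length = σ.length) :
    betaFun (place σ (x ^ 2)) w = if w = σ then 1 else 0 := by
  induction σ generalizing w with
  | nil => rw [List.length_eq_zero_iff.1 h, if_pos rfl]; exact betaFun_x_sq
  | cons s σ ih =>
    rcases w with _ | ⟨t, w⟩
    · simp at h
    · rw [List.length_cons, List.length_cons, Nat.add_right_cancel_iff] at h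
      rcases zmod2_cases s with rfl | rfl <;> rcases zmod2_cases t with rfl | rfl
      · rw [place_zero_cons, betaFun_pair_zero, ih h]; simp
      · rw [place_zero_cons, betaFun_pair_one, betaFun_one]; simp
      · rw [place_one_cons, betaFun_pair_zero, betaFun_one]; simp
      · rw [place_one_cons, betaFun_pair_one, ih h]; simp

theorem alphaFun_place_x_sq {σ w : Word} (h : w.length = σ.length + 1) :
    alphaFun (place σ (x ^ 2)) w = 0 := by
  induction σ generalizing w with
  | nil =>
    obtain ⟨s, rfl⟩ := List.length_eq_one_iff.1 h
    exact alphaFun_x_sq s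
  | cons s σ ih =>
    rcases w with _ | ⟨t, w⟩
    · simp at h
    · rw [List.length_cons, List.length_cons, Nat.add_right_cancel_iff] at h
      rcases zmod2_cases s with rfl | rfl <;> rcases zmod2_cases t with rfl | rfl
      · rw [place_zero_cons, alphaFun_pair_zero, ih h]
      · rw [place_zero_cons, alphaFun_pair_one, alphaFun_one]
      · rw [place_one_cons, alphaFun_pair_zero, alphaFun_one]
      · rw [place_one_cons, alphaFun_pair_one, ih h]

/-- Elements of `N_{m+1}` with prescribed coordinates. -/
theorem exists_coord_eq (m : ℕ) (f f' : Word → ZMod 2) : ∃ k ∈ N (m + 1), ∃ t ∈ N (m + 1),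
    ((∀ w : Word, w.length = m + 1 → alphaFun k w = f w) ∧
      ∀ w : Word, w.length = m → betaFun k w = 0) ∧
    (∀ w : Word, w.length = m + 1 → alphaFun t w = 0) ∧
      ∀ w : Word, w.length = m → betaFun t w = f' w := by
  obtain ⟨k, hk, hkf⟩ := exists_mem_level_K_alphaFun_eq (m + 1) f
  obtain ⟨t, ht, ht0, htf⟩ := exists_mem_level_T_betaFun_eq m f'
  exact ⟨k, (le_sup_left : level K (m + 1) ≤ N (m + 1)) hk, t,
    (le_sup_right : level T m ≤ N (m + 1)) ht,
    ⟨hkf, fun w hw => betaFun_of_mem_level_K hk hw⟩, ht0, htf⟩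

theorem isAlphaBeta (m : ℕ) : IsAlphaBeta (m + 1) (alphaHom m) (betaHom m) where
  surjective := by
    rintro ⟨u, u'⟩
    obtain ⟨k, hk, t, ht, ⟨h1, h2⟩, h3, h4⟩ :=
      exists_coord_eq m (coeffFun u.toAdd) (coeffFun u'.toAdd)
    refine ⟨⟨k, hk⟩ * ⟨t, ht⟩, ?_⟩
    have ht1 : alphaHom m ⟨t, ht⟩ = 1 := alphaHom_eq_one.2 h3
    have hk1 : betaHom m ⟨k, hk⟩ = 1 := betaHom_eq_one.2 h2
    rw [map_mul, MonoidHom.prod_apply, MonoidHom.prod_apply, ht1, hk1, Prod.mk_mul_mk, mul_one,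
      one_mul]
    refine Prod.ext ?_ ?_
    · exact congrArg Multiplicative.ofAdd ((toV_congr h1).trans (toV_coeffFun _))
    · exact congrArg Multiplicative.ofAdd ((toV_congr h4).trans (toV_coeffFun _))
  ker_eq := by
    ext g
    rw [MonoidHom.mem_ker, MonoidHom.prod_apply, Prod.mk_eq_one, alphaHom_eq_one,
      betaHom_eq_one, Subgroup.mem_subgroupOf]
    refine ⟨fun h => mem_N_succ_of_coord_eq_zero g.2 h.1 h.2, fun h => ?_⟩
    have hg := N_succ_le_coordGroup (m + 1) h
    exact ⟨fun w hw => alphaFun_eq_zero hg hw, fun w hw => betaFun_eq_zero hg hw⟩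
  alpha_x σ := by
    rw [monomial_eq_toV]
    exact congrArg Multiplicative.ofAdd (toV_congr fun w hw =>
      alphaFun_place_x (by rw [hw, List.length_ofFn]))
  beta_x σ := betaHom_eq_one.2 fun w hw =>
    betaFun_of_mem_level_K (place_mem_level' x_mem_K List.length_ofFn) hw
  alpha_xsq τ := alphaHom_eq_one.2 fun w hw => alphaFun_place_x_sq (by
    rw [hw, List.length_ofFn]; rfl)
  beta_xsq τ := by
    rw [monomial_eq_toV]
    exact congrArg Multiplicative.ofAdd (toV_congr fun w hw =>
      betaFun_place_x_sq (by rw [hw, List.length_ofFn]; rfl))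

theorem layer_eq_mul (m r : ℕ) : (layer m r : Set (Equiv.Perm Word)) =
    (N (m + 2) : Set (Equiv.Perm Word)) * alphaInv (alphaHom m) (betaHom m) (Vfil (m + 1) r) *
      betaInv (alphaHom m) (betaHom m) (Vfil m r) := by
  ext g
  rw [Set.mem_mul]
  constructor
  · intro hg
    obtain ⟨k, hk, t, ht, ⟨h1, h2⟩, h3, h4⟩ := exists_coord_eq m (alphaFun g) (betaFun g)
    have hg' := N_succ_le_coordGroup m hg.1
    have hk' := N_succ_le_coordGroup m hk
    have ht' := N_succ_le_coordGroup m ht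
    refine ⟨g * (k * t)⁻¹ * k, Set.mul_mem_mul ?_ ⟨hk, ?_, ?_⟩, t, ⟨ht, ?_, ?_⟩, by group⟩
    · refine mem_N_succ_of_coord_eq_zero (mul_mem hg.1 (inv_mem (mul_mem hk ht)))
        (fun w hw => ?_) fun w hw => ?_
      · rw [alphaFun_mul hg' (inv_mem (mul_mem hk' ht')) hw, alphaFun_inv (mul_mem hk' ht') hw,
          alphaFun_mul hk' ht' hw, h1 w hw, h3 w hw, add_zero, CharTwo.add_self_eq_zero]
      · rw [betaFun_mul hg' (inv_mem (mul_mem hk' ht')) hw, betaFun_inv (mul_mem hk' ht') hw,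
          betaFun_mul hk' ht' hw, h2 w hw, h4 w hw, zero_add, CharTwo.add_self_eq_zero]
    · exact toV_mem_Vfil.2 (hg.2.1.congr fun w hw => (h1 w hw).symm)
    · exact betaHom_eq_one.2 h2
    · exact alphaHom_eq_one.2 h3
    · exact toV_mem_Vfil.2 (hg.2.2.congr fun w hw => (h4 w hw).symm)
  · rintro ⟨_, ⟨n, hn, k, ⟨hk, hk1, hk2⟩, rfl⟩, t, ⟨ht, ht1, ht2⟩, rfl⟩
    refine mul_mem (mul_mem (N_le_layer m r hn) ?_) ?_
    · exact ⟨hk, toV_mem_Vfil.1 hk1, inFil_of_eq_zero (betaHom_eq_one.1 hk2)⟩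
    · exact ⟨ht, inFil_of_eq_zero (alphaHom_eq_one.1 ht1), toV_mem_Vfil.1 ht2⟩

/-! ### Ranks of the lower central factors -/

/-- The elementary abelian `2`-group `(ℤ/2)^k` has rank `k`: its generating sets are its spanning
sets over `𝔽_2`. -/
theorem rank_elementary (k : ℕ) : Group.rank (Multiplicative (Fin k → ZMod 2)) = k := by
  classical
  apply le_antisymm
  · let S : Finset (Multiplicative (Fin k → ZMod 2)) :=
      Finset.univ.image fun i : Fin k => Multiplicative.ofAdd (Pi.single i 1)
    have hS : Subgroup.closure (S : Set (Multiplicative (Fin k → ZMod 2))) = ⊤ := by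
      rw [eq_top_iff]
      intro y _
      have hy : y = ∏ i, Multiplicative.ofAdd (Pi.single i (y.toAdd i)) := by
        rw [← ofAdd_sum, Finset.univ_sum_single, ofAdd_toAdd]
      rw [hy]
      refine Subgroup.prod_mem _ fun i _ => ?_
      rcases zmod2_cases (y.toAdd i) with h | h <;> rw [h]
      · rw [Pi.single_zero, ofAdd_zero]
        exact one_mem _
      · exact Subgroup.subset_closure
          (Finset.mem_coe.2 (Finset.mem_image_of_mem _ (Finset.mem_univ i)))
    calc Group.rank (Multiplicative (Fin k → ZMod 2)) ≤ S.card := Group.rank_le hS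
      _ ≤ (Finset.univ : Finset (Fin k)).card := Finset.card_image_le
      _ = k := Finset.card_fin k
  · obtain ⟨S, hcard, hS⟩ := Group.rank_spec (Multiplicative (Fin k → ZMod 2))
    let S' : Finset (Fin k → ZMod 2) := S.image Multiplicative.toAdd
    let M : Subgroup (Multiplicative (Fin k → ZMod 2)) := AddSubgroup.toSubgroup
      (Submodule.span (ZMod 2) (S' : Set (Fin k → ZMod 2))).toAddSubgroup
    have hM : M = ⊤ := by
      rw [eq_top_iff, ← hS, Subgroup.closure_le]
      intro y hy
      change y.toAdd ∈ Submodule.span (ZMod 2) (S' : Set (Fin k → ZMod 2))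
      exact Submodule.subset_span (Finset.mem_coe.2 (Finset.mem_image_of_mem _ hy))
    have hspan : Submodule.span (ZMod 2) (S' : Set (Fin k → ZMod 2)) = ⊤ := by
      rw [eq_top_iff]
      intro y _
      have : Multiplicative.ofAdd y ∈ M := hM ▸ Subgroup.mem_top _
      exact this
    have h := finrank_span_finset_le_card (R := ZMod 2) S'
    rw [Set.finrank, hspan, finrank_top, Module.finrank_fin_fun] at h
    exact hcard ▸ h.trans Finset.card_image_le

theorem mem_gammaG {n : ℕ} (g : G) : (g : Equiv.Perm Word) ∈ gammaG n ↔ g ∈ gamma G n :=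
  Subgroup.mem_map_iff_mem G.subtype_injective

/-- Coordinates on `γ_n / γ_{n+1}` with values in `(ℤ/2)^k` determine its rank and its order. -/
theorem hasRank_lcFactor {n k : ℕ} (F : Equiv.Perm Word → Fin k → ZMod 2)
    (hmul : ∀ g ∈ gammaG n, ∀ h ∈ gammaG n, F (g * h) = F g + F h)
    (hker : ∀ g ∈ gammaG n, F g = 0 ↔ g ∈ gammaG (n + 1))
    (hsurj : ∀ i, ∃ g ∈ gammaG n, F g = Pi.single i 1) :
    HasRank (lcFactor G n) k ∧ (gamma G (n + 1)).relIndex (gamma G n) = 2 ^ k := by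
  let φ : gamma G n →* Multiplicative (Fin k → ZMod 2) := MonoidHom.mk'
    (fun g => Multiplicative.ofAdd (F (g : G)))
    fun g h => congrArg Multiplicative.ofAdd
      (hmul _ ((mem_gammaG _).2 g.2) _ ((mem_gammaG _).2 h.2))
  have hφ : Function.Surjective φ := by
    rw [← MonoidHom.range_eq_top, eq_top_iff]
    intro y _
    have hy : y = ∏ i, Multiplicative.ofAdd (Pi.single i (y.toAdd i)) := by
      rw [← ofAdd_sum, Finset.univ_sum_single, ofAdd_toAdd]
    rw [hy]
    refine Subgroup.prod_mem _ fun i _ => ?_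
    rcases zmod2_cases (y.toAdd i) with h | h <;> rw [h]
    · rw [Pi.single_zero, ofAdd_zero]
      exact one_mem _
    · obtain ⟨g, hg, hgF⟩ := hsurj i
      obtain ⟨g, hg, rfl⟩ := hg
      exact ⟨⟨g, hg⟩, congrArg Multiplicative.ofAdd hgF⟩
  have hkerφ : φ.ker = (gamma G (n + 1)).subgroupOf (gamma G n) := by
    ext g
    rw [MonoidHom.mem_ker, Subgroup.mem_subgroupOf, ← mem_gammaG,
      ← hker _ ((mem_gammaG _).2 g.2)]
    exact ofAdd_eq_one
  let e : lcFactor G n ≃* Multiplicative (Fin k → ZMod 2) :=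
    (QuotientGroup.quotientMulEquivOfEq hkerφ.symm).trans
      (QuotientGroup.quotientKerEquivOfSurjective φ hφ)
  have hfg : Group.FG (lcFactor G n) :=
    Group.fg_of_surjective (f := e.symm.toMonoidHom) e.symm.surjective
  refine ⟨⟨hfg, (Group.rank_congr e).trans (rank_elementary k)⟩, ?_⟩
  calc (gamma G (n + 1)).relIndex (gamma G n) = Nat.card (lcFactor G n) := rfl
    _ = Nat.card (Multiplicative (Fin k → ZMod 2)) := Nat.card_congr e.toEquiv
    _ = Nat.card (Fin k → ZMod 2) := Nat.card_congr Multiplicative.toAdd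
    _ = 2 ^ k := by simp

theorem gStable_of_commutator_le {H M : Subgroup (Equiv.Perm Word)} (hM : ⁅M, G⁆ ≤ H)
    (hH : H ≤ M) : GStable H := by
  intro g hg y hy
  rw [show g * y * g⁻¹ = ⁅y, g⁆⁻¹ * y by rw [commutatorElement_def]; group]
  exact mul_mem (inv_mem (hM (Subgroup.commutator_mem_commutator (hH hy) hg))) hy

theorem le_twoCosets {H : Subgroup (Equiv.Perm Word)} (hH : GStable H) {y : Equiv.Perm Word}
    (hyG : y ∈ G) (hy : y * y ∈ H) : H ≤ twoCosets hH hyG hy := fun _ hg => Or.inl hg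

theorem self_mem_twoCosets {H : Subgroup (Equiv.Perm Word)} (hH : GStable H) {y : Equiv.Perm Word}
    (hyG : y ∈ G) (hy : y * y ∈ H) : y ∈ twoCosets hH hyG hy :=
  Or.inr (by rw [inv_mul_cancel]; exact one_mem _)

theorem twoCosets_le {H M : Subgroup (Equiv.Perm Word)} (hH : GStable H) {y : Equiv.Perm Word}
    (hyG : y ∈ G) (hy : y * y ∈ H) (hHM : H ≤ M) (hyM : y ∈ M) : twoCosets hH hyG hy ≤ M := by
  rintro g (hg | hg)
  · exact hHM hg
  · rw [← mul_inv_cancel_left y g]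
    exact mul_mem hyM (hHM hg)

theorem gammaG_two : gammaG 2 = ⁅G, G⁆ := by rw [gammaG_succ le_rfl, gammaG_one]

theorem parity_nil_commutator {g : Equiv.Perm Word} (hg : g ∈ ⁅G, G⁆) (n : ℕ) :
    parity n [] g = 0 := by
  let M : Subgroup (Equiv.Perm Word) :=
    { carrier := {g | g ∈ treeAut ∧ parity n [] g = 0}
      one_mem' := ⟨one_mem _, parity_one _ _⟩
      mul_mem' := by
        rintro g h ⟨hg, g0⟩ ⟨hh, h0⟩
        exact ⟨mul_mem hg hh, by rw [parity_nil_mul hg hh, g0, h0, add_zero]⟩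
      inv_mem' := by
        rintro g ⟨hg, g0⟩
        refine ⟨inv_mem hg, ?_⟩
        rw [parity_inv_of_fix hg _ (List.length_eq_zero_iff.1 (length_apply hg [])), g0] }
  have hM : ⁅G, G⁆ ≤ M := by
    rw [Subgroup.commutator_le]
    intro p hp q hq
    have hp' := G_le_treeAut hp
    have hq' := G_le_treeAut hq
    have hi : ∀ {y : Equiv.Perm Word}, y ∈ treeAut → parity n [] y⁻¹ = parity n [] y := fun hy =>
      parity_inv_of_fix hy _ (List.length_eq_zero_iff.1 (length_apply hy []))
    refine ⟨mul_mem (mul_mem (mul_mem hp' hq') (inv_mem hp')) (inv_mem hq'), ?_⟩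
    rw [commutatorElement_def, parity_nil_mul (mul_mem (mul_mem hp' hq') (inv_mem hp'))
      (inv_mem hq'), parity_nil_mul (mul_mem hp' hq') (inv_mem hp'), parity_nil_mul hp' hq',
      hi hp', hi hq', add_right_comm (parity n [] p), CharTwo.add_self_eq_zero, zero_add,
      CharTwo.add_self_eq_zero]
  exact (hM hg).2

/-- The label parities of the first three levels are faithful on the abelianisation of `G`. -/
theorem mem_commutator_of_parity_eq_zero {g : Equiv.Perm Word} (hg : g ∈ G)
    (h0 : parity 0 [] g = 0) (h1 : parity 1 [] g = 0) (h2 : parity 2 [] g = 0) : g ∈ ⁅G, G⁆ := by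
  have hG : ⁅G, G⁆ ≤ G := Subgroup.commutator_le.2 fun p hp q hq =>
    mul_mem (mul_mem (mul_mem hp hq) (inv_mem hp)) (inv_mem hq)
  have s0 : GStable ⁅G, G⁆ := G_gStable.commutator
  have d0 : d * d ∈ ⁅G, G⁆ := d_mul_d ▸ one_mem _
  have s1 : GStable (twoCosets s0 d_mem d0) :=
    gStable_of_commutator_le (le_twoCosets s0 d_mem d0) (twoCosets_le _ _ _ hG d_mem)
  have b1 : b * b ∈ twoCosets s0 d_mem d0 := b_mul_b ▸ one_mem _
  have s2 : GStable (twoCosets s1 b_mem b1) :=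
    gStable_of_commutator_le ((le_twoCosets s0 d_mem d0).trans (le_twoCosets s1 b_mem b1))
      (twoCosets_le _ _ _ (twoCosets_le _ _ _ hG d_mem) b_mem)
  have a2 : a * a ∈ twoCosets s1 b_mem b1 := a_mul_a ▸ one_mem _
  have hle : G ≤ twoCosets s2 a_mem a2 :=
    G_le_of_mem (self_mem_twoCosets _ _ _) (le_twoCosets _ _ _ (self_mem_twoCosets _ _ _))
      (le_twoCosets _ _ _ (le_twoCosets _ _ _ (self_mem_twoCosets _ _ _)))
  have hp : ∀ {y z : Equiv.Perm Word} (n : ℕ), y ∈ G → z ∈ G →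
      parity n [] (y⁻¹ * z) = parity n [] y + parity n [] z := by
    intro y z n hy hz
    have hy' := G_le_treeAut hy
    rw [parity_nil_mul (inv_mem hy') (G_le_treeAut hz),
      parity_inv_of_fix hy' _ (List.length_eq_zero_iff.1 (length_apply hy' []))]
  have ga := mul_mem (inv_mem a_mem) hg
  have gb := mul_mem (inv_mem b_mem) hg
  have gba := mul_mem (inv_mem b_mem) ga
  rcases hle hg with (h | h) | (h | h)
  · rcases h with h | h
    · exact h
    · have := parity_nil_commutator h 2
      rw [hp 2 d_mem hg, h2, parity_two_d] at this
      exact absurd this one_ne_zero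
  · rcases h with h | h
    · have := parity_nil_commutator h 1
      rw [hp 1 b_mem hg, h1, parity_one_b] at this
      exact absurd this one_ne_zero
    · have := parity_nil_commutator h 1
      rw [hp 1 d_mem gb, hp 1 b_mem hg, h1, parity_one_b, parity_one_d] at this
      exact absurd this one_ne_zero
  · rcases h with h | h
    · have := parity_nil_commutator h 0
      rw [hp 0 a_mem hg, h0, parity_zero_a] at this
      exact absurd this one_ne_zero
    · have := parity_nil_commutator h 0
      rw [hp 0 d_mem ga, hp 0 a_mem hg, h0, parity_zero_a, parity_zero_d] at this
      exact absurd this one_ne_zero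
  · rcases h with h | h
    · have := parity_nil_commutator h 0
      rw [hp 0 b_mem ga, hp 0 a_mem hg, h0, parity_zero_a, parity_zero_b] at this
      exact absurd this one_ne_zero
    · have := parity_nil_commutator h 0
      rw [hp 0 d_mem gba, hp 0 b_mem ga, hp 0 a_mem hg, h0, parity_zero_a, parity_zero_b,
        parity_zero_d] at this
      exact absurd this one_ne_zero

theorem lcFactor_one :
    HasRank (lcFactor G 1) 3 ∧ (gamma G (1 + 1)).relIndex (gamma G 1) = 2 ^ 3 := by
  refine hasRank_lcFactor (fun g i => parity i [] g) ?_ ?_ ?_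
  · intro g hg h hh
    rw [gammaG_one] at hg hh
    funext i
    exact parity_nil_mul (G_le_treeAut hg) (G_le_treeAut hh) _
  · intro g hg
    rw [gammaG_one] at hg
    rw [gammaG_two]
    refine ⟨fun h => mem_commutator_of_parity_eq_zero hg (congrFun h 0) (congrFun h 1)
      (congrFun h 2), fun h => ?_⟩
    funext i
    exact parity_nil_commutator h _
  · intro i
    rw [gammaG_one]
    fin_cases i
    · refine ⟨a, a_mem, funext fun j => ?_⟩
      fin_cases j
      · exact parity_zero_a
      · exact parity_succ_a 0
      · exact parity_succ_a 1
    · refine ⟨c, c_mem, funext fun j => ?_⟩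
      fin_cases j
      · exact parity_zero_c
      · exact parity_one_c
      · exact parity_two_c
    · refine ⟨d, d_mem, funext fun j => ?_⟩
      fin_cases j
      · exact parity_zero_d
      · exact parity_one_d
      · exact parity_two_d

/-- The tree automorphisms that fix the first level. -/
def levelOneStabilizer : Subgroup (Equiv.Perm Word) where
  carrier := {g | g ∈ treeAut ∧ ∀ u : Word, u.length = 1 → g u = u}
  one_mem' := ⟨one_mem _, fun _ _ => rfl⟩
  mul_mem' := by
    rintro g h ⟨hg, g1⟩ ⟨hh, h1⟩
    exact ⟨mul_mem hg hh, fun u hu => by rw [Equiv.Perm.mul_apply, h1 u hu, g1 u hu]⟩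
  inv_mem' := by
    rintro g ⟨hg, g1⟩
    exact ⟨inv_mem hg, fun u hu => by rw [Equiv.Perm.inv_eq_iff_eq, g1 u hu]⟩

theorem commutator_le_levelOneStabilizer : ⁅G, G⁆ ≤ levelOneStabilizer := by
  have hst : GStable levelOneStabilizer := by
    rintro g hg y ⟨hy, hy1⟩
    have hg' := G_le_treeAut hg
    refine ⟨mul_mem (mul_mem hg' hy) (inv_mem hg'), fun u hu => ?_⟩
    rw [Equiv.Perm.mul_apply, Equiv.Perm.mul_apply,
      hy1 _ (by rw [length_apply (inv_mem hg'), hu]), ← Equiv.Perm.mul_apply, mul_inv_cancel,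
      Equiv.Perm.one_apply]
  refine commutator_G_le hst ⟨x_mem_treeAut, fun u hu => x_apply_singleton hu⟩ ?_
  have hb := bcd_mem_treeAut.1
  rw [commutator_a_d]
  exact ⟨pair_mem_treeAut hb hb, fun u hu => pair_apply_singleton hb hb hu⟩

theorem lcFactor_two :
    HasRank (lcFactor G 2) 2 ∧ (gamma G (2 + 1)).relIndex (gamma G 2) = 2 ^ 2 := by
  have hx : x ∈ ⁅G, G⁆ := Subgroup.commutator_mem_commutator a_mem b_mem
  have hbb : pair b b ∈ ⁅G, G⁆ :=
    commutator_a_d ▸ Subgroup.commutator_mem_commutator a_mem d_mem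
  have hG : ⁅G, G⁆ ≤ G := Subgroup.commutator_le.2 fun p hp q hq =>
    mul_mem (mul_mem (mul_mem hp hq) (inv_mem hp)) (inv_mem hq)
  have h3 : ⁅⁅G, G⁆, G⁆ = N 1 := by rw [← gammaG_two, ← gammaG_succ one_le_two, gammaG_three]
  have hN : N 1 ≤ ⁅G, G⁆ := by
    rw [← h3]
    exact Subgroup.commutator_mono hG le_rfl
  have hmul : ∀ (n : ℕ), ∀ g ∈ ⁅G, G⁆, ∀ h ∈ ⁅G, G⁆,
      parity n [0] (g * h) = parity n [0] g + parity n [0] h := by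
    intro n g hg h hh
    have hg' := commutator_le_levelOneStabilizer hg
    have hh' := commutator_le_levelOneStabilizer hh
    exact parity_mul_of_fix hg'.1 hh'.1 n (hh'.2 _ rfl)
  have hinv : ∀ (n : ℕ), ∀ g ∈ ⁅G, G⁆, parity n [0] g⁻¹ = parity n [0] g := by
    intro n g hg
    have hg' := commutator_le_levelOneStabilizer hg
    exact parity_inv_of_fix hg'.1 n (hg'.2 _ rfl)
  have hN0 : ∀ (n : ℕ), ∀ g ∈ N 1, parity n [0] g = 0 := fun n g hg =>
    (N_succ_le_coordGroup 0 hg).2.2.1 n [0] rfl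
  have x0 : parity 0 [0] x = 1 := by rw [parity_x, parity_zero_c, parity_zero_a, zero_add]
  have x2 : parity 2 [0] x = 0 := parity_two_x 0
  have b0 : parity 0 [0] (pair b b) = 0 := by rw [parity_pair_zero, parity_zero_b]
  have b2 : parity 2 [0] (pair b b) = 1 := by rw [parity_pair_zero, parity_two_b]
  have s0 := N_gStable 1
  have q0 : pair b b * pair b b ∈ N 1 := by
    rw [pair_mul, b_mul_b, pair_one]
    exact one_mem _
  have s1 : GStable (twoCosets s0 (hG hbb) q0) :=
    gStable_of_commutator_le (h3.le.trans (le_twoCosets _ _ _)) (twoCosets_le _ _ _ hN hbb)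
  have q1 : x * x ∈ twoCosets s0 (hG hbb) q0 := le_twoCosets _ _ _ (sq x ▸ x_sq_mem_N_one)
  have s2 : GStable (twoCosets s1 x_mem q1) :=
    gStable_of_commutator_le (h3.le.trans ((le_twoCosets _ _ _).trans (le_twoCosets _ _ _)))
      (twoCosets_le _ _ _ (twoCosets_le _ _ _ hN hbb) hx)
  have hle : ⁅G, G⁆ ≤ twoCosets s1 x_mem q1 := by
    refine commutator_G_le s2 (self_mem_twoCosets _ _ _) ?_
    rw [commutator_a_d]
    exact le_twoCosets _ _ _ (self_mem_twoCosets _ _ _)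
  refine hasRank_lcFactor (fun g => ![parity 0 [0] g, parity 2 [0] g]) ?_ ?_ ?_
  · intro g hg h hh
    rw [gammaG_two] at hg hh
    rw [hmul 0 g hg h hh, hmul 2 g hg h hh, Matrix.cons_add_cons, Matrix.cons_add_cons,
      Matrix.empty_add_empty]
  · intro g hg
    rw [gammaG_two] at hg
    rw [gammaG_three]
    constructor
    · intro hF
      have g0 : parity 0 [0] g = 0 := congrFun hF 0
      have g2 : parity 2 [0] g = 0 := congrFun hF 1
      have hxg := mul_mem (inv_mem hx) hg
      rcases hle hg with (h | h) | (h | h)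
      · exact h
      · have := hN0 2 _ h
        rw [hmul 2 _ (inv_mem hbb) _ hg, hinv 2 _ hbb, b2, g2] at this
        exact absurd this one_ne_zero
      · have := hN0 0 _ h
        rw [hmul 0 _ (inv_mem hx) _ hg, hinv 0 _ hx, x0, g0] at this
        exact absurd this one_ne_zero
      · have := hN0 0 _ h
        rw [hmul 0 _ (inv_mem hbb) _ hxg, hinv 0 _ hbb, hmul 0 _ (inv_mem hx) _ hg, hinv 0 _ hx, x0,
          g0, b0] at this
        exact absurd this one_ne_zero
    · intro h
      rw [hN0 0 g h, hN0 2 g h]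
      exact funext fun i => by fin_cases i <;> rfl
  · intro i
    rw [gammaG_two]
    fin_cases i
    · refine ⟨x, hx, funext fun j => ?_⟩
      fin_cases j
      · exact x0
      · exact x2
    · refine ⟨pair b b, hbb, funext fun j => ?_⟩
      fin_cases j
      · exact b0
      · exact b2

theorem lcFactor_of_lt {m r : ℕ} (hr : r < 2 ^ m) :
    HasRank (lcFactor G (2 ^ (m + 1) + 1 + r)) 2 ∧
      (gamma G (2 ^ (m + 1) + 1 + r + 1)).relIndex (gamma G (2 ^ (m + 1) + 1 + r)) = 2 ^ 2 := by
  have hr' : r < 2 ^ (m + 1) := by rw [pow_succ]; omega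
  obtain ⟨φ, h1, h2, h3⟩ := exists_functional hr'
  obtain ⟨ψ, k1, k2, k3⟩ := exists_functional hr
  have e1 := gammaG_eq_layer m hr'.le
  have e2 : gammaG (2 ^ (m + 1) + 1 + r + 1) = layer m (r + 1) := gammaG_eq_layer m hr'
  refine hasRank_lcFactor (fun g => ![φ (alphaFun g), ψ (betaFun g)]) ?_ ?_ ?_ <;> rw [e1]
  · intro g hg h hh
    have hg' := N_succ_le_coordGroup m hg.1
    have hh' := N_succ_le_coordGroup m hh.1
    rw [h3 _ (alphaFun g + alphaFun h) fun w hw => alphaFun_mul hg' hh' hw,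
      k3 _ (betaFun g + betaFun h) fun w hw => betaFun_mul hg' hh' hw, map_add, map_add,
      Matrix.cons_add_cons, Matrix.cons_add_cons, Matrix.empty_add_empty]
  · intro g hg
    rw [e2]
    constructor
    · intro h
      exact ⟨hg.1, (h2 _ hg.2.1).2 (congrFun h 0), (k2 _ hg.2.2).2 (congrFun h 1)⟩
    · intro h
      rw [(h2 _ hg.2.1).1 h.2.1, (k2 _ hg.2.2).1 h.2.2]
      exact funext fun i => by fin_cases i <;> rfl
  · obtain ⟨k, hk, t, ht, ⟨c1, c2⟩, c3, c4⟩ := exists_coord_eq m (vFun r) (vFun r)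
    intro i
    fin_cases i
    · refine ⟨k, ⟨hk, (inFil_vFun hr').congr fun w hw => (c1 w hw).symm, inFil_of_eq_zero c2⟩,
        funext fun j => ?_⟩
      fin_cases j
      · exact (h3 _ _ c1).trans h1
      · exact (k3 _ 0 c2).trans (map_zero ψ)
    · refine ⟨t, ⟨ht, inFil_of_eq_zero c3, (inFil_vFun hr).congr fun w hw => (c4 w hw).symm⟩,
        funext fun j => ?_⟩
      fin_cases j
      · exact (h3 _ 0 c3).trans (map_zero φ)
      · exact (k3 _ _ c4).trans k1

theorem lcFactor_of_ge {m r : ℕ} (hr : 2 ^ m ≤ r) (hr' : r < 2 ^ (m + 1)) :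
    HasRank (lcFactor G (2 ^ (m + 1) + 1 + r)) 1 ∧
      (gamma G (2 ^ (m + 1) + 1 + r + 1)).relIndex (gamma G (2 ^ (m + 1) + 1 + r)) = 2 ^ 1 := by
  obtain ⟨φ, h1, h2, h3⟩ := exists_functional hr'
  have e1 := gammaG_eq_layer m hr'.le
  have e2 : gammaG (2 ^ (m + 1) + 1 + r + 1) = layer m (r + 1) := gammaG_eq_layer m hr'
  refine hasRank_lcFactor (fun g _ => φ (alphaFun g)) ?_ ?_ ?_ <;> rw [e1]
  · intro g hg h hh
    have hg' := N_succ_le_coordGroup m hg.1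
    have hh' := N_succ_le_coordGroup m hh.1
    rw [h3 _ (alphaFun g + alphaFun h) fun w hw => alphaFun_mul hg' hh' hw, map_add]
    rfl
  · intro g hg
    rw [e2]
    constructor
    · intro h
      -- The `β`-coordinate vanishes, since its degree `r` is at least `2 ^ m`.
      exact ⟨hg.1, (h2 _ hg.2.1).2 (congrFun h 0),
        inFil_of_eq_zero fun w hw => hg.2.2.eq_zero hr hw⟩
    · intro h
      rw [(h2 _ hg.2.1).1 h.2.1]
      rfl
  · obtain ⟨k, hk, -, -, ⟨c1, c2⟩, -⟩ := exists_coord_eq m (vFun r) 0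
    intro i
    refine ⟨k, ⟨hk, (inFil_vFun hr').congr fun w hw => (c1 w hw).symm, inFil_of_eq_zero c2⟩, ?_⟩
    rw [h3 _ _ c1, h1, Subsingleton.elim i 0]
    exact funext fun j => by rw [Subsingleton.elim j 0, Pi.single_eq_same]

/-! ### Residual finiteness and width -/

theorem exists_relIndex_eq {n : ℕ} (hn : 1 ≤ n) :
    ∃ k ≤ 3, (gamma G (n + 1)).relIndex (gamma G n) = 2 ^ k := by
  rcases (by omega : n = 1 ∨ n = 2 ∨ 3 ≤ n) with rfl | rfl | h3
  · exact ⟨3, le_rfl, lcFactor_one.2⟩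
  · exact ⟨2, by norm_num, lcFactor_two.2⟩
  · have h0 : n - 1 ≠ 0 := by omega
    have hlog : 0 < Nat.log 2 (n - 1) := Nat.log_pos one_lt_two (by omega)
    obtain ⟨m, hm⟩ := Nat.exists_eq_add_of_le' hlog
    have h1 : 2 ^ (m + 1) ≤ n - 1 := hm ▸ Nat.pow_log_le_self 2 h0
    have h2 : n - 1 < 2 ^ (m + 1 + 1) := hm ▸ Nat.lt_pow_succ_log_self one_lt_two (n - 1)
    obtain ⟨r, rfl⟩ : ∃ r, n = 2 ^ (m + 1) + 1 + r := ⟨n - (2 ^ (m + 1) + 1), by omega⟩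
    have hr : r < 2 ^ (m + 1) := by rw [pow_succ] at h2; omega
    rcases lt_or_ge r (2 ^ m) with h | h
    · exact ⟨2, by norm_num, (lcFactor_of_lt h).2⟩
    · exact ⟨1, by norm_num, (lcFactor_of_ge h hr).2⟩

theorem exists_index_gamma_eq (n : ℕ) : ∃ k, (gamma G (n + 1)).index = 2 ^ k := by
  induction n with
  | zero => exact ⟨0, Subgroup.index_top⟩
  | succ n ih =>
    obtain ⟨k, hk⟩ := ih
    obtain ⟨l, -, hl⟩ := exists_relIndex_eq (Nat.succ_pos n)
    have hle : gamma G (n + 1 + 1) ≤ gamma G (n + 1) :=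
      Subgroup.lowerCentralSeries_antitone ⊤ (Nat.le_succ n)
    exact ⟨l + k, by rw [← Subgroup.relIndex_mul_index hle, hl, hk, pow_add]⟩

theorem isResiduallyP_two_G : IsResiduallyP 2 G := by
  intro g hg
  obtain ⟨w, hw⟩ : ∃ w, (g : Equiv.Perm Word) w ≠ w := by
    by_contra! h
    exact hg (Subtype.ext (Equiv.ext h))
  refine ⟨gamma G (2 ^ (w.length + 1) + 1), gamma_normal _ _, exists_index_gamma_eq _,
    fun hmem => ?_⟩
  rw [← mem_gammaG] at hmem
  have h := gammaG_eq_layer w.length (Nat.zero_le _)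
  rw [add_zero, layer_zero] at h
  rw [h] at hmem
  -- `N_{m+1}` fixes the level `m + 2`, hence all words of length at most `m + 2`.
  have hfix := N_succ_le_coordGroup _ hmem
  have key : ∀ k (u : Word), u.length + k = w.length + 2 → (g : Equiv.Perm Word) u = u := by
    intro k
    induction k with
    | zero => exact fun u hu => coordGroup_apply hfix hu
    | succ k ih =>
      intro u hu
      exact apply_of_apply_append hfix.1 (s := 0) (ih (u ++ [0]) (by
        rw [List.length_append, List.length_singleton]; omega))
  exact hw (key 2 w rfl)

theorem hasFiniteCWidth_G : HasFiniteCWidth 2 G := by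
  refine ⟨isResiduallyP_two_G, 2 ^ 3, fun n hn => ?_⟩
  obtain ⟨k, hk, h⟩ := exists_relIndex_eq hn
  rw [h]
  exact ⟨pow_ne_zero k two_ne_zero, Nat.pow_le_pow_right two_pos hk⟩

end Grigorchuk

theorem mainTheorem2 :
    (∀ m : ℕ, 1 ≤ m →
      Grigorchuk.gammaG (2 ^ m + 1) = Grigorchuk.N m ∧
      ∃ (α : Grigorchuk.N m →* Multiplicative (Grigorchuk.V m))
        (β : Grigorchuk.N m →* Multiplicative (Grigorchuk.V (m - 1))),
        Grigorchuk.IsAlphaBeta m α β ∧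
        ∀ r : ℕ, r ≤ 2 ^ m →
          (Grigorchuk.gammaG (2 ^ m + 1 + r) : Set (Equiv.Perm Grigorchuk.Word)) =
            (Grigorchuk.N (m + 1) : Set (Equiv.Perm Grigorchuk.Word)) *
              Grigorchuk.alphaInv α β (Grigorchuk.Vfil m r) *
              Grigorchuk.betaInv α β (Grigorchuk.Vfil (m - 1) r)) ∧
    Grigorchuk.HasRank (Grigorchuk.lcFactor Grigorchuk.G 1) 3 ∧
    Grigorchuk.HasRank (Grigorchuk.lcFactor Grigorchuk.G 2) 2 ∧
    (∀ m r : ℕ, 1 ≤ m → r < 2 ^ (m - 1) →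
      Grigorchuk.HasRank (Grigorchuk.lcFactor Grigorchuk.G (2 ^ m + 1 + r)) 2) ∧
    (∀ m r : ℕ, 1 ≤ m → 2 ^ (m - 1) ≤ r → r < 2 ^ m →
      Grigorchuk.HasRank (Grigorchuk.lcFactor Grigorchuk.G (2 ^ m + 1 + r)) 1) ∧
    Grigorchuk.HasFiniteCWidth 2 Grigorchuk.G := by
  refine ⟨fun m hm => ?_, Grigorchuk.lcFactor_one.1, Grigorchuk.lcFactor_two.1,
    fun m r hm hr => ?_, fun m r hm hr hr' => ?_, Grigorchuk.hasFiniteCWidth_G⟩ <;>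
    obtain ⟨m, rfl⟩ := Nat.exists_eq_add_of_le' hm
  · refine ⟨?_, Grigorchuk.alphaHom m, Grigorchuk.betaHom m, Grigorchuk.isAlphaBeta m,
      fun r hr => ?_⟩
    · rw [← Grigorchuk.layer_zero, ← Grigorchuk.gammaG_eq_layer m (Nat.zero_le _), add_zero]
    · rw [Grigorchuk.gammaG_eq_layer m hr]
      exact Grigorchuk.layer_eq_mul m r
  · exact (Grigorchuk.lcFactor_of_lt hr).1
  · exact (Grigorchuk.lcFactor_of_ge hr hr').1
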